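/- **Operadic model categories.** Let $\mathcal D$ be an operadic model category: a simplicial model category (mapping spaces $\mathrm{Map}(-,-)$, finite simplicial tensors and cotensors, axiom SM7) with a symmetric monoidal product $\otimes$ with unit $\mathbb I$, simplicially enriched (it acts on mapping spaces by maps $\mathrm{Map}(x,y)\times \mathrm{Map}(x',y')\to \mathrm{Map}(x\otimes x',y\otimes y')$ compatible with composition and with the associativity, unit and symmetry isomorphisms), such that: the pushout product axiom for cofibrations holds; the product with an initial object (on either side) is initial; $f\otimes x$ and $x\otimes f$ are weak equivalences whenever $f$ is a weak equivalence and $x$ is cofibrant; for finite simplicial sets $K$, writing $K\cdot x$ for the simplicial tensor, the canonical comparison maps identify $K\cdot x$ with both $x\otimes (K\cdot\mathbb I)$ and $(K\cdot\mathbb I)\otimes x$; and $\mathrm{Map}(\mathbb I,-)$ preserves fibrations and acyclic fibrations. **Weak function objects.** Write $\otimes^{\mathbb L}$ and $\mathbb R\mathrm{Map}$ for the derived tensor product and the derived mapping spaces on $ho(\mathcal D)$. A weak function object is a functor $F\colon ho(\mathcal D)^{op}\times ho(\mathcal D)\to ho(\mathcal D)$ with a natural transformation $\mathbb R\mathrm{Map}(a\otimes^{\mathbb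 L}b,c)\to\mathbb R\mathrm{Map}(a,F(b,c))$ in the homotopy category of spaces. It provides an adjoint for $a\otimes^{\mathbb L}b\to c$ if this map is an isomorphism for these $a,b,c$. A morphism $\eta\colon x\to y$ of $ho(\mathcal D)$ is rigid if $\eta^*\colon F(y,y)\to F(x,y)$ is an isomorphism in $ho(\mathcal D)$. **Operads.** Operads are symmetric operads in simplicial sets, with operations of all arities $n\ge 0$; weak equivalences and fibrations are defined levelwise, and an operad is cofibrant if every map out of it lifts through all acyclic fibrations. $\mathrm{Map}_{operad}$ denotes the simplicial mapping space of operads. For an object $X$ of $\mathcal D$, $\mathrm{End}(X)(n)=\mathrm{Map}(X^{\otimes n},X)$. For a morphism $f\colon X\to Y$ of $\mathcal D$, $\mathrm{End}(f)(n)=\mathrm{Map}(X^{\otimes n},X)\times_{\mathrm{Map}(X^{\otimes n},Y)}\mathrm{Map}(Y^{\otimes n},Y)$, and $\mathrm{End}(f)\to \mathrm{End}(X)$ is the projection. For $\eta\colon x\to y$ in $ho(\mathcal D)$, the map $\mathbb R\mathrm{End}(\eta)\to\mathbb R\mathrm{End}(x)$ is the map $\mathrm{End}(f)\to\mathrm{End}(X)$,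 where $f\colon X\to Y$ is a fibration between cofibrant-fibrant objects of $\mathcal D$ whose image in $ho(\mathcal D)$ is isomorphic, as an arrow, to $\eta$. **Theorem.** Let $F$ be a weak function object for the operadic model category $\mathcal D$, and let $\eta\colon x\to y$ be a rigid morphism of $ho(\mathcal D)$. Suppose that for all $n,m\ge 0$ the weak function object provides adjoints for $$(x^{\otimes^{\mathbb L}n}\otimes^{\mathbb L}y^{\otimes^{\mathbb L}m})\otimes^{\mathbb L}x\to y\qquad\text{and}\qquad (x^{\otimes^{\mathbb L}n}\otimes^{\mathbb L}y^{\otimes^{\mathbb L}m})\otimes^{\mathbb L}y\to y.$$ Then $\eta$ is represented by some fibration $f\colon X\to Y$ between cofibrant-fibrant objects, and for every such representative $f$: 1. the map of operads $\mathrm{End}(f)\to\mathrm{End}(X)$ (that is, $\mathbb R\mathrm{End}(\eta)\to\mathbb R\mathrm{End}(x)$) is a weak equivalence of operads; 2. for every cofibrant operad $\mathcal O$ and every $\mathcal O$-algebra structure $\theta\colon\mathcal O\to\mathrm{End}(X)$, the homotopy fiber over $\theta$ of $$\mathrm{Map}_{operad}(\mathcal O,\mathrm{End}(f))\to\mathrm{Map}_{operad}(\mathcal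 O,\mathrm{End}(X))$$ is contractible. -/

import Mathlib

universe v u

open CategoryTheory MonoidalCategory Opposite HomotopicalAlgebra
open CategoryTheory.SimplicialCategory


noncomputable section

namespace OperadicRigidity

lemma app_congr {K L : SSet.{v}} {f g : K ⟶ L} (h : f = g) (q : SimplexCategoryᵒᵖ) (x : K.obj q) :
    f.app q x = g.app q x := by rw [h]

lemma app_map {K L : SSet.{v}} (f : K ⟶ L) {q r : SimplexCategoryᵒᵖ} (a : q ⟶ r) (x : K.obj q) :
    f.app r (K.map a x) = L.map a (f.app q x) := NatTrans.naturality_apply f a x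

section
variable {D : Type u} [Category.{v} D] [SimplicialCategory D]

/-- `LHom q X Y` is the set of `q`-simplices of the mapping space from `X` to `Y`. -/
def LHom (q : SimplexCategoryᵒᵖ) (X Y : D) : Type v := (sHom X Y).obj q

/-- Composition of `q`-simplices of mapping spaces. -/
def lcomp {q : SimplexCategoryᵒᵖ} {X Y Z : D} (f : LHom q X Y) (g : LHom q Y Z) : LHom q X Z :=
  (sHomComp X Y Z).app q (f, g)

infixr:80 " ≫ₗ " => lcomp

/-- A morphism of `D`, viewed as a (degenerate) `q`-simplex of the mapping space. -/
def degen (q : SimplexCategoryᵒᵖ) {X Y : D} (f : X ⟶ Y) : LHom q X Y :=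
  (eHomEquiv SSet f).app q PUnit.unit

/-- The simplicial structure maps of the mapping spaces. -/
def LHom.op {q r : SimplexCategoryᵒᵖ} (a : q ⟶ r) {X Y : D} (f : LHom q X Y) : LHom r X Y :=
  (sHom X Y).map a f

variable {q r : SimplexCategoryᵒᵖ} {W X Y Z : D}

@[simp] lemma lcomp_assoc (f : LHom q W X) (g : LHom q X Y) (h : LHom q Y Z) :
    (f ≫ₗ g) ≫ₗ h = f ≫ₗ g ≫ₗ h :=
  app_congr (e_assoc SSet W X Y Z) q (f, (g, h))

lemma degen_comp (f : X ⟶ Y) (g : Y ⟶ Z) :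
    degen q (f ≫ g) = degen q f ≫ₗ degen q g := by
  unfold degen; rw [eHomEquiv_comp]; rfl

@[simp] lemma id_lcomp (f : LHom q X Y) : degen q (𝟙 X) ≫ₗ f = f := by
  unfold degen; rw [eHomEquiv_id]; exact app_congr (e_id_comp SSet X Y) q f

@[simp] lemma lcomp_id (f : LHom q X Y) : f ≫ₗ degen q (𝟙 Y) = f := by
  unfold degen; rw [eHomEquiv_id]; exact app_congr (e_comp_id SSet X Y) q f

lemma degen_comp_assoc (f : X ⟶ Y) (g : Y ⟶ Z) {T : D} (h : LHom q Z T) :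
    degen q f ≫ₗ degen q g ≫ₗ h = degen q (f ≫ g) ≫ₗ h := by
  rw [degen_comp, lcomp_assoc]

lemma op_lcomp (a : q ⟶ r) (f : LHom q X Y) (g : LHom q Y Z) :
    (f ≫ₗ g).op a = f.op a ≫ₗ g.op a :=
  (app_map (sHomComp X Y Z) a (f, g)).symm

lemma op_degen (a : q ⟶ r) (f : X ⟶ Y) : (degen q f).op a = degen r f :=
  (app_map (eHomEquiv SSet f) a PUnit.unit).symm

lemma lop_id (f : LHom q X Y) : f.op (𝟙 q) = f := by simp [LHom.op]; rfl

lemma lop_op {s : SimplexCategoryᵒᵖ} (a : q ⟶ r) (b : r ⟶ s) (f : LHom q X Y) :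
    f.op (a ≫ b) = (f.op a).op b := by simp [LHom.op]; rfl

end

/-- A simplicial enrichment of the symmetric monoidal category `D`: the tensor product acts on
mapping spaces, compatibly with simplicial composition, and the
associativity, unit and symmetry isomorphisms are simplicially natural. (Elements of the
mapping spaces are written in each simplicial degree `q`.) -/
class SymmetricMonoidalEnrichment (D : Type u) [Category.{v} D] [SimplicialCategory D]
    [MonoidalCategory D] [SymmetricCategory D] where
  tensorMap (X X' Y Y' : D) : sHom X Y ⊗ sHom X' Y' ⟶ sHom (X ⊗ X') (Y ⊗ Y')
  tensorMap_degen {X X' Y Y' : D} (q : SimplexCategoryᵒᵖ) (f : X ⟶ Y) (f' : X' ⟶ Y') :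
    (tensorMap X X' Y Y').app q (degen q f, degen q f') = degen q (f ⊗ₘ f')
  tensorMap_comp {X X' Y Y' Z Z' : D} {q : SimplexCategoryᵒᵖ} (f : LHom q X Y) (f' : LHom q X' Y')
    (g : LHom q Y Z) (g' : LHom q Y' Z') :
    (tensorMap X X' Z Z').app q (f ≫ₗ g, f' ≫ₗ g') =
      lcomp ((tensorMap X X' Y Y').app q (f, f')) ((tensorMap Y Y' Z Z').app q (g, g'))
  associator_natural {X X' X'' Y Y' Y'' : D} {q : SimplexCategoryᵒᵖ} (f : LHom q X Y)
    (f' : LHom q X' Y') (f'' : LHom q X'' Y'') :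
    lcomp ((tensorMap (X ⊗ X') X'' (Y ⊗ Y') Y'').app q ((tensorMap X X' Y Y').app q (f, f'), f''))
      (degen q (α_ Y Y' Y'').hom) =
    degen q (α_ X X' X'').hom ≫ₗ
      ((tensorMap X (X' ⊗ X'') Y (Y' ⊗ Y'')).app q (f, (tensorMap X' X'' Y' Y'').app q (f', f'')))
  leftUnitor_natural {X Y : D} {q : SimplexCategoryᵒᵖ} (f : LHom q X Y) :
    lcomp ((tensorMap (𝟙_ D) X (𝟙_ D) Y).app q (degen q (𝟙 (𝟙_ D)), f)) (degen q (λ_ Y).hom) =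
      degen q (λ_ X).hom ≫ₗ f
  rightUnitor_natural {X Y : D} {q : SimplexCategoryᵒᵖ} (f : LHom q X Y) :
    lcomp ((tensorMap X (𝟙_ D) Y (𝟙_ D)).app q (f, degen q (𝟙 (𝟙_ D)))) (degen q (ρ_ Y).hom) =
      degen q (ρ_ X).hom ≫ₗ f
  braiding_natural {X X' Y Y' : D} {q : SimplexCategoryᵒᵖ} (f : LHom q X Y) (f' : LHom q X' Y') :
    lcomp ((tensorMap X X' Y Y').app q (f, f')) (degen q (β_ Y Y').hom) =
      degen q (β_ X X').hom ≫ₗ ((tensorMap X' X Y' Y).app q (f', f))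

section
variable {D : Type u} [Category.{v} D] [SimplicialCategory D] [MonoidalCategory D]
  [SymmetricCategory D] [SymmetricMonoidalEnrichment D]

/-- Tensor product of `q`-simplices of mapping spaces. -/
def ltens {q : SimplexCategoryᵒᵖ} {X X' Y Y' : D} (f : LHom q X Y) (f' : LHom q X' Y') :
    LHom q (X ⊗ X') (Y ⊗ Y') :=
  (SymmetricMonoidalEnrichment.tensorMap X X' Y Y').app q (f, f')

infixr:81 " ⊗ₗ " => ltens

variable {q r : SimplexCategoryᵒᵖ} {X X' X'' Y Y' Y'' Z Z' : D}

lemma degen_tens (f : X ⟶ Y) (f' : X' ⟶ Y') : degen q (f ⊗ₘ f') = degen q f ⊗ₗ degen q f' :=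
  (SymmetricMonoidalEnrichment.tensorMap_degen q f f').symm

lemma ltens_comp (f : LHom q X Y) (f' : LHom q X' Y') (g : LHom q Y Z) (g' : LHom q Y' Z') :
    (f ≫ₗ g) ⊗ₗ (f' ≫ₗ g') = (f ⊗ₗ f') ≫ₗ (g ⊗ₗ g') :=
  SymmetricMonoidalEnrichment.tensorMap_comp f f' g g'

lemma lassoc (f : LHom q X Y) (f' : LHom q X' Y') (f'' : LHom q X'' Y'') :
    ((f ⊗ₗ f') ⊗ₗ f'') ≫ₗ degen q (α_ Y Y' Y'').hom =
      degen q (α_ X X' X'').hom ≫ₗ (f ⊗ₗ f' ⊗ₗ f'') :=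
  SymmetricMonoidalEnrichment.associator_natural f f' f''

lemma lunit (f : LHom q X Y) :
    (degen q (𝟙 (𝟙_ D)) ⊗ₗ f) ≫ₗ degen q (λ_ Y).hom = degen q (λ_ X).hom ≫ₗ f :=
  SymmetricMonoidalEnrichment.leftUnitor_natural f

lemma runit (f : LHom q X Y) :
    (f ⊗ₗ degen q (𝟙 (𝟙_ D))) ≫ₗ degen q (ρ_ Y).hom = degen q (ρ_ X).hom ≫ₗ f :=
  SymmetricMonoidalEnrichment.rightUnitor_natural f

lemma lbraid (f : LHom q X Y) (f' : LHom q X' Y') :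
    (f ⊗ₗ f') ≫ₗ degen q (β_ Y Y').hom = degen q (β_ X X').hom ≫ₗ (f' ⊗ₗ f) :=
  SymmetricMonoidalEnrichment.braiding_natural f f'

lemma op_ltens (a : q ⟶ r) (f : LHom q X Y) (f' : LHom q X' Y') :
    (f ⊗ₗ f').op a = f.op a ⊗ₗ f'.op a :=
  (app_map (SymmetricMonoidalEnrichment.tensorMap X X' Y Y') a (f, f')).symm

end
section Coherence

variable {D : Type u} [Category.{v} D] [MonoidalCategory D] {ι κ : Type}

/-- The right-bracketed tensor product of the objects labelled by a list. -/
def tl (X : ι → D) : List ι → D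
  | [] => 𝟙_ D
  | a :: L => X a ⊗ tl X L

/-- Formal composites of transpositions of adjacent, distinct labels. -/
inductive Pm : List ι → List ι → Type
  | nil : Pm [] []
  | cons (a : ι) {L L' : List ι} (p : Pm L L') : Pm (a :: L) (a :: L')
  | swap (a b : ι) (L : List ι) (h : a ≠ b) : Pm (a :: b :: L) (b :: a :: L)
  | trans {L L' L'' : List ι} (p : Pm L L') (p' : Pm L' L'') : Pm L L''

/-- The identity. -/
def Pm.refl : ∀ L : List ι, Pm L L
  | [] => .nil
  | a :: L => .cons a (Pm.refl L)

/-- The inverse. -/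
def Pm.symm : ∀ {L L' : List ι}, Pm L L' → Pm L' L
  | _, _, .nil => .nil
  | _, _, .cons a p => .cons a p.symm
  | _, _, .swap a b L h => .swap b a L h.symm
  | _, _, .trans p p' => .trans p'.symm p.symm

lemma Pm.exists_of_perm {L L' : List ι} (h : L.Perm L') (hL : L.Nodup) : Nonempty (Pm L L') := by
  induction h with
  | nil => exact ⟨.nil⟩
  | cons a _ ih => obtain ⟨p⟩ := ih (List.nodup_cons.1 hL).2; exact ⟨.cons a p⟩
  | swap a b L =>
    refine ⟨.swap b a L ?_⟩
    rintro rfl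
    simp at hL
  | trans h1 _ ih1 ih2 =>
    obtain ⟨p⟩ := ih1 hL
    obtain ⟨p'⟩ := ih2 (h1.nodup_iff.1 hL)
    exact ⟨.trans p p'⟩

/-- Extraction of a label to the front of a list. -/
inductive Fr (a : ι) : List ι → List ι → Type
  | here (L : List ι) : Fr a (a :: L) L
  | there (b : ι) {L M : List ι} (h : a ≠ b) (f : Fr a L M) : Fr a (b :: L) (b :: M)

lemma Fr.eq {a : ι} : ∀ {L M M' : List ι} (f : Fr a L M) (f' : Fr a L M'), M = M' ∧ HEq f f'
  | _, _, _, .here L, .here _ => ⟨rfl, HEq.rfl⟩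
  | _, _, _, .here L, .there _ h _ => (h rfl).elim
  | _, _, _, .there _ h _, .here _ => (h rfl).elim
  | _, _, _, .there b h f, .there _ _ f' => by
      obtain ⟨rfl, h⟩ := Fr.eq f f'
      cases h
      exact ⟨rfl, HEq.rfl⟩

variable [SymmetricCategory D]

/-- Exchange of two factors. -/
def sw (A B C : D) : A ⊗ (B ⊗ C) ⟶ B ⊗ (A ⊗ C) :=
  (α_ A B C).inv ≫ (β_ A B).hom ▷ C ≫ (α_ B A C).hom

lemma sw_sw (A B C : D) : sw A B C ≫ sw B A C = 𝟙 _ := by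
  simp [sw, ← comp_whiskerRight_assoc]

lemma sw_natural (A B : D) {C C' : D} (f : C ⟶ C') :
    A ◁ B ◁ f ≫ sw A B C' = sw A B C ≫ B ◁ A ◁ f := by
  simp only [sw, associator_inv_naturality_right_assoc, Category.assoc,
    whisker_exchange_assoc, associator_naturality_right]

lemma sw_braid (A B C E : D) :
    sw A B (C ⊗ E) ≫ B ◁ sw A C E ≫ sw B C (A ⊗ E) =
      A ◁ sw B C E ≫ sw A C (B ⊗ E) ≫ C ◁ sw A B E := by
  have h := congrArg (fun t => 𝟙 (A ⊗ B ⊗ C ⊗ E) ⊗≫ t ▷ E ⊗≫ 𝟙 (C ⊗ B ⊗ A ⊗ E))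
    (BraidedCategory.yang_baxter' A B C)
  calc _ = 𝟙 _ ⊗≫ ((β_ A B).hom ▷ C ⊗≫ B ◁ (β_ A C).hom ⊗≫ (β_ B C).hom ▷ A) ▷ E ⊗≫ 𝟙 _ := by
        simp only [sw]; monoidal
    _ = _ := h.trans (by simp only [sw]; monoidal)

lemma move_cons {A B L L' M M' : D} {p : L ⟶ L'} {f' : L' ⟶ B ⊗ M'} {f : L ⟶ B ⊗ M}
    {p' : M ⟶ M'} (e : p ≫ f' = f ≫ B ◁ p') :
    A ◁ p ≫ (A ◁ f' ≫ sw A B M') = (A ◁ f ≫ sw A B M) ≫ B ◁ A ◁ p' := by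
  rw [Category.assoc, ← sw_natural, ← whiskerLeft_comp_assoc, ← whiskerLeft_comp_assoc, e]

lemma move_swap (A B C : D) {L M : D} (f : L ⟶ C ⊗ M) :
    sw A B L ≫ B ◁ (A ◁ f ≫ sw A C M) ≫ sw B C (A ⊗ M) =
      (A ◁ (B ◁ f ≫ sw B C M) ≫ sw A C (B ⊗ M)) ≫ C ◁ sw A B M := by
  simp only [whiskerLeft_comp, Category.assoc]
  rw [← sw_braid, ← Category.assoc, ← sw_natural, Category.assoc]

/-- The isomorphism given by a formal composite of transpositions. -/
def Pm.ev (X : ι → D) : ∀ {L L' : List ι}, Pm L L' → (tl X L ⟶ tl X L')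
  | _, _, .nil => 𝟙 _
  | _, _, .cons a p => X a ◁ p.ev X
  | _, _, .swap a b L _ => sw (X a) (X b) (tl X L)
  | _, _, .trans p p' => p.ev X ≫ p'.ev X

/-- The isomorphism moving a factor to the front. -/
def Fr.ev (X : ι → D) {a : ι} : ∀ {L M : List ι}, Fr a L M → (tl X L ⟶ X a ⊗ tl X M)
  | _, _, .here _ => 𝟙 _
  | _, _, .there b (M := M) _ f => X b ◁ f.ev X ≫ sw (X b) (X a) (tl X M)

@[simp] lemma Pm.ev_refl (X : ι → D) : ∀ L : List ι, (Pm.refl L).ev X = 𝟙 _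
  | [] => rfl
  | a :: L => by simp [Pm.refl, Pm.ev, Pm.ev_refl X L, tl]

lemma Pm.move (X : ι → D) {a : ι} : ∀ {L L' M' : List ι} (p : Pm L L') (f' : Fr a L' M'),
    ∃ (M : List ι) (f : Fr a L M) (p' : Pm M M'), p.ev X ≫ f'.ev X = f.ev X ≫ X a ◁ p'.ev X
  | _, _, _, .nil, f' => nomatch f'
  | _, _, _, .cons _ p, .here _ =>
      ⟨_, .here _, p, (Category.comp_id (X a ◁ p.ev X)).trans (Category.id_comp _).symm⟩
  | _, _, _, .cons b p, .there _ h f' => by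
      obtain ⟨M, f, p', e⟩ := Pm.move X p f'
      exact ⟨_, .there b h f, .cons b p', move_cons e⟩
  | _, _, _, .swap x y L h, f' => by
      cases f' with
      | here =>
        refine ⟨_, .there x h.symm (.here _), .refl _, ?_⟩
        have : sw (X x) (X a) (tl X L) ≫ 𝟙 _ =
          (X x ◁ 𝟙 _ ≫ sw (X x) (X a) (tl X L)) ≫ X a ◁ 𝟙 _ := by simp
        rw [Pm.ev_refl]; exact this
      | there _ h' f' =>
        cases f' with
        | here =>
          refine ⟨_, .here _, .refl _, ?_⟩
          have : sw (X a) (X y) (tl X L) ≫ (X y ◁ 𝟙 _ ≫ sw (X y) (X a) (tl X L)) =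
            𝟙 _ ≫ X a ◁ 𝟙 _ := by simp [sw_sw]
          rw [Pm.ev_refl]; exact this
        | there _ h'' f =>
          exact ⟨_, .there x h'' (.there y h' f), .swap x y _ h,
            move_swap (X x) (X y) (X a) (f.ev X)⟩
  | _, _, _, .trans p p', f' => by
      obtain ⟨M, f, q, e⟩ := Pm.move X p' f'
      obtain ⟨M', f', q', e'⟩ := Pm.move X p f
      exact ⟨M', f', .trans q' q, by simp [Pm.ev, e, reassoc_of% e']⟩

lemma Pm.ev_nil (X : ι → D) : ∀ {L L' : List ι} (p : Pm L L'), L' = [] →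
    ∃ h : L = L', p.ev X = eqToHom (by rw [h])
  | _, _, .nil, _ => ⟨rfl, rfl⟩
  | _, _, .trans p p', h => by
      obtain ⟨rfl, e⟩ := Pm.ev_nil X p' h
      obtain ⟨rfl, e'⟩ := Pm.ev_nil X p h
      exact ⟨rfl, by simp [Pm.ev, e, e']⟩

/-- Coherence: formal composites of transpositions of distinct labels with the same source and
target have the same value. -/
theorem Pm.ev_unique (X : ι → D) : ∀ {L' L : List ι} (p q : Pm L L'), p.ev X = q.ev X
  | [], _, p, q => by
      obtain ⟨rfl, e⟩ := Pm.ev_nil X p rfl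
      obtain ⟨_, e'⟩ := Pm.ev_nil X q rfl
      rw [e, e']
  | a :: L', _, p, q => by
      obtain ⟨M, f, p', e⟩ := Pm.move X p (.here _)
      obtain ⟨M', f', q', e'⟩ := Pm.move X q (.here _)
      obtain ⟨rfl, h⟩ := Fr.eq f f'
      cases h
      have := Pm.ev_unique X p' q'
      simp only [Fr.ev] at e e'
      rw [← Category.comp_id (p.ev X), ← Category.comp_id (q.ev X)]
      exact e.trans ((by rw [this] : _ = _).trans e'.symm)

lemma Pm.ev_symm (X : ι → D) {L L' : List ι} (p : Pm L L') : p.ev X ≫ p.symm.ev X = 𝟙 _ := by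
  rw [← Pm.ev_refl X L]
  exact Pm.ev_unique X (.trans p p.symm) (.refl _)

lemma Pm.symm_ev (X : ι → D) {L L' : List ι} (p : Pm L L') : p.symm.ev X ≫ p.ev X = 𝟙 _ := by
  rw [← Pm.ev_refl X L']
  exact Pm.ev_unique X (.trans p.symm p) (.refl _)


/-! Canonical morphisms -/

def Pm.appendRight (M : List ι) : ∀ {L L' : List ι}, Pm L L' → Pm (L ++ M) (L' ++ M)
  | _, _, .nil => .refl M
  | _, _, .cons a p => .cons a (p.appendRight M)
  | _, _, .swap a b L h => .swap a b (L ++ M) h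
  | _, _, .trans p p' => .trans (p.appendRight M) (p'.appendRight M)

def Pm.appendLeft {M M' : List ι} (q : Pm M M') : ∀ L : List ι, Pm (L ++ M) (L ++ M')
  | [] => q
  | a :: L => .cons a (q.appendLeft L)

def Pm.appendAssoc : ∀ L M N : List ι, Pm ((L ++ M) ++ N) (L ++ (M ++ N))
  | [], M, N => .refl (M ++ N)
  | a :: L, M, N => .cons a (Pm.appendAssoc L M N)

def Pm.appendNil : ∀ L : List ι, Pm (L ++ []) L
  | [] => .nil
  | a :: L => .cons a (Pm.appendNil L)

/-- Concatenation of right-bracketed tensor products. -/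
def app (X : ι → D) : ∀ L L' : List ι, tl X L ⊗ tl X L' ≅ tl X (L ++ L')
  | [], L' => λ_ (tl X L')
  | a :: L, L' => α_ (X a) (tl X L) (tl X L') ≪≫ whiskerLeftIso (X a) (app X L L')

lemma appendRight_ev_cons {A P P' M Q Q' : D} {p : P ⟶ P'} {f : P ⊗ M ⟶ Q} {f' : P' ⊗ M ⟶ Q'}
    {q : Q ⟶ Q'} (e : p ▷ M ≫ f' = f ≫ q) :
    (A ◁ p) ▷ M ≫ ((α_ A P' M).hom ≫ A ◁ f') = ((α_ A P M).hom ≫ A ◁ f) ≫ A ◁ q := by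
  simp only [whisker_assoc, Category.assoc, Iso.inv_hom_id_assoc, ← whiskerLeft_comp, e]

lemma appendRight_ev_swap {A B P M Q : D} (f : P ⊗ M ⟶ Q) :
    sw A B P ▷ M ≫ ((α_ B (A ⊗ P) M).hom ≫ B ◁ ((α_ A P M).hom ≫ A ◁ f)) =
      ((α_ A (B ⊗ P) M).hom ≫ A ◁ ((α_ B P M).hom ≫ B ◁ f)) ≫ sw A B Q := by
  have : sw A B P ▷ M ≫ (α_ B (A ⊗ P) M).hom ≫ B ◁ (α_ A P M).hom =
    (α_ A (B ⊗ P) M).hom ≫ A ◁ (α_ B P M).hom ≫ sw A B (P ⊗ M) := by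
    simp only [sw]; monoidal
  simp only [whiskerLeft_comp, Category.assoc, sw_natural]
  rw [reassoc_of% this]

lemma Pm.appendRight_ev (X : ι → D) (M : List ι) : ∀ {L L' : List ι} (p : Pm L L'),
    p.ev X ▷ tl X M ≫ (app X L' M).hom = (app X L M).hom ≫ (p.appendRight M).ev X
  | _, _, .nil => by
      have : (𝟙 (𝟙_ D)) ▷ tl X M ≫ (λ_ (tl X M)).hom = (λ_ (tl X M)).hom ≫ 𝟙 _ := by simp
      exact this.trans (congrArg (fun t => (λ_ (tl X M)).hom ≫ t) (Pm.ev_refl X M).symm)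
  | _, _, .cons a p => appendRight_ev_cons (p.appendRight_ev X M)
  | _, _, .swap a b L h => appendRight_ev_swap (app X L M).hom
  | _, _, .trans p p' => by
      have h1 := p.appendRight_ev X M
      have h2 := p'.appendRight_ev X M
      simp only [Pm.ev, Pm.appendRight, comp_whiskerRight, Category.assoc]
      rw [h2, reassoc_of% h1]

lemma Pm.appendLeft_ev (X : ι → D) {M M' : List ι} (q : Pm M M') : ∀ L : List ι,
    tl X L ◁ q.ev X ≫ (app X L M').hom = (app X L M).hom ≫ (q.appendLeft L).ev X
  | [] => leftUnitor_naturality _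
  | a :: L => by
      have h := q.appendLeft_ev X L
      have : (X a ⊗ tl X L) ◁ q.ev X ≫ ((α_ (X a) (tl X L) (tl X M')).hom ≫
        X a ◁ (app X L M').hom) = ((α_ (X a) (tl X L) (tl X M)).hom ≫
        X a ◁ (app X L M).hom) ≫ X a ◁ (q.appendLeft L).ev X := by
        simp only [tensor_whiskerLeft, Category.assoc, Iso.inv_hom_id_assoc, ← whiskerLeft_comp, h]
      exact this

lemma Pm.appendAssoc_ev (X : ι → D) : ∀ L M N : List ι,
    (α_ (tl X L) (tl X M) (tl X N)).hom ≫ tl X L ◁ (app X M N).hom ≫ (app X L (M ++ N)).hom =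
      (app X L M).hom ▷ tl X N ≫ (app X (L ++ M) N).hom ≫ (Pm.appendAssoc L M N).ev X
  | [], M, N => by
      have : (α_ (𝟙_ D) (tl X M) (tl X N)).hom ≫ 𝟙_ D ◁ (app X M N).hom ≫ (λ_ _).hom =
        (λ_ (tl X M)).hom ▷ tl X N ≫ (app X M N).hom ≫ 𝟙 _ := by simp
      exact this.trans (congrArg (fun t => (λ_ (tl X M)).hom ▷ tl X N ≫ (app X M N).hom ≫ t)
        (Pm.ev_refl X (M ++ N)).symm)
  | a :: L, M, N => by
      have h := Pm.appendAssoc_ev X L M N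
      have : (α_ (X a ⊗ tl X L) (tl X M) (tl X N)).hom ≫ (X a ⊗ tl X L) ◁ (app X M N).hom ≫
          ((α_ (X a) (tl X L) (tl X (M ++ N))).hom ≫ X a ◁ (app X L (M ++ N)).hom) =
        ((α_ (X a) (tl X L) (tl X M)).hom ≫ X a ◁ (app X L M).hom) ▷ tl X N ≫
          ((α_ (X a) (tl X (L ++ M)) (tl X N)).hom ≫ X a ◁ (app X (L ++ M) N).hom) ≫
          X a ◁ (Pm.appendAssoc L M N).ev X := by
        simp only [tensor_whiskerLeft, comp_whiskerRight, whisker_assoc, Category.assoc,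
          Iso.inv_hom_id_assoc, ← whiskerLeft_comp, ← h]
        simp
      exact this

lemma appendNil_ev_cons {A B C : D} {f : B ⊗ 𝟙_ D ⟶ C} {g : C ⟶ B} (h : (ρ_ B).hom = f ≫ g) :
    (ρ_ (A ⊗ B)).hom = ((α_ A B (𝟙_ D)).hom ≫ A ◁ f) ≫ A ◁ g := by
  rw [Category.assoc, ← whiskerLeft_comp, ← h]; simp

lemma Pm.appendNil_ev (X : ι → D) : ∀ L : List ι,
    (ρ_ (tl X L)).hom = (app X L []).hom ≫ (Pm.appendNil L).ev X
  | [] => by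
      have : (ρ_ (𝟙_ D)).hom = (λ_ (𝟙_ D)).hom ≫ 𝟙 _ := by simp [unitors_equal]
      exact this
  | _ :: L => appendNil_ev_cons (Pm.appendNil_ev X L)

variable {X : ι → D} {A A' A'' B B' B'' C : D} {L L' L'' M M' N : List ι}

/-- `Can a b f` means that, under the identifications `a` and `b`, the morphism `f` is a
composite of symmetries permuting the labels. -/
def Can (a : A ≅ tl X L) (b : B ≅ tl X L') (f : A ⟶ B) : Prop :=
  ∃ p : Pm L L', f ≫ b.hom = a.hom ≫ p.ev X

lemma Can.unique {a : A ≅ tl X L} {b : B ≅ tl X L'} {f g : A ⟶ B} (hf : Can a b f)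
    (hg : Can a b g) : f = g := by
  obtain ⟨p, hp⟩ := hf
  obtain ⟨q, hq⟩ := hg
  rw [← cancel_mono b.hom, hp, hq, Pm.ev_unique X p q]

lemma Can.id (a : A ≅ tl X L) : Can a a (𝟙 A) := ⟨.refl L, by simp⟩

lemma Can.comp {a : A ≅ tl X L} {b : A' ≅ tl X L'} {c : A'' ≅ tl X L''} {f : A ⟶ A'}
    {g : A' ⟶ A''} (hf : Can a b f) (hg : Can b c g) : Can a c (f ≫ g) := by
  obtain ⟨p, hp⟩ := hf
  obtain ⟨q, hq⟩ := hg
  exact ⟨.trans p q, by simp [Pm.ev, hq, reassoc_of% hp]⟩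

lemma Can.inv {a : A ≅ tl X L} {b : B ≅ tl X L'} {e : A ≅ B} (h : Can a b e.hom) :
    Can b a e.inv := by
  obtain ⟨p, hp⟩ := h
  refine ⟨p.symm, ?_⟩
  rw [← cancel_epi e.hom, reassoc_of% hp, Pm.ev_symm]; simp

/-- Tensor product of identifications. -/
def dt (a : A ≅ tl X L) (b : B ≅ tl X L') : A ⊗ B ≅ tl X (L ++ L') := (a ⊗ᵢ b) ≪≫ app X L L'

lemma Can.tens {a : A ≅ tl X L} {a' : A' ≅ tl X L'} {b : B ≅ tl X M} {b' : B' ≅ tl X M'}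
    {f : A ⟶ A'} {g : B ⟶ B'} (hf : Can a a' f) (hg : Can b b' g) :
    Can (dt a b) (dt a' b') (f ⊗ₘ g) := by
  obtain ⟨p, hp⟩ := hf
  obtain ⟨q, hq⟩ := hg
  refine ⟨.trans (p.appendRight M) (q.appendLeft L'), ?_⟩
  simp only [dt, Iso.trans_hom, tensorIso_hom, tensorHom_comp_tensorHom_assoc, hp, hq,
    Pm.ev, Category.assoc]
  rw [← reassoc_of% (Pm.appendRight_ev X M p), ← Pm.appendLeft_ev,
    ← tensorHom_comp_tensorHom_assoc, tensorHom_def (p.ev X), Category.assoc]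

lemma assoc_aux {A B C A' B' C' E F G H : D} (a : A ⟶ A') (b : B ⟶ B') (c : C ⟶ C')
    {f : B' ⊗ C' ⟶ E} {g : A' ⊗ E ⟶ F} {f' : A' ⊗ B' ⟶ G} {g' : G ⊗ C' ⟶ H} {k : H ⟶ F}
    (h : (α_ A' B' C').hom ≫ A' ◁ f ≫ g = f' ▷ C' ≫ g' ≫ k) :
    (α_ A B C).hom ≫ (a ⊗ₘ ((b ⊗ₘ c) ≫ f)) ≫ g = ((((a ⊗ₘ b) ≫ f') ⊗ₘ c) ≫ g') ≫ k := by
  have h1 : a ⊗ₘ ((b ⊗ₘ c) ≫ f) = (a ⊗ₘ b ⊗ₘ c) ≫ A' ◁ f := by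
    rw [← id_tensorHom, tensorHom_comp_tensorHom, Category.comp_id]
  have h2 : ((a ⊗ₘ b) ≫ f') ⊗ₘ c = ((a ⊗ₘ b) ⊗ₘ c) ≫ f' ▷ C' := by
    rw [← tensorHom_id, tensorHom_comp_tensorHom, Category.comp_id]
  rw [h1, h2, Category.assoc, Category.assoc, Category.assoc, ← h, associator_naturality_assoc]

lemma Can.assoc (a : A ≅ tl X L) (b : B ≅ tl X M) (c : C ≅ tl X N) :
    Can (dt (dt a b) c) (dt a (dt b c)) (α_ A B C).hom :=
  ⟨.appendAssoc L M N, assoc_aux a.hom b.hom c.hom (Pm.appendAssoc_ev X L M N)⟩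

/-- The empty product. -/
def dnil (X : ι → D) : 𝟙_ D ≅ tl X [] := Iso.refl (𝟙_ D)

lemma Can.lunit (a : A ≅ tl X L) : Can (dt (dnil X) a) a (λ_ A).hom := by
  refine ⟨.refl L, ?_⟩
  have : (λ_ A).hom ≫ a.hom = ((𝟙 (𝟙_ D) ⊗ₘ a.hom) ≫ (λ_ _).hom) ≫ 𝟙 _ := by simp
  exact this.trans (congrArg (fun t => ((𝟙 (𝟙_ D) ⊗ₘ a.hom) ≫ (λ_ (tl X L)).hom) ≫ t)
    (Pm.ev_refl X L).symm)

lemma Can.runit (a : A ≅ tl X L) : Can (dt a (dnil X)) a (ρ_ A).hom := by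
  refine ⟨.appendNil L, ?_⟩
  have : (ρ_ A).hom ≫ a.hom = (a.hom ⊗ₘ 𝟙 (𝟙_ D)) ≫ (ρ_ (tl X L)).hom := by simp
  rw [this, Pm.appendNil_ev]
  exact (Category.assoc _ _ _).symm


lemma Can.pre (e : B ≅ A) (a : A ≅ tl X L) : Can (e ≪≫ a) a e.hom := ⟨.refl L, by simp⟩

lemma Can.hom (a : A ≅ tl X L) : Can a (Iso.refl _) a.hom := ⟨.refl L, by simp⟩

lemma Can.cast {a : A ≅ tl X L} {b : B ≅ tl X L'} {f g : A ⟶ B} (hf : Can a b f) (h : f = g) :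
    Can a b g := h ▸ hf

/-- A one-fold product. -/
def ds (X : ι → D) (a : ι) : X a ≅ tl X [a] := (ρ_ (X a)).symm

lemma dt_ds (X : ι → D) (a : ι) (L : List ι) :
    dt (ds X a) (Iso.refl (tl X L)) = Iso.refl (tl X (a :: L)) := by
  ext
  have : ((ρ_ (X a)).inv ⊗ₘ 𝟙 (tl X L)) ≫ (α_ (X a) (𝟙_ D) (tl X L)).hom ≫
    X a ◁ (λ_ (tl X L)).hom = 𝟙 _ := by simp
  exact this

lemma Can.braid_symm {a : A ≅ tl X L} {b : B ≅ tl X M} (h : Can (dt a b) (dt b a) (β_ A B).hom) :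
    Can (dt b a) (dt a b) (β_ B A).hom :=
  h.inv.cast (by rw [← cancel_epi (β_ A B).hom]; simp)

lemma Can.braid_tens {a : A ≅ tl X L} {b : B ≅ tl X M} {c : C ≅ tl X N}
    (h : Can (dt a b) (dt b a) (β_ A B).hom) (h' : Can (dt a c) (dt c a) (β_ A C).hom) :
    Can (dt a (dt b c)) (dt (dt b c) a) (β_ A (B ⊗ C)).hom := by
  refine ((Can.assoc a b c).inv.comp ((h.tens (.id c)).comp ((Can.assoc b a c).comp
    ((Can.tens (.id b) h').comp (Can.assoc b c a).inv)))).cast ?_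
  simp

lemma Can.braid_single (X : ι → D) (a b : ι) (h : a ≠ b) :
    Can (dt (ds X a) (ds X b)) (dt (ds X b) (ds X a)) (β_ (X a) (X b)).hom := by
  refine ⟨.swap a b [] h, ?_⟩
  have key (A B : D) : ((ρ_ A).inv ⊗ₘ (ρ_ B).inv) ≫ (α_ A (𝟙_ D) (B ⊗ 𝟙_ D)).hom ≫
      A ◁ (λ_ (B ⊗ 𝟙_ D)).hom = A ◁ (ρ_ B).inv := by
    rw [tensorHom_def']; simp
  have : (β_ (X a) (X b)).hom ≫ (((ρ_ (X b)).inv ⊗ₘ (ρ_ (X a)).inv) ≫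
      (α_ (X b) (𝟙_ D) (X a ⊗ 𝟙_ D)).hom ≫ X b ◁ (λ_ (X a ⊗ 𝟙_ D)).hom) =
    (((ρ_ (X a)).inv ⊗ₘ (ρ_ (X b)).inv) ≫
      (α_ (X a) (𝟙_ D) (X b ⊗ 𝟙_ D)).hom ≫ X a ◁ (λ_ (X b ⊗ 𝟙_ D)).hom) ≫
      sw (X a) (X b) (𝟙_ D) := by
    rw [key, key]
    simp only [sw]
    have h1 : X a ◁ (ρ_ (X b)).inv ≫ (α_ (X a) (X b) (𝟙_ D)).inv = (ρ_ (X a ⊗ X b)).inv := by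
      simp
    have h2 : (ρ_ (X b ⊗ X a)).inv ≫ (α_ (X b) (X a) (𝟙_ D)).hom = X b ◁ (ρ_ (X a)).inv := by
      simp
    rw [reassoc_of% h1, ← h2, rightUnitor_inv_naturality_assoc]
  exact this

lemma Can.braid_cons (X : ι → D) (a : ι) : ∀ M : List ι, (∀ b ∈ M, a ≠ b) →
    Can (dt (ds X a) (Iso.refl (tl X M))) (dt (Iso.refl (tl X M)) (ds X a))
      (β_ (X a) (tl X M)).hom
  | [], _ => ((Can.runit (ds X a)).comp (Can.lunit (ds X a)).inv).cast
      (braiding_tensorUnit_right (X a)).symm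
  | b :: M, h => by
      have := (Can.braid_single X a b (h b (by simp))).braid_tens
        (Can.braid_cons X a M fun c hc => h c (by simp [hc]))
      rw [dt_ds X b M] at this
      exact this

lemma Can.braid_refl (X : ι → D) (M : List ι) : ∀ L : List ι, (∀ a ∈ L, ∀ b ∈ M, a ≠ b) →
    Can (dt (Iso.refl (tl X L)) (Iso.refl (tl X M))) (dt (Iso.refl (tl X M)) (Iso.refl (tl X L)))
      (β_ (tl X L) (tl X M)).hom
  | [], _ => ((Can.lunit _).comp (Can.runit _).inv).cast (braiding_tensorUnit_left _).symm
  | a :: L, h => by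
      have := ((Can.braid_cons X a M (h a (by simp))).braid_symm.braid_tens
        (Can.braid_refl X M L fun c hc => h c (by simp [hc])).braid_symm).braid_symm
      rw [dt_ds X a L] at this
      exact this

lemma Can.braid (a : A ≅ tl X L) (b : B ≅ tl X M) (h : ∀ x ∈ L, ∀ y ∈ M, x ≠ y) :
    Can (dt a b) (dt b a) (β_ A B).hom := by
  refine (((Can.hom a).tens (Can.hom b)).comp ((Can.braid_refl X M L h).comp
    (Can.inv (e := b ⊗ᵢ a) ((Can.hom b).tens (Can.hom a))))).cast ?_
  rw [← Category.assoc, BraidedCategory.braiding_naturality, Category.assoc]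
  simp

/-- Concatenation of the lists `M a`, for `a` in a list. -/
def fm (M : ι → List κ) : List ι → List κ
  | [] => []
  | a :: L => M a ++ fm M L

/-- Substitution of products into a product. -/
def dl {X : κ → D} {Y : ι → D} {M : ι → List κ} (y : ∀ i, Y i ≅ tl X (M i)) :
    ∀ L : List ι, tl Y L ≅ tl X (fm M L)
  | [] => Iso.refl (𝟙_ D)
  | a :: L => dt (y a) (dl y L)

section
variable {X : κ → D} {Y : ι → D} {M : ι → List κ} (y : ∀ i, Y i ≅ tl X (M i))

lemma Can.sub_ev (h : ∀ i j, i ≠ j → ∀ a ∈ M i, ∀ b ∈ M j, a ≠ b) : ∀ {L L' : List ι}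
    (p : Pm L L'), Can (dl y L) (dl y L') (p.ev Y)
  | _, _, .nil => Can.id _
  | _, _, .cons a p => ((Can.id (y a)).tens (Can.sub_ev h p)).cast (id_tensorHom _ _)
  | _, _, .swap a b L hab =>
      ((Can.assoc (y a) (y b) (dl y L)).inv.comp (((Can.braid (y a) (y b) (h a b hab)).tens
        (Can.id (dl y L))).comp (Can.assoc (y b) (y a) (dl y L)))).cast (by simp; rfl)
  | _, _, .trans p p' => (Can.sub_ev h p).comp (Can.sub_ev h p')

lemma Can.sub (h : ∀ i j, i ≠ j → ∀ a ∈ M i, ∀ b ∈ M j, a ≠ b) {L L' : List ι} {w : A ≅ tl Y L}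
    {w' : A' ≅ tl Y L'} {f : A ⟶ A'} (hf : Can w w' f) :
    Can (w ≪≫ dl y L) (w' ≪≫ dl y L') f := by
  obtain ⟨p, hp⟩ := hf
  obtain ⟨q, hq⟩ := Can.sub_ev y h p
  exact ⟨q, by simp [reassoc_of% hp, hq]⟩

lemma Can.dl_app : ∀ L L' : List ι,
    Can (app Y L L' ≪≫ dl y (L ++ L')) (dt (dl y L) (dl y L')) (𝟙 _)
  | [], L' => ((Can.pre (λ_ (tl Y L')) (dl y L')).comp (Can.lunit (dl y L')).inv).cast (by simp; rfl)
  | a :: L, L' => by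
      have h := (Can.pre (α_ (Y a) (tl Y L) (tl Y L')) (dt (y a) (app Y L L' ≪≫ dl y (L ++ L')))).comp
        (((Can.id (y a)).tens (Can.dl_app L L')).comp (Can.assoc (y a) (dl y L) (dl y L')).inv)
      have e : app Y (a :: L) L' ≪≫ dl y (a :: L ++ L') =
          α_ (Y a) (tl Y L) (tl Y L') ≪≫ dt (y a) (app Y L L' ≪≫ dl y (L ++ L')) := by
        ext
        have : ((α_ (Y a) (tl Y L) (tl Y L')).hom ≫ Y a ◁ (app Y L L').hom) ≫
          (((y a).hom ⊗ₘ (dl y (L ++ L')).hom) ≫ (app X (M a) (fm M (L ++ L'))).hom) =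
          (α_ (Y a) (tl Y L) (tl Y L')).hom ≫ ((y a).hom ⊗ₘ ((app Y L L').hom ≫
            (dl y (L ++ L')).hom)) ≫ (app X (M a) (fm M (L ++ L'))).hom := by
          rw [← id_tensorHom, Category.assoc, tensorHom_comp_tensorHom_assoc, Category.id_comp]
        exact this
      rw [e]
      exact h.cast (by simp; rfl)

lemma Can.dl_dt {L L' : List ι} (w : A ≅ tl Y L) (z : B ≅ tl Y L') :
    Can (dt w z ≪≫ dl y (L ++ L')) (dt (w ≪≫ dl y L) (z ≪≫ dl y L')) (𝟙 _) := by
  obtain ⟨p, hp⟩ := Can.dl_app y L L'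
  refine ⟨p, ?_⟩
  simp only [Category.id_comp, Iso.trans_hom, dt, tensorIso_hom] at hp
  simp only [dt, Iso.trans_hom, tensorIso_hom, Category.id_comp, Category.assoc]
  rw [← tensorHom_comp_tensorHom_assoc, hp, Category.assoc]

lemma Can.dl_ds (a : ι) : Can (y a) (ds Y a ≪≫ dl y [a]) (𝟙 _) :=
  Can.inv (e := Iso.refl _) (((Can.pre (ds Y a) (dl y [a])).comp (Can.runit (y a))).cast
    (Iso.inv_hom_id _))
end

/-- The right-bracketed tensor product of a finite sequence of objects. -/
def tpr : ∀ n : ℕ, (Fin n → D) → D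
  | 0, _ => 𝟙_ D
  | n + 1, A => A 0 ⊗ tpr n fun i => A i.succ

/-- The tensor product of a finite sequence of morphisms. -/
def tmap : ∀ {n : ℕ} {A B : Fin n → D}, (∀ i, A i ⟶ B i) → (tpr n A ⟶ tpr n B)
  | 0, _, _, _ => 𝟙 _
  | _ + 1, _, _, f => f 0 ⊗ₘ tmap fun i => f i.succ

/-- Concatenation of a finite sequence of lists. -/
def fl : ∀ {n : ℕ}, (Fin n → List κ) → List κ
  | 0, _ => []
  | _ + 1, M => M 0 ++ fl fun i => M i.succ

lemma mem_fl {x : κ} : ∀ {n : ℕ} {M : Fin n → List κ}, x ∈ fl M ↔ ∃ i, x ∈ M i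
  | 0, _ => by simp [fl]
  | n + 1, M => by simp [fl, mem_fl, Fin.exists_fin_succ]

lemma nodup_fl : ∀ {n : ℕ} {M : Fin n → List κ}, (∀ i, (M i).Nodup) →
    (∀ i j x, x ∈ M i → x ∈ M j → i = j) → (fl M).Nodup
  | 0, _, _, _ => by simp [fl]
  | n + 1, M, h, h' => by
      refine List.Nodup.append (h 0) (nodup_fl (fun i => h i.succ) fun i j x hi hj =>
        Fin.succ_injective _ (h' _ _ x hi hj)) ?_
      intro x hx hx'
      obtain ⟨i, hi⟩ := mem_fl.1 hx'
      exact Fin.succ_ne_zero i (h' _ _ x hi hx)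

/-- The product of a finite sequence of labelled products. -/
def dtp {X : κ → D} : ∀ {n : ℕ} {A : Fin n → D} {M : Fin n → List κ}, (∀ i, A i ≅ tl X (M i)) →
    (tpr n A ≅ tl X (fl M))
  | 0, _, _, _ => Iso.refl (𝟙_ D)
  | _ + 1, _, _, a => dt (a 0) (dtp fun i => a i.succ)

lemma tmap_id : ∀ {n : ℕ} (A : Fin n → D), tmap (fun i => 𝟙 (A i)) = 𝟙 (tpr n A)
  | 0, _ => rfl
  | n + 1, A => by
      have := tmap_id fun i => A (Fin.succ i)
      simp only [tmap, this]
      exact id_tensorHom_id _ _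

lemma Can.tpr {X : κ → D} : ∀ {n : ℕ} {A B : Fin n → D} {M N : Fin n → List κ}
    {a : ∀ i, A i ≅ tl X (M i)} {b : ∀ i, B i ≅ tl X (N i)} {f : ∀ i, A i ⟶ B i},
    (∀ i, Can (a i) (b i) (f i)) → Can (dtp a) (dtp b) (tmap f)
  | 0, _, _, _, _, _, _, _, _ => Can.id _
  | _ + 1, _, _, _, _, _, _, _, h => (h 0).tens (Can.tpr fun i => h i.succ)

section
variable {X : κ → D} {Y : ι → D} {M : ι → List κ} (y : ∀ i, Y i ≅ tl X (M i))

lemma Can.dl_tpr : ∀ {n : ℕ} {A : Fin n → D} {K : Fin n → List ι} (w : ∀ i, A i ≅ tl Y (K i)),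
    Can (dtp fun i => w i ≪≫ dl y (K i)) (dtp w ≪≫ dl y (fl K)) (𝟙 _)
  | 0, _, _, _ => ⟨.nil, by simp; rfl⟩
  | n + 1, A, K, w => by
      have h := (Can.id (w 0 ≪≫ dl y (K 0))).tens (Can.dl_tpr fun i => w i.succ)
      have h' := Can.inv (e := Iso.refl _) (Can.dl_dt y (w 0) (dtp fun i => w i.succ))
      exact (h.comp h').cast (by simp; rfl)

lemma Can.dl_cmp {n : ℕ} {A : Fin n → D} {K : Fin n → List ι} {N : Fin n → List κ}
    {w : ∀ i, A i ≅ tl Y (K i)} {y' : ∀ i, A i ≅ tl X (N i)}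
    (h : ∀ i, Can (y' i) (w i ≪≫ dl y (K i)) (𝟙 _)) :
    Can (dtp y') (dtp w ≪≫ dl y (fl K)) (𝟙 _) :=
  ((Can.tpr h).comp (Can.dl_tpr y w)).cast (by rw [tmap_id, Category.id_comp])

end

section
variable {m n : ℕ} {k : Fin n → ℕ}

lemma perm_aux {M N : List κ} (hM : M.Nodup) (hN : N.Nodup) (h : ∀ x, x ∈ M ↔ x ∈ N) :
    Nonempty (Pm M N) := Pm.exists_of_perm ((List.perm_ext_iff_of_nodup hM hN).2 h) hM

lemma nodup_single : (fl fun i : Fin m => [i]).Nodup :=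
  nodup_fl (fun _ => by simp) (by simp +contextual)

lemma nodup_relabel (σ : Equiv.Perm (Fin m)) : (fl fun i : Fin m => [σ i]).Nodup :=
  nodup_fl (fun _ => by simp) (by simp only [List.mem_singleton]; rintro i j x rfl h; simpa using h)

lemma nodup_split (e : (Σ i : Fin n, Fin (k i)) ≃ Fin m) :
    (fl fun i => fl fun c => [e ⟨i, c⟩]).Nodup := by
  refine nodup_fl (fun i => nodup_fl (fun _ => by simp) ?_) ?_
  · simp only [List.mem_singleton]
    rintro a b x rfl h
    simpa using h
  · simp only [mem_fl, List.mem_singleton]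
    rintro i j x ⟨a, rfl⟩ ⟨b, h⟩
    exact congrArg Sigma.fst (e.injective h)

/-- A chosen composite of adjacent transpositions; any two choices have the same value. -/
def relabelPm (σ : Equiv.Perm (Fin m)) : Pm (fl fun i : Fin m => [i]) (fl fun i => [σ i]) :=
  Classical.choice <| perm_aux nodup_single (nodup_relabel σ) fun x => by
    simp only [mem_fl, List.mem_singleton, exists_eq', true_iff]
    exact ⟨σ.symm x, by simp⟩

/-- A chosen composite of adjacent transpositions; any two choices have the same value. -/
def splitPm (e : (Σ i : Fin n, Fin (k i)) ≃ Fin m) :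
    Pm (fl fun i : Fin m => [i]) (fl fun i => fl fun c => [e ⟨i, c⟩]) :=
  Classical.choice <| perm_aux nodup_single (nodup_split e) fun x => by
    simp only [mem_fl, List.mem_singleton, exists_eq', true_iff]
    exact ⟨(e.symm x).1, (e.symm x).2, by simp⟩

/-- The symmetry isomorphism permuting the factors: the `i`-th factor of the target is the
`σ i`-th factor of the source. -/
def relabel (σ : Equiv.Perm (Fin m)) (Y : Fin m → D) : tpr m Y ⟶ tpr m fun i => Y (σ i) :=
  (dtp fun i => ds Y i).hom ≫ (relabelPm σ).ev Y ≫ (dtp fun i => ds Y (σ i)).inv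

/-- The symmetry isomorphism grouping factors: the `c`-th factor in the `i`-th group is the
`e ⟨i, c⟩`-th factor of the source. -/
def split (e : (Σ i : Fin n, Fin (k i)) ≃ Fin m) (Y : Fin m → D) :
    tpr m Y ⟶ tpr n fun i => tpr (k i) fun c => Y (e ⟨i, c⟩) :=
  (dtp fun i => ds Y i).hom ≫ (splitPm e).ev Y ≫ (dtp fun i => dtp fun c => ds Y (e ⟨i, c⟩)).inv

variable {X : κ → D} {Y : Fin m → D} {M : Fin m → List κ}

lemma relabel_can (σ : Equiv.Perm (Fin m)) (y : ∀ i, Y i ≅ tl X (M i))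
    (h : ∀ i j, i ≠ j → ∀ a ∈ M i, ∀ b ∈ M j, a ≠ b) :
    Can (dtp y) (dtp fun i => y (σ i)) (relabel σ Y) := by
  have h0 : Can (dtp fun i => ds Y i) (dtp fun i => ds Y (σ i)) (relabel σ Y) :=
    ⟨relabelPm σ, by simp [relabel]⟩
  exact ((Can.dl_cmp y fun i => Can.dl_ds y i).comp ((Can.sub y h h0).comp
    (Can.inv (e := Iso.refl _) (Can.dl_cmp y fun i => Can.dl_ds y (σ i))))).cast (by simp)

lemma split_can (e : (Σ i : Fin n, Fin (k i)) ≃ Fin m) (y : ∀ i, Y i ≅ tl X (M i))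
    (h : ∀ i j, i ≠ j → ∀ a ∈ M i, ∀ b ∈ M j, a ≠ b) :
    Can (dtp y) (dtp fun i => dtp fun c => y (e ⟨i, c⟩)) (split e Y) := by
  have h0 : Can (dtp fun i => ds Y i) (dtp fun i => dtp fun c => ds Y (e ⟨i, c⟩)) (split e Y) :=
    ⟨splitPm e, by simp [split]⟩
  exact ((Can.dl_cmp y fun i => Can.dl_ds y i).comp ((Can.sub y h h0).comp
    (Can.inv (e := Iso.refl _) (Can.dl_cmp y fun i => Can.dl_cmp y fun c =>
      Can.dl_ds y (e ⟨i, c⟩))))).cast (by simp)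

end

end Coherence

section Naturality

variable {D : Type u} [Category.{v} D] [SimplicialCategory D] [MonoidalCategory D]
  [SymmetricCategory D] [SymmetricMonoidalEnrichment D] {ι κ : Type} {q r : SimplexCategoryᵒᵖ}
  {A A' B B' C C' A₂ A₂' B₂ B₂' : D}

/-- Commutative squares in simplicial degree `q` with two vertical sides in `D`. -/
def LSq (u : LHom q A A') (w : LHom q B B') (f : A ⟶ B) (f' : A' ⟶ B') : Prop :=
  u ≫ₗ degen q f' = degen q f ≫ₗ w

lemma LSq.id (u : LHom q A A') : LSq u u (𝟙 A) (𝟙 A') := by simp [LSq]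

lemma LSq.comp {u : LHom q A A'} {w : LHom q B B'} {z : LHom q C C'} {f : A ⟶ B} {f' : A' ⟶ B'}
    {g : B ⟶ C} {g' : B' ⟶ C'} (h : LSq u w f f') (h' : LSq w z g g') :
    LSq u z (f ≫ g) (f' ≫ g') := by
  unfold LSq at *
  rw [degen_comp, degen_comp, ← lcomp_assoc, h, lcomp_assoc, h', lcomp_assoc]

lemma LSq.inv {u : LHom q A A'} {w : LHom q B B'} {e : A ≅ B} {e' : A' ≅ B'}
    (h : LSq u w e.hom e'.hom) : LSq w u e.inv e'.inv := by
  unfold LSq at *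
  have : degen q e.inv ≫ₗ (u ≫ₗ degen q e'.hom) ≫ₗ degen q e'.inv =
      degen q e.inv ≫ₗ (degen q e.hom ≫ₗ w) ≫ₗ degen q e'.inv := by rw [h]
  rw [lcomp_assoc, lcomp_assoc, ← degen_comp, degen_comp_assoc, e.inv_hom_id, e'.hom_inv_id,
    id_lcomp, lcomp_id] at this
  exact this.symm

lemma LSq.tens {u : LHom q A A'} {w : LHom q B B'} {f : A ⟶ B} {f' : A' ⟶ B'}
    {u₂ : LHom q A₂ A₂'} {w₂ : LHom q B₂ B₂'} {f₂ : A₂ ⟶ B₂} {f₂' : A₂' ⟶ B₂'}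
    (h : LSq u w f f') (h₂ : LSq u₂ w₂ f₂ f₂') :
    LSq (u ⊗ₗ u₂) (w ⊗ₗ w₂) (f ⊗ₘ f₂) (f' ⊗ₘ f₂') := by
  unfold LSq at *
  rw [degen_tens, degen_tens, ← ltens_comp, ← ltens_comp, h, h₂]

lemma LSq.sw (u : LHom q A A') (w : LHom q B B') (z : LHom q C C') :
    LSq (u ⊗ₗ w ⊗ₗ z) (w ⊗ₗ u ⊗ₗ z) (sw A B C) (sw A' B' C') := by
  have h : LSq ((u ⊗ₗ w) ⊗ₗ z) ((w ⊗ₗ u) ⊗ₗ z) ((β_ A B).hom ⊗ₘ 𝟙 C) ((β_ A' B').hom ⊗ₘ 𝟙 C') :=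
    LSq.tens (lbraid u w) (LSq.id z)
  have h1 : LSq ((u ⊗ₗ w) ⊗ₗ z) _ (α_ A B C).hom (α_ A' B' C').hom := lassoc u w z
  have h2 : LSq ((w ⊗ₗ u) ⊗ₗ z) _ (α_ B A C).hom (α_ B' A' C').hom := lassoc w u z
  rw [tensorHom_id, tensorHom_id] at h
  exact h1.inv.comp (h.comp h2)

/-- The tensor product of `q`-simplices of mapping spaces labelled by a list. -/
def ltl {Y Y' : ι → D} (g : ∀ a, LHom q (Y a) (Y' a)) : ∀ L : List ι, LHom q (tl Y L) (tl Y' L)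
  | [] => degen q (𝟙 (𝟙_ D))
  | a :: L => g a ⊗ₗ ltl g L

/-- The tensor product of a finite sequence of `q`-simplices of mapping spaces. -/
def ltp : ∀ {n : ℕ} {A B : Fin n → D}, (∀ i, LHom q (A i) (B i)) → LHom q (tpr n A) (tpr n B)
  | 0, _, _, _ => degen q (𝟙 (𝟙_ D))
  | _ + 1, _, _, f => f 0 ⊗ₗ ltp fun i => f i.succ

lemma degen_tmap : ∀ {n : ℕ} {A B : Fin n → D} (f : ∀ i, A i ⟶ B i),
    degen q (tmap f) = ltp fun i => degen q (f i)
  | 0, _, _, _ => rfl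
  | _ + 1, _, _, f => (degen_tens _ _).trans (congrArg (fun t => degen q (f 0) ⊗ₗ t)
      (degen_tmap fun i => f i.succ))

lemma ltp_comp : ∀ {n : ℕ} {A B C : Fin n → D} (f : ∀ i, LHom q (A i) (B i))
    (g : ∀ i, LHom q (B i) (C i)), ltp (fun i => f i ≫ₗ g i) = ltp f ≫ₗ ltp g
  | 0, _, _, _, _, _ => (id_lcomp _).symm
  | _ + 1, _, _, _, f, g => (congrArg (fun t => (f 0 ≫ₗ g 0) ⊗ₗ t)
      (ltp_comp (fun i => f i.succ) fun i => g i.succ)).trans (ltens_comp _ _ _ _)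

lemma op_ltp (a : q ⟶ r) : ∀ {n : ℕ} {A B : Fin n → D} (f : ∀ i, LHom q (A i) (B i)),
    (ltp f).op a = ltp fun i => (f i).op a
  | 0, _, _, _ => op_degen a _
  | _ + 1, _, _, f => (op_ltens a _ _).trans (congrArg (fun t => (f 0).op a ⊗ₗ t)
      (op_ltp a fun i => f i.succ))

section
variable {Y Y' : ι → D} (g : ∀ a, LHom q (Y a) (Y' a))

lemma LSq.ev : ∀ {L L' : List ι} (p : Pm L L'), LSq (ltl g L) (ltl g L') (p.ev Y) (p.ev Y')
  | _, _, .nil => LSq.id _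
  | _, _, .cons a p => by
      have := (LSq.id (g a)).tens (LSq.ev p)
      rw [id_tensorHom, id_tensorHom] at this
      exact this
  | _, _, .swap a b L _ => LSq.sw (g a) (g b) (ltl g L)
  | _, _, .trans p p' => (LSq.ev p).comp (LSq.ev p')

lemma LSq.app : ∀ L L' : List ι,
    LSq (ltl g L ⊗ₗ ltl g L') (ltl g (L ++ L')) (app Y L L').hom (app Y' L L').hom
  | [], L' => lunit (ltl g L')
  | a :: L, L' => by
      have h : LSq ((g a ⊗ₗ ltl g L) ⊗ₗ ltl g L') _ (α_ (Y a) (tl Y L) (tl Y L')).hom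
        (α_ (Y' a) (tl Y' L) (tl Y' L')).hom := lassoc (g a) (ltl g L) (ltl g L')
      have h' := (LSq.id (g a)).tens (LSq.app L L')
      rw [id_tensorHom, id_tensorHom] at h'
      exact h.comp h'

lemma LSq.ds (a : ι) : LSq (g a) (ltl g [a]) (ds Y a).hom (ds Y' a).hom :=
  LSq.inv (e := ρ_ (Y a)) (e' := ρ_ (Y' a)) (runit (g a))

lemma LSq.dtp : ∀ {n : ℕ} {A B : Fin n → D} {M : Fin n → List ι} {u : ∀ i, LHom q (A i) (B i)}
    {a : ∀ i, A i ≅ tl Y (M i)} {b : ∀ i, B i ≅ tl Y' (M i)},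
    (∀ i, LSq (u i) (ltl g (M i)) (a i).hom (b i).hom) →
    LSq (ltp u) (ltl g (fl M)) (dtp a).hom (dtp b).hom
  | 0, _, _, _, _, _, _, _ => LSq.id _
  | _ + 1, _, _, _, _, _, _, h => ((h 0).tens (LSq.dtp fun i => h i.succ)).comp (LSq.app g _ _)

end

variable {m n : ℕ} {k : Fin n → ℕ} {Y Y' : Fin m → D} (g : ∀ i, LHom q (Y i) (Y' i))

lemma relabel_natural (σ : Equiv.Perm (Fin m)) :
    ltp g ≫ₗ degen q (relabel σ Y') = degen q (relabel σ Y) ≫ₗ ltp fun i => g (σ i) :=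
  (LSq.dtp g fun i => LSq.ds g i).comp ((LSq.ev g _).comp
    (LSq.dtp g fun i => LSq.ds g (σ i)).inv)

lemma split_natural (e : (Σ i : Fin n, Fin (k i)) ≃ Fin m) :
    ltp g ≫ₗ degen q (split e Y') =
      degen q (split e Y) ≫ₗ ltp fun i => ltp fun c => g (e ⟨i, c⟩) :=
  (LSq.dtp g fun i => LSq.ds g i).comp ((LSq.ev g _).comp
    (LSq.dtp g fun i => LSq.dtp g fun c => LSq.ds g (e ⟨i, c⟩)).inv)

end Naturality

section Powers

variable {D : Type u} [Category.{v} D] [MonoidalCategory D] [SymmetricCategory D]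
  {m n : ℕ} {k : Fin n → ℕ} (x : D)

/-- The tensor power of an object. -/
abbrev pw (n : ℕ) (x : D) : D := tpr n fun _ => x

/-- The labelled object all of whose labels are `x`. -/
def cst (m : ℕ) (x : D) : Fin m → D := fun _ => x

/-- A tensor power of `x`, with factors labelled by `E`. -/
def dpw {n : ℕ} (E : Fin n → Fin m) : pw n x ≅ tl (cst m x) (fl fun i => [E i]) :=
  dtp fun i => ds (cst m x) (E i)

/-- A product of tensor powers of `x`, with factors labelled by `E`. -/
def dpp (E : ∀ i, Fin (k i) → Fin m) :
    tpr n (fun i => pw (k i) x) ≅ tl (cst m x) (fl fun i => fl fun c => [E i c]) :=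
  dtp fun i => dpw x (E i)

/-- The symmetry isomorphisms of a tensor power. -/
def pwRelabel (σ : Equiv.Perm (Fin m)) : pw m x ⟶ pw m x := relabel σ fun _ => x

/-- Decomposition of a tensor power into a product of tensor powers: the `c`-th factor in the
`i`-th group is the `e ⟨i, c⟩`-th factor of the source. -/
def pwSplit (e : (Σ i : Fin n, Fin (k i)) ≃ Fin m) : pw m x ⟶ tpr n fun i => pw (k i) x :=
  split e fun _ => x

lemma single_ne {i j : Fin m} (h : i ≠ j) : ∀ a ∈ [i], ∀ b ∈ [j], a ≠ b := by simpa using h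

lemma pwRelabel_can (σ : Equiv.Perm (Fin m)) (τ : Fin m ↪ Fin n) :
    Can (dpw x τ) (dpw x fun i => τ (σ i)) (pwRelabel x σ) :=
  relabel_can (Y := fun _ => x) σ (fun i => ds (cst n x) (τ i)) fun _ _ h =>
    single_ne fun e => h (τ.injective e)

lemma pwSplit_can {t : ℕ} (e : (Σ i : Fin n, Fin (k i)) ≃ Fin m) (τ : Fin m ↪ Fin t) :
    Can (dpw x τ) (dpp x fun i c => τ (e ⟨i, c⟩)) (pwSplit x e) :=
  split_can (Y := fun _ => x) e (fun i => ds (cst t x) (τ i)) fun _ _ h =>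
    single_ne fun e => h (τ.injective e)

lemma pwSplit_can' {t : ℕ} (e : (Σ i : Fin n, Fin (k i)) ≃ Fin m) (τ : Fin m ↪ Fin t)
    (E : ∀ i, Fin (k i) → Fin t) (h : ∀ i c, τ (e ⟨i, c⟩) = E i c) :
    Can (dpw x τ) (dpp x E) (pwSplit x e) := by
  obtain rfl : (fun i c => τ (e ⟨i, c⟩)) = E := by funext i c; exact h i c
  exact pwSplit_can x e τ

/-- The first tensor power of an object is that object. -/
def pwOne : pw 1 x ⟶ x := (ρ_ x).hom

lemma relabel_one : pwRelabel x (1 : Equiv.Perm (Fin m)) = 𝟙 _ :=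
  (pwRelabel_can x 1 (.refl _)).unique (Can.id _)

lemma relabel_mul (σ τ : Equiv.Perm (Fin m)) :
    pwRelabel x (σ * τ) = pwRelabel x σ ≫ pwRelabel x τ :=
  (pwRelabel_can x (σ * τ) (.refl _)).unique
    ((pwRelabel_can x σ (.refl _)).comp (pwRelabel_can x τ σ.toEmbedding))

lemma relabel_split (σ : Equiv.Perm (Fin m)) (e : (Σ i : Fin n, Fin (k i)) ≃ Fin m) :
    pwRelabel x σ ≫ pwSplit x e = pwSplit x (e.trans σ) :=
  ((pwRelabel_can x σ (.refl _)).comp (pwSplit_can x e σ.toEmbedding)).unique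
    (pwSplit_can x (e.trans σ) (.refl _))

lemma split_relabel (e : (Σ i : Fin n, Fin (k i)) ≃ Fin m) (σ : Equiv.Perm (Fin n))
    (e' : (Σ i : Fin n, Fin (k (σ i))) ≃ Fin m) (h : ∀ i c, e' ⟨i, c⟩ = e ⟨σ i, c⟩) :
    pwSplit x e ≫ relabel σ (fun i => pw (k i) x) = pwSplit x e' := by
  have h1 := (pwSplit_can x e (.refl _)).comp (relabel_can (Y := fun i => pw (k i) x) σ
    (fun i => dpw x fun c => e ⟨i, c⟩) (by
      simp only [mem_fl, List.mem_singleton]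
      rintro i j hij _ ⟨a, rfl⟩ _ ⟨b, rfl⟩ hab
      exact hij (congrArg Sigma.fst (e.injective hab))))
  exact h1.unique (pwSplit_can' x e' (.refl _) _ h)

lemma split_tmap_relabel (e e' : (Σ i : Fin n, Fin (k i)) ≃ Fin m)
    (τ : ∀ i, Equiv.Perm (Fin (k i))) (h : ∀ i c, e' ⟨i, c⟩ = e ⟨i, τ i c⟩) :
    pwSplit x e ≫ tmap (fun i => pwRelabel x (τ i)) = pwSplit x e' := by
  have h1 := (pwSplit_can x e (.refl _)).comp (Can.tpr fun i => pwRelabel_can x (τ i)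
    ⟨fun c => e ⟨i, c⟩, fun a b hab => by simpa using hab⟩)
  exact h1.unique (pwSplit_can' x e' (.refl _) _ h)

lemma split_unit_left (e : (Σ _ : Fin 1, Fin m) ≃ Fin m) (h : ∀ c, e ⟨0, c⟩ = c) :
    pwSplit x e ≫ (ρ_ (pw m x)).hom = 𝟙 _ :=
  ((pwSplit_can' x e (.refl _) (fun _ c => c) fun i c => by
    obtain rfl := Subsingleton.elim i 0; exact h c).comp
      (Can.runit (dpw x fun c : Fin m => c))).unique (Can.id _)

lemma split_unit_right (e : (Σ _ : Fin n, Fin 1) ≃ Fin n) (h : ∀ i, e ⟨i, 0⟩ = i) :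
    pwSplit x e ≫ tmap (fun _ => pwOne x) = 𝟙 _ :=
  ((pwSplit_can' x e (.refl _) (fun i _ => i) fun i c => by
    obtain rfl := Subsingleton.elim c 0; exact h i).comp
      (Can.tpr fun i => Can.runit (ds (cst n x) i))).unique (Can.id _)

lemma split_assoc {t : ℕ} {l : Fin m → ℕ} {s : Fin n → ℕ}
    (e : (Σ i : Fin n, Fin (k i)) ≃ Fin m) (e₂ : (Σ j : Fin m, Fin (l j)) ≃ Fin t)
    (e₃ : (Σ i : Fin n, Fin (s i)) ≃ Fin t)
    (e₁ : ∀ i, (Σ c : Fin (k i), Fin (l (e ⟨i, c⟩))) ≃ Fin (s i))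
    (h : ∀ i c d, e₂ ⟨e ⟨i, c⟩, d⟩ = e₃ ⟨i, e₁ i ⟨c, d⟩⟩) :
    pwSplit x e₂ ≫ split e (fun j => pw (l j) x) =
      pwSplit x e₃ ≫ tmap fun i => pwSplit x (e₁ i) := by
  have h1 := (pwSplit_can x e₂ (.refl _)).comp (split_can (Y := fun j => pw (l j) x) e
    (fun j => dpw x fun c => e₂ ⟨j, c⟩) (by
      simp only [mem_fl, List.mem_singleton]
      rintro i j hij _ ⟨a, rfl⟩ _ ⟨b, rfl⟩ hab
      exact hij (congrArg Sigma.fst (e₂.injective hab))))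
  have h2 := (pwSplit_can x e₃ (.refl _)).comp (Can.tpr fun i => pwSplit_can x (e₁ i)
    ⟨fun c => e₃ ⟨i, c⟩, fun a b hab => by simpa using hab⟩)
  have : (fun i c d => e₂ ⟨e ⟨i, c⟩, d⟩) =
    fun (i : Fin n) (c : Fin (k i)) (d : Fin (l (e ⟨i, c⟩))) => e₃ ⟨i, e₁ i ⟨c, d⟩⟩ := by
    funext i c d; exact h i c d
  have key (E : ∀ (i : Fin n) (c : Fin (k i)), Fin (l (e ⟨i, c⟩)) → Fin t)
    (hE : E = fun i c d => e₃ ⟨i, e₁ i ⟨c, d⟩⟩) {f : pw t x ⟶ _}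
    (hf : Can (dpw x fun i => i) (dtp fun i => dtp fun c => dpw x (E i c)) f) :
    f = pwSplit x e₃ ≫ tmap fun i => pwSplit x (e₁ i) := by
    subst hE
    exact hf.unique h2
  exact key _ this h1

end Powers

/-! Operads -/

/-- A symmetric operad in sets. The set `P n` consists of the operations with `n` inputs. The
composite `comp e p q` is formed from an operation `p` with `n` inputs and operations
`q i` with `k i` inputs; the bijection `e` says which input of the composite is fed
into the `c`-th input of `q i`. -/
structure Operad where
  P : ℕ → Type v
  act {n : ℕ} : Equiv.Perm (Fin n) → P n → P n
  one : P 1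
  comp {m n : ℕ} {k : Fin n → ℕ} (e : (Σ i : Fin n, Fin (k i)) ≃ Fin m) :
    P n → (∀ i, P (k i)) → P m
  one_act {n : ℕ} (p : P n) : act 1 p = p
  mul_act {n : ℕ} (σ τ : Equiv.Perm (Fin n)) (p : P n) : act (σ * τ) p = act σ (act τ p)
  act_comp {m n : ℕ} {k : Fin n → ℕ} (σ : Equiv.Perm (Fin m))
    (e : (Σ i : Fin n, Fin (k i)) ≃ Fin m) (p : P n) (q : ∀ i, P (k i)) :
    act σ (comp e p q) = comp (e.trans σ) p q
  comp_act {m n : ℕ} {k : Fin n → ℕ} (e : (Σ i : Fin n, Fin (k i)) ≃ Fin m)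
    (σ : Equiv.Perm (Fin n)) (e' : (Σ i : Fin n, Fin (k (σ i))) ≃ Fin m)
    (h : ∀ i c, e' ⟨i, c⟩ = e ⟨σ i, c⟩) (p : P n) (q : ∀ i, P (k i)) :
    comp e (act σ p) q = comp e' p fun i => q (σ i)
  comp_act' {m n : ℕ} {k : Fin n → ℕ} (e e' : (Σ i : Fin n, Fin (k i)) ≃ Fin m)
    (τ : ∀ i, Equiv.Perm (Fin (k i))) (h : ∀ i c, e' ⟨i, c⟩ = e ⟨i, τ i c⟩) (p : P n)
    (q : ∀ i, P (k i)) : comp e p (fun i => act (τ i) (q i)) = comp e' p q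
  one_comp {m : ℕ} (e : (Σ _ : Fin 1, Fin m) ≃ Fin m) (h : ∀ c, e ⟨0, c⟩ = c) (q : P m) :
    comp e one (fun _ => q) = q
  comp_one {n : ℕ} (e : (Σ _ : Fin n, Fin 1) ≃ Fin n) (h : ∀ i, e ⟨i, 0⟩ = i) (p : P n) :
    comp e p (fun _ => one) = p
  assoc {m n t : ℕ} {k : Fin n → ℕ} {l : Fin m → ℕ} {s : Fin n → ℕ}
    (e : (Σ i : Fin n, Fin (k i)) ≃ Fin m) (e₂ : (Σ j : Fin m, Fin (l j)) ≃ Fin t)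
    (e₃ : (Σ i : Fin n, Fin (s i)) ≃ Fin t)
    (e₁ : ∀ i, (Σ c : Fin (k i), Fin (l (e ⟨i, c⟩))) ≃ Fin (s i))
    (h : ∀ i c d, e₂ ⟨e ⟨i, c⟩, d⟩ = e₃ ⟨i, e₁ i ⟨c, d⟩⟩)
    (p : P n) (q : ∀ i, P (k i)) (r : ∀ j, P (l j)) :
    comp e₂ (comp e p q) r = comp e₃ p fun i => comp (e₁ i) (q i) fun c => r (e ⟨i, c⟩)

/-- Morphisms of operads. -/
@[ext]
structure Operad.Hom (P Q : Operad.{v}) where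
  app (n : ℕ) : P.P n → Q.P n
  act {n : ℕ} (σ : Equiv.Perm (Fin n)) (p : P.P n) : app n (P.act σ p) = Q.act σ (app n p)
  one : app 1 P.one = Q.one
  comp {m n : ℕ} {k : Fin n → ℕ} (e : (Σ i : Fin n, Fin (k i)) ≃ Fin m) (p : P.P n)
    (q : ∀ i, P.P (k i)) : app m (P.comp e p q) = Q.comp e (app n p) fun i => app (k i) (q i)

instance : Category Operad.{v} where
  Hom := Operad.Hom
  id P := ⟨fun _ p => p, fun _ _ => rfl, rfl, fun _ _ _ => rfl⟩
  comp f g := ⟨fun n p => g.app n (f.app n p), fun σ p => by rw [f.act, g.act],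
    by rw [f.one, g.one], fun e p q => by rw [f.comp, g.comp]⟩

@[ext]
lemma Operad.hom_ext {P Q : Operad.{v}} {f g : P ⟶ Q} (h : ∀ n p, f.app n p = g.app n p) :
    f = g := Operad.Hom.ext (by funext n p; exact h n p)

/-- The functor of operations with `n` inputs. -/
def Operad.arity (n : ℕ) : Operad.{v} ⥤ Type v where
  obj P := P.P n
  map f := ↾(f.app n)

/-- Simplicial operads: these are the same as operads in simplicial sets. -/
abbrev SimplicialOperad := SimplicialObject Operad.{v}

/-- The simplicial set of operations with `n` inputs. -/
def SimplicialOperad.level (n : ℕ) : SimplicialOperad.{v} ⥤ SSet.{v} :=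
  (SimplicialObject.whiskering _ _).obj (Operad.arity n)

section EndOperad

variable {D : Type u} [Category.{v} D] [SimplicialCategory D] [MonoidalCategory D]
  [SymmetricCategory D] [SymmetricMonoidalEnrichment D]

/-- The endomorphism operad of `x` in simplicial degree `q`. -/
def endAt (q : SimplexCategoryᵒᵖ) (x : D) : Operad.{v} where
  P n := LHom q (pw n x) x
  act σ p := degen q (pwRelabel x σ) ≫ₗ p
  one := degen q (pwOne x)
  comp e p g := degen q (pwSplit x e) ≫ₗ ltp g ≫ₗ p
  one_act p := by rw [relabel_one, id_lcomp]
  mul_act σ τ p := by rw [relabel_mul, degen_comp, lcomp_assoc]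
  act_comp σ e p g := by rw [degen_comp_assoc, relabel_split]
  comp_act {m n k} e σ e' h p g := by
    have : ltp g ≫ₗ degen q (pwRelabel x σ) =
      degen q (relabel σ fun i => pw (k i) x) ≫ₗ ltp fun i => g (σ i) := relabel_natural g σ
    rw [← lcomp_assoc (ltp g), this, lcomp_assoc, degen_comp_assoc, split_relabel x e σ e' h]
  comp_act' e e' τ h p g := by
    rw [ltp_comp, ← degen_tmap, lcomp_assoc, degen_comp_assoc, split_tmap_relabel x e e' τ h]
  one_comp {m} e h g := by
    have : (ltp fun _ : Fin 1 => g) ≫ₗ degen q (pwOne x) = degen q (ρ_ (pw m x)).hom ≫ₗ g :=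
      runit g
    have h' := congrArg (fun t => degen q (pwSplit x e) ≫ₗ t) this
    refine h'.trans ?_
    refine (degen_comp_assoc (pwSplit x e) (ρ_ (pw m x)).hom g).trans ?_
    rw [split_unit_left x e h, id_lcomp]
  comp_one e h p := by
    rw [← degen_tmap, degen_comp_assoc, split_unit_right x e h, id_lcomp]
  assoc {m n t k l s} e e₂ e₃ e₁ h p g r := by
    have : ltp r ≫ₗ degen q (pwSplit x e) = degen q (split e fun j => pw (l j) x) ≫ₗ
      ltp fun i => ltp fun c => r (e ⟨i, c⟩) := split_natural r e
    rw [← lcomp_assoc (ltp r), this, lcomp_assoc, degen_comp_assoc, split_assoc x e e₂ e₃ e₁ h,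
      ltp_comp, ltp_comp, ← degen_tmap, degen_comp]
    simp only [lcomp_assoc]

lemma op_endAt_comp {q r : SimplexCategoryᵒᵖ} (a : q ⟶ r) (x : D) {m n : ℕ} {k : Fin n → ℕ}
    (e : (Σ i : Fin n, Fin (k i)) ≃ Fin m) (p : LHom q (pw n x) x)
    (g : ∀ i, LHom q (pw (k i) x) x) : (degen q (pwSplit x e) ≫ₗ ltp g ≫ₗ p).op a =
      degen r (pwSplit x e) ≫ₗ ltp (fun i => (g i).op a) ≫ₗ p.op a := by
  rw [op_lcomp, op_lcomp, op_degen, op_ltp]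

/-- The endomorphism operad of `x`: its simplicial set of operations with `n` inputs is
the mapping space from the `n`-th tensor power of `x` to `x`. -/
def endOperad (x : D) : SimplicialOperad.{v} where
  obj q := endAt q x
  map {q r} a :=
    { app := fun _ p => LHom.op a p
      act := fun σ p => (op_lcomp a _ _).trans (by rw [op_degen]; rfl)
      one := op_degen a _
      comp := fun e p g => op_endAt_comp a x e p g }
  map_id q := by ext n p; exact lop_id p
  map_comp a b := by ext n p; exact lop_op a b p

/-- The tensor power of a morphism. -/
def pmap (n : ℕ) {x y : D} (f : x ⟶ y) : pw n x ⟶ pw n y := tmap fun _ => f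

variable {x y : D} {q : SimplexCategoryᵒᵖ}

lemma degen_pmap (n : ℕ) (f : x ⟶ y) :
    degen q (pmap n f) = ltp fun _ : Fin n => degen q f := degen_tmap _

lemma compat_act (f : x ⟶ y) {n : ℕ} (σ : Equiv.Perm (Fin n)) {a : LHom q (pw n x) x}
    {b : LHom q (pw n y) y} (w : a ≫ₗ degen q f = degen q (pmap n f) ≫ₗ b) :
    (degen q (pwRelabel x σ) ≫ₗ a) ≫ₗ degen q f =
      degen q (pmap n f) ≫ₗ degen q (pwRelabel y σ) ≫ₗ b := by
  have h : ltp (fun _ : Fin n => degen q f) ≫ₗ degen q (pwRelabel y σ) =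
    degen q (pwRelabel x σ) ≫ₗ ltp fun _ => degen q f := relabel_natural _ σ
  rw [lcomp_assoc, w, degen_pmap, ← lcomp_assoc, ← h, lcomp_assoc]

lemma compat_one (f : x ⟶ y) :
    degen q (pwOne x) ≫ₗ degen q f = degen q (pmap 1 f) ≫ₗ degen q (pwOne y) :=
  (runit (degen q f)).symm.trans
    (congrArg (fun t => t ≫ₗ degen q (ρ_ y).hom) (degen_tens f (𝟙 (𝟙_ D))).symm)

lemma compat_comp (f : x ⟶ y) {m n : ℕ} {k : Fin n → ℕ} (e : (Σ i : Fin n, Fin (k i)) ≃ Fin m)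
    {a : LHom q (pw n x) x} {b : LHom q (pw n y) y}
    (w : a ≫ₗ degen q f = degen q (pmap n f) ≫ₗ b) {g : ∀ i, LHom q (pw (k i) x) x}
    {g' : ∀ i, LHom q (pw (k i) y) y}
    (w' : ∀ i, g i ≫ₗ degen q f = degen q (pmap (k i) f) ≫ₗ g' i) :
    (degen q (pwSplit x e) ≫ₗ ltp g ≫ₗ a) ≫ₗ degen q f =
      degen q (pmap m f) ≫ₗ degen q (pwSplit y e) ≫ₗ ltp g' ≫ₗ b := by
  have h : ltp (fun _ : Fin m => degen q f) ≫ₗ degen q (pwSplit y e) =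
    degen q (pwSplit x e) ≫ₗ ltp fun i => ltp fun _ : Fin (k i) => degen q f :=
    split_natural _ e
  have h' : ltp g ≫ₗ ltp (fun _ : Fin n => degen q f) =
      (ltp fun i => ltp fun _ : Fin (k i) => degen q f) ≫ₗ ltp g' := by
    rw [← ltp_comp, ← ltp_comp]
    congr 1
    funext i
    rw [w' i, degen_pmap]
  rw [lcomp_assoc, lcomp_assoc, w, degen_pmap, degen_pmap, ← lcomp_assoc (ltp g), h',
    lcomp_assoc, ← lcomp_assoc, ← h, lcomp_assoc]

/-- The endomorphism operad of a morphism `f : x ⟶ y` in simplicial degree `q`: an operation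
consists of an operation of `x` and an operation of `y` that are compatible with `f`. -/
def endArrowAt (q : SimplexCategoryᵒᵖ) (f : x ⟶ y) : Operad.{v} where
  P n := { p : LHom q (pw n x) x × LHom q (pw n y) y //
    p.1 ≫ₗ degen q f = degen q (pmap n f) ≫ₗ p.2 }
  act σ p := ⟨((endAt q x).act σ p.1.1, (endAt q y).act σ p.1.2), compat_act f σ p.2⟩
  one := ⟨((endAt q x).one, (endAt q y).one), compat_one f⟩
  comp e p g := ⟨((endAt q x).comp e p.1.1 fun i => (g i).1.1,
      (endAt q y).comp e p.1.2 fun i => (g i).1.2), compat_comp f e p.2 fun i => (g i).2⟩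
  one_act p := Subtype.ext (Prod.ext ((endAt q x).one_act _) ((endAt q y).one_act _))
  mul_act σ τ p := Subtype.ext (Prod.ext ((endAt q x).mul_act _ _ _) ((endAt q y).mul_act _ _ _))
  act_comp σ e p g := Subtype.ext (Prod.ext ((endAt q x).act_comp σ e _ _)
    ((endAt q y).act_comp σ e _ _))
  comp_act e σ e' h p g := Subtype.ext (Prod.ext ((endAt q x).comp_act e σ e' h _ _)
    ((endAt q y).comp_act e σ e' h _ _))
  comp_act' e e' τ h p g := Subtype.ext (Prod.ext ((endAt q x).comp_act' e e' τ h _ _)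
    ((endAt q y).comp_act' e e' τ h _ _))
  one_comp e h g := Subtype.ext (Prod.ext ((endAt q x).one_comp e h _)
    ((endAt q y).one_comp e h _))
  comp_one e h p := Subtype.ext (Prod.ext ((endAt q x).comp_one e h _)
    ((endAt q y).comp_one e h _))
  assoc e e₂ e₃ e₁ h p g r := Subtype.ext (Prod.ext ((endAt q x).assoc e e₂ e₃ e₁ h _ _ _)
    ((endAt q y).assoc e e₂ e₃ e₁ h _ _ _))

/-- The endomorphism operad of a morphism `f : x ⟶ y`. Its simplicial set of operations with
`n` inputs is the pullback of the mapping spaces from `x ^ n` to `x` and from `y ^ n` to `y`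
over the mapping space from `x ^ n` to `y`. -/
def endArrow (f : x ⟶ y) : SimplicialOperad.{v} where
  obj q := endArrowAt q f
  map {q r} a :=
    { app := fun n p => ⟨(p.1.1.op a, p.1.2.op a), by
        rw [← op_degen a f, ← op_degen a (pmap n f), ← op_lcomp, ← op_lcomp, p.2]⟩
      act := fun σ p => Subtype.ext (Prod.ext (((endOperad x).map a).act σ p.1.1)
        (((endOperad y).map a).act σ p.1.2))
      one := Subtype.ext (Prod.ext ((endOperad x).map a).one ((endOperad y).map a).one)
      comp := fun e p g => Subtype.ext (Prod.ext (((endOperad x).map a).comp e p.1.1 _)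
        (((endOperad y).map a).comp e p.1.2 _)) }
  map_id q := by ext n p; exact Subtype.ext (Prod.ext (lop_id _) (lop_id _))
  map_comp a b := by ext n p; exact Subtype.ext (Prod.ext (lop_op a b _) (lop_op a b _))

/-- The projection from the endomorphism operad of `f : x ⟶ y` to that of `x`. -/
def endArrowToSource (f : x ⟶ y) : endArrow f ⟶ endOperad x where
  app q :=
    { app := fun _ p => p.1.1
      act := fun _ _ => rfl
      one := rfl
      comp := fun _ _ _ => rfl }

end EndOperad

/-! Homotopy theory of simplicial sets and of simplicial operads -/

section Spaces

open SSet.modelCategoryQuillen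

/-- A map of simplicial sets is a weak equivalence if it induces bijections on
sets of homotopy classes of maps to every Kan complex. -/
def sWeq : MorphismProperty SSet.{v} := fun X Y f =>
  ∀ Z : SSet.{v}, SSet.KanComplex Z →
    Function.Bijective (SSet.mapπ₀ ((MonoidalClosed.pre f).app Z))

/-- The homotopy category of simplicial sets. -/
abbrev HoSSet := (sWeq.{v}).Localization

/-- A simplicial set is contractible if its map to the point is a weak equivalence. -/
def Contractible (X : SSet.{v}) : Prop := sWeq (Limits.terminal.from X)

/-- Evaluation of paths in `Y` at the two endpoints `i = 0, 1`. -/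
def pathEv (Y : SSet.{v}) (i : Fin 2) : (ihom (SSet.stdSimplex.obj (.mk 1))).obj Y ⟶ Y :=
  (λ_ _).inv ≫ SSet.const (SSet.stdSimplex.obj₀Equiv.symm i) ▷ _ ≫ (ihom.ev _).app Y

/-- The homotopy fiber of `p : X ⟶ Y` over a vertex `y` of `Y`: it consists of a point of `X`
together with a path in `Y` from its image to `y`. -/
def homotopyFiber {X Y : SSet.{v}} (p : X ⟶ Y) (y : 𝟙_ SSet.{v} ⟶ Y) : SSet.{v} :=
  Limits.pullback (Limits.pullback.snd p (pathEv Y 0) ≫ pathEv Y 1) y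

/-- Weak equivalences of simplicial operads are defined levelwise. -/
def operadWeq : MorphismProperty SimplicialOperad.{v} := fun _ _ f =>
  ∀ n, sWeq ((SimplicialOperad.level n).map f)

/-- Fibrations of simplicial operads are defined levelwise. -/
def operadFib : MorphismProperty SimplicialOperad.{v} := fun _ _ f =>
  ∀ n, Fibration ((SimplicialOperad.level n).map f)

/-- A simplicial operad is cofibrant if all maps out of it lift through acyclic fibrations. -/
def IsCofibrantOperad (O : SimplicialOperad.{v}) : Prop :=
  ∀ ⦃P Q : SimplicialOperad.{v}⦄ (p : P ⟶ Q), operadFib p → operadWeq p →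
    ∀ g : O ⟶ Q, ∃ h : O ⟶ P, h ≫ p = g

/-- The mapping spaces of simplicial operads: a `q`-simplex of `operadMap O P` is a
morphism from `O` to the cotensor of `P` with the `q`-simplex. -/
abbrev operadMap (O P : SimplicialOperad.{v}) : SSet.{v} := sHom O P

/-- The map on mapping spaces induced by `f : P ⟶ Q`. -/
abbrev operadMapPost (O : SimplicialOperad.{v}) {P Q : SimplicialOperad.{v}} (f : P ⟶ Q) :
    operadMap O P ⟶ operadMap O Q := eHomWhiskerLeft SSet.{v} O f

/-- The vertex of the mapping space given by a morphism of operads. -/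
abbrev operadMapVertex {O P : SimplicialOperad.{v}} (θ : O ⟶ P) : 𝟙_ SSet.{v} ⟶ operadMap O P :=
  eHomEquiv SSet.{v} θ

end Spaces

/-! Operadic model categories -/

section Tensors

variable {D : Type u} [Category.{v} D] [SimplicialCategory D]

/-- The object `T` with `η : K ⟶ Map(x, T)` is the tensor of `x` with the simplicial
set `K`: the induced maps `Map(T, y) ⟶ Map(K, Map(x, y))` are isomorphisms. -/
def IsTensor (K : SSet.{v}) (x T : D) (η : K ⟶ sHom x T) : Prop :=
  ∀ y : D, IsIso (MonoidalClosed.curry (η ▷ sHom T y ≫ sHomComp x T y))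

/-- The object `C` with `ε : K ⟶ Map(C, y)` is the cotensor of `y` with the simplicial
set `K`: the induced maps `Map(x, C) ⟶ Map(K, Map(x, y))` are isomorphisms. -/
def IsCotensor (K : SSet.{v}) (y C : D) (ε : K ⟶ sHom C y) : Prop :=
  ∀ x : D, IsIso (MonoidalClosed.curry ((β_ K (sHom x C)).hom ≫ sHom x C ◁ ε ≫ sHomComp x C y))

end Tensors

section

open SSet.modelCategoryQuillen

/-- Operadic model categories, i.e. simplicial symmetric tensor model categories. The fields say:
finite simplicial tensors and cotensors exist, and the pullback-power of a cofibration and a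
fibration is a fibration of simplicial sets, acyclic if one of the two maps is (so that
`D` is a simplicial model category); the tensor product satisfies the pushout product
axiom, preserves initial objects in either variable, and preserves weak equivalences when the
other input is cofibrant; for finite `K`, the canonical comparison maps between the tensor of
`x` with `K` and the products of `x` with the tensor of the unit with `K` are
isomorphisms; the mapping spaces out of the unit object form a right Quillen functor. -/
class OperadicModelCategory (D : Type u) [Category.{v} D] [ModelCategory D]
    [SimplicialCategory D] [MonoidalCategory D] [SymmetricCategory D]
    [SymmetricMonoidalEnrichment D] : Prop where
  exists_tensor (K : SSet.{v}) [K.Finite] (x : D) : ∃ T η, IsTensor K x T η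
  exists_cotensor (K : SSet.{v}) [K.Finite] (y : D) : ∃ C ε, IsCotensor K y C ε
  sm7 {a b x y : D} (i : a ⟶ b) (p : x ⟶ y) [Cofibration i] [Fibration p]
    (sq : (sHomFunctor D).PullbackObjObj i p) :
    Fibration sq.π ∧ (WeakEquivalence i ∨ WeakEquivalence p → sWeq sq.π)
  pushoutProduct {a b x y : D} (i : a ⟶ b) (j : x ⟶ y) [Cofibration i] [Cofibration j]
    (sq : (curriedTensor D).PushoutObjObj i j) :
    Cofibration sq.ι ∧ (WeakEquivalence i ∨ WeakEquivalence j → WeakEquivalence sq.ι)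
  initial_tensor (a x : D) (h : Nonempty (Limits.IsInitial a)) :
    Nonempty (Limits.IsInitial (a ⊗ x))
  tensor_initial (x a : D) (h : Nonempty (Limits.IsInitial a)) :
    Nonempty (Limits.IsInitial (x ⊗ a))
  weq_whiskerRight {a b : D} (f : a ⟶ b) (x : D) [WeakEquivalence f] [IsCofibrant x] :
    WeakEquivalence (f ▷ x)
  weq_whiskerLeft (x : D) {a b : D} (f : a ⟶ b) [WeakEquivalence f] [IsCofibrant x] :
    WeakEquivalence (x ◁ f)
  tensor_unit_right (K : SSet.{v}) [K.Finite] (T : D) (η : K ⟶ sHom (𝟙_ D) T)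
    (h : IsTensor K (𝟙_ D) T η) (x : D) :
    IsTensor K (x ⊗ 𝟙_ D) (x ⊗ T) ((λ_ K).inv ≫ (eHomEquiv SSet (𝟙 x) ⊗ₘ η) ≫
      SymmetricMonoidalEnrichment.tensorMap x (𝟙_ D) x T)
  tensor_unit_left (K : SSet.{v}) [K.Finite] (T : D) (η : K ⟶ sHom (𝟙_ D) T)
    (h : IsTensor K (𝟙_ D) T η) (x : D) :
    IsTensor K (𝟙_ D ⊗ x) (T ⊗ x) ((ρ_ K).inv ≫ (η ⊗ₘ eHomEquiv SSet (𝟙 x)) ≫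
      SymmetricMonoidalEnrichment.tensorMap (𝟙_ D) x T x)
  unit_fibration {x y : D} (p : x ⟶ y) [Fibration p] :
    Fibration (eHomWhiskerLeft SSet (𝟙_ D) p) ∧
      (WeakEquivalence p → sWeq (eHomWhiskerLeft SSet (𝟙_ D) p))

end

section

variable {D : Type u} [Category.{v} D] [SimplicialCategory D]

/-- The empty simplicial set. -/
def sEmpty : SSet.{v} := (Functor.const _).obj PEmpty

lemma sEmpty_finite : sEmpty.{v}.Finite where
  finite := by
    have : IsEmpty sEmpty.{v}.N := ⟨fun x => (x.simplex : PEmpty).elim⟩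
    infer_instance

lemma sEmpty_hom_ext {W Z : SSet.{v}} (f g : W ⟶ (ihom sEmpty.{v}).obj Z) : f = g := by
  apply MonoidalClosed.uncurry_injective
  ext q x
  exact (x.1 : PEmpty).elim

/-- The simplicial set of maps from the empty simplicial set is a point. -/
def sEmptyTerminal (Z : SSet.{v}) : Limits.IsTerminal ((ihom sEmpty.{v}).obj Z) :=
  Limits.IsTerminal.ofUniqueHom
    (fun W => MonoidalClosed.curry
      { app := fun q => ↾fun x => (x.1 : PEmpty).elim
        naturality := fun q r a => by ext x; exact (x.1 : PEmpty).elim })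
    fun _ _ => sEmpty_hom_ext _ _

end

section Derived

variable (D : Type u) [Category.{v} D] [ModelCategory D]

/-- The homotopy category. -/
abbrev Ho := (weakEquivalences D).Localization

/-- The localization functor to the homotopy category. -/
abbrev toHo : D ⥤ Ho D := (weakEquivalences D).Q

variable [SimplicialCategory D] [MonoidalCategory D]
  [SymmetricCategory D] [SymmetricMonoidalEnrichment D] [OperadicModelCategory D]

/-- The tensor product of cofibrant objects, with values in the homotopy category. -/
def cofTensor : CofibrantObject D ⥤ CofibrantObject D ⥤ Ho D :=
  ((Functor.whiskeringLeft₂ (Ho D)).obj CofibrantObject.ι).obj CofibrantObject.ι |>.obj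
    ((Functor.postcompose₂.obj (toHo D)).obj (curriedTensor D))

/-- Mapping spaces from cofibrant to fibrant objects, with values in the homotopy category of
spaces. -/
def cofFibMap : (CofibrantObject D)ᵒᵖ ⥤ FibrantObject D ⥤ HoSSet.{v} :=
  ((Functor.whiskeringLeft₂ HoSSet.{v}).obj CofibrantObject.ι.op).obj FibrantObject.ι |>.obj
    ((Functor.postcompose₂.obj sWeq.{v}.Q).obj (sHomFunctor D))


variable {D}

lemma exists_terminal : ∃ C : D, Nonempty (Limits.IsTerminal C) ∧
    ∀ x : D, Nonempty (Limits.IsTerminal (sHom x C)) := by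
  have := sEmpty_finite.{v}
  obtain ⟨C, ε, h⟩ := OperadicModelCategory.exists_cotensor sEmpty.{v} (⊤_ D)
  have hC (x : D) : Nonempty (Limits.IsTerminal (sHom x C)) := by
    have := h x
    exact ⟨(sEmptyTerminal _).ofIso (asIso (MonoidalClosed.curry ((β_ sEmpty.{v} (sHom x C)).hom ≫
      sHom x C ◁ ε ≫ sHomComp x C (⊤_ D)))).symm⟩
  refine ⟨C, ⟨Limits.IsTerminal.ofUniqueHom
    (fun x => (eHomEquiv SSet.{v}).symm ((hC x).some.from _)) fun x f => ?_⟩, hC⟩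
  rw [Equiv.eq_symm_apply]
  exact (hC x).some.hom_ext _ _

lemma exists_initial : ∃ T : D, Nonempty (Limits.IsInitial T) ∧
    ∀ y : D, Nonempty (Limits.IsTerminal (sHom T y)) := by
  have := sEmpty_finite.{v}
  obtain ⟨T, η, h⟩ := OperadicModelCategory.exists_tensor sEmpty.{v} (⊤_ D)
  have hT (y : D) : Nonempty (Limits.IsTerminal (sHom T y)) := by
    have := h y
    exact ⟨(sEmptyTerminal _).ofIso (asIso (MonoidalClosed.curry
      (η ▷ sHom T y ≫ sHomComp (⊤_ D) T y))).symm⟩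
  refine ⟨T, ⟨Limits.IsInitial.ofUniqueHom
    (fun y => (eHomEquiv SSet.{v}).symm ((hT y).some.from _)) fun y f => ?_⟩, hT⟩
  rw [Equiv.eq_symm_apply]
  exact (hT y).some.hom_ext _ _

lemma map_trivialCofibration {a b : D} (i : a ⟶ b) (y : D) [Cofibration i] [WeakEquivalence i]
    [IsFibrant y] : sWeq (eHomWhiskerRight SSet.{v} i y) := by
  obtain ⟨C, ⟨hC⟩, hC'⟩ := exists_terminal (D := D)
  have : Fibration (hC.from y) := (isFibrant_iff_of_isTerminal _ hC).1 inferInstance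
  let sq : (sHomFunctor D).PullbackObjObj i (hC.from y) :=
    { pt := sHom a y
      fst := 𝟙 _
      snd := (hC' b).some.from _
      isPullback := by
        have h1 : IsIso (((sHomFunctor D).map i.op).app C) :=
          Limits.isIso_of_isTerminal (hC' b).some (hC' a).some _
        apply +allowSynthFailures IsPullback.of_horiz_isIso
        · exact IsIso.id (sHom a y)
        · exact ⟨(hC' a).some.hom_ext _ _⟩
      π := eHomWhiskerRight SSet.{v} i y
      π_fst := Category.comp_id _
      π_snd := (hC' b).some.hom_ext _ _ }
  exact (OperadicModelCategory.sm7 i (hC.from y) sq).2 (.inl inferInstance)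

lemma map_trivialFibration (x : D) {y z : D} (p : y ⟶ z) [Fibration p] [WeakEquivalence p]
    [IsCofibrant x] : sWeq (eHomWhiskerLeft SSet.{v} x p) := by
  obtain ⟨T, ⟨hT⟩, hT'⟩ := exists_initial (D := D)
  have : Cofibration (hT.to x) := (isCofibrant_iff_of_isInitial _ hT).1 inferInstance
  let sq : (sHomFunctor D).PullbackObjObj (hT.to x) p :=
    { pt := sHom x z
      fst := (hT' y).some.from _
      snd := 𝟙 _
      isPullback := by
        have h1 : IsIso (((sHomFunctor D).obj (op T)).map p) :=
          Limits.isIso_of_isTerminal (hT' y).some (hT' z).some _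
        apply +allowSynthFailures IsPullback.of_vert_isIso
        · exact IsIso.id (sHom x z)
        · exact ⟨(hT' z).some.hom_ext _ _⟩
      π := eHomWhiskerLeft SSet.{v} x p
      π_fst := (hT' y).some.hom_ext _ _
      π_snd := Category.comp_id _ }
  exact (OperadicModelCategory.sm7 (hT.to x) p sq).2 (.inr inferInstance)

lemma isIso_map_weq_left {a b : D} (f : a ⟶ b) (y : D) [IsCofibrant a] [IsCofibrant b]
    [WeakEquivalence f] [IsFibrant y] : IsIso (sWeq.{v}.Q.map (eHomWhiskerRight SSet.{v} f y)) := by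
  let G : Dᵒᵖ ⥤ HoSSet.{v} := (sHomFunctor D).flip.obj y ⋙ sWeq.{v}.Q
  have hG {c d : D} (i : c ⟶ d) [Cofibration i] [WeakEquivalence i] : IsIso (G.map i.op) :=
    Localization.inverts sWeq.Q sWeq _ (map_trivialCofibration i y)
  let h : CofibrantBrownFactorization f := Classical.arbitrary _
  have h1 := hG h.i
  have h2 := hG h.s
  have h3 : G.map h.p.op ≫ G.map h.s.op = 𝟙 _ := by
    rw [← G.map_comp, ← op_comp, h.s_p, op_id, G.map_id]
  have h4 : IsIso (G.map h.p.op) := by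
    rw [show G.map h.p.op = inv (G.map h.s.op) by rw [← cancel_mono (G.map h.s.op), h3]; simp]
    infer_instance
  have h5 : G.map f.op = G.map h.p.op ≫ G.map h.i.op := by
    rw [← G.map_comp, ← op_comp, h.fac]
  change IsIso (G.map f.op)
  rw [h5]
  infer_instance

lemma isIso_map_weq_right (x : D) {y z : D} (f : y ⟶ z) [IsFibrant y] [IsFibrant z]
    [WeakEquivalence f] [IsCofibrant x] :
    IsIso (sWeq.{v}.Q.map (eHomWhiskerLeft SSet.{v} x f)) := by
  let G : D ⥤ HoSSet.{v} := (sHomFunctor D).obj (op x) ⋙ sWeq.{v}.Q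
  have hG {c d : D} (i : c ⟶ d) [Fibration i] [WeakEquivalence i] : IsIso (G.map i) :=
    Localization.inverts sWeq.Q sWeq _ (map_trivialFibration x i)
  let h : FibrantBrownFactorization f := Classical.arbitrary _
  have h1 := hG h.p
  have h2 := hG h.r
  have h3 : G.map h.i ≫ G.map h.r = 𝟙 _ := by
    rw [← G.map_comp, h.i_r, G.map_id]
  have h4 : IsIso (G.map h.i) := by
    rw [show G.map h.i = inv (G.map h.r) by rw [← cancel_mono (G.map h.r), h3]; simp]
    infer_instance
  have h5 : G.map f = G.map h.i ≫ G.map h.p := by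
    rw [← G.map_comp, h.fac]
  change IsIso (G.map f)
  rw [h5]
  infer_instance

variable (D)

lemma cofTensor_inverts : MorphismProperty.IsInvertedBy₂ (weakEquivalences (CofibrantObject D))
    (weakEquivalences (CofibrantObject D)) (cofTensor D) := by
  rintro ⟨a, x⟩ ⟨b, y⟩ ⟨f, g⟩ ⟨hf, hg⟩
  have : WeakEquivalence f.hom := ⟨hf⟩
  have : WeakEquivalence g.hom := ⟨hg⟩
  have h1 : IsIso ((toHo D).map (f.hom ▷ x.obj)) :=
    Localization.inverts _ (weakEquivalences D) _
      (OperadicModelCategory.weq_whiskerRight f.hom x.obj).mem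
  have h2 : IsIso ((toHo D).map (b.obj ◁ g.hom)) :=
    Localization.inverts _ (weakEquivalences D) _
      (OperadicModelCategory.weq_whiskerLeft b.obj g.hom).mem
  exact IsIso.comp_isIso' h1 h2

lemma cofFibMap_inverts : MorphismProperty.IsInvertedBy₂ (weakEquivalences (CofibrantObject D)).op
    (weakEquivalences (FibrantObject D)) (cofFibMap D) := by
  rintro ⟨a, x⟩ ⟨b, y⟩ ⟨f, g⟩ ⟨hf, hg⟩
  have : WeakEquivalence f.unop.hom := ⟨hf⟩
  have : WeakEquivalence g.hom := ⟨hg⟩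
  exact IsIso.comp_isIso' (isIso_map_weq_left f.unop.hom x.obj)
    (isIso_map_weq_right b.unop.obj g.hom)

/-- The derived tensor product. -/
def derivedTensor : Ho D ⥤ Ho D ⥤ Ho D :=
  Localization.lift₂ (cofTensor D) (cofTensor_inverts D) (CofibrantObject.ι ⋙ toHo D)
    (CofibrantObject.ι ⋙ toHo D)

/-- The derived mapping spaces. -/
def derivedMap : (Ho D)ᵒᵖ ⥤ Ho D ⥤ HoSSet.{v} :=
  Localization.lift₂ (cofFibMap D) (cofFibMap_inverts D) (CofibrantObject.ι ⋙ toHo D).op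
    (FibrantObject.ι ⋙ toHo D)

variable {D}

/-- The derived tensor product of two objects. -/
abbrev dtens (x y : Ho D) : Ho D := ((derivedTensor D).obj x).obj y

/-- The derived tensor powers. -/
def dpow (x : Ho D) : ℕ → Ho D
  | 0 => (toHo D).obj (𝟙_ D)
  | n + 1 => dtens (dpow x n) x

/-- The derived mapping space of two objects. -/
abbrev dmap (x y : Ho D) : HoSSet.{v} := ((derivedMap D).obj (op x)).obj y

variable (D)

/-- A weak function object: a functor `F` together with a natural transformation `adj` from the
derived mapping space of `x ⊗ y` and `z` to that of `x` and `F (y, z)`, in the homotopy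
category of spaces. -/
structure WeakFunctionObject where
  F : (Ho D)ᵒᵖ ⥤ Ho D ⥤ Ho D
  adj (x y z : Ho D) : dmap (dtens x y) z ⟶ dmap x ((F.obj (op y)).obj z)
  adj_natural_left {x x' : Ho D} (f : x ⟶ x') (y z : Ho D) :
    ((derivedMap D).map (((derivedTensor D).map f).app y).op).app z ≫ adj x y z =
      adj x' y z ≫ ((derivedMap D).map f.op).app _
  adj_natural_middle (x : Ho D) {y y' : Ho D} (f : y ⟶ y') (z : Ho D) :
    ((derivedMap D).map (((derivedTensor D).obj x).map f).op).app z ≫ adj x y z =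
      adj x y' z ≫ ((derivedMap D).obj (op x)).map ((F.map f.op).app z)
  adj_natural_right (x y : Ho D) {z z' : Ho D} (f : z ⟶ z') :
    ((derivedMap D).obj (op (dtens x y))).map f ≫ adj x y z' =
      adj x y z ≫ ((derivedMap D).obj (op x)).map ((F.obj (op y)).map f)

variable {D}

/-- The weak function object provides an adjoint for maps from the derived tensor product of
`x` and `y` to `z`. -/
def WeakFunctionObject.ProvidesAdjoint (W : WeakFunctionObject D) (x y z : Ho D) : Prop :=
  IsIso (W.adj x y z)

/-- A morphism `η : x ⟶ y` is rigid if `F (y, y) ⟶ F (x, y)` is an isomorphism. -/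
def WeakFunctionObject.IsRigid (W : WeakFunctionObject D) {x y : Ho D} (η : x ⟶ y) : Prop :=
  IsIso ((W.F.map η.op).app y)

/-- The morphism `f` of `D` is a fibration between cofibrant-fibrant objects which represents
the morphism `η` of the homotopy category. -/
structure Represents {X Y : D} (f : X ⟶ Y) {x y : Ho D} (η : x ⟶ y) : Prop where
  fibration : Fibration f
  cofibrant_source : IsCofibrant X
  fibrant_source : IsFibrant X
  cofibrant_target : IsCofibrant Y
  fibrant_target : IsFibrant Y
  iso : Nonempty (Arrow.mk ((toHo D).map f) ≅ Arrow.mk η)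

end Derived

end OperadicRigidity

end

open OperadicRigidity

/-!
The operations of `End(f)` are the pullback of `Map(X^n, f) : Map(X^n, X) → Map(X^n, Y)` and
`(f^n)^* : Map(Y^n, Y) → Map(X^n, Y)`. Since `Map(X^n, f)` is a fibration of Kan complexes, right
properness reduces the levelwise weak equivalence `End(f) → End(X)` to `(f^n)^*` being a weak
equivalence. Rigidity of `η` and the adjoints show that `(X^n ⊗ Y^m) ⊗ f` induces weak equivalences
on mapping spaces to `Y`, and `f^n` is a composite of such maps, which replace one factor `X` by `Y`
at a time. As the unit need not be cofibrant, this is done for tensor powers that start with a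
cofibrant replacement of the unit.

For the homotopy fibers, `Map(O, -)` commutes with mapping path objects, and when `O` is cofibrant
it takes levelwise trivial fibrations to trivial fibrations. A weak equivalence of levelwise Kan
operads is replaced by the end point map of its mapping path operad, which is a levelwise trivial
fibration, so the homotopy fibers are fibers of a trivial fibration.
-/

noncomputable section

namespace OperadicRigidity

section Paths

open SSet SSet.modelCategoryQuillen Simplicial CartesianMonoidalCategory

/-- The vertex `i` of the interval. -/
abbrev intervalVertex (i : Fin 2) : 𝟙_ SSet.{v} ⟶ Δ[1] := SSet.const (stdSimplex.obj₀Equiv.symm i)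

lemma anodyne_δ (k : Fin 2) : anodyneExtensions (stdSimplex.δ.{v} k) := by
  intro E B p hp
  have : Fibration p := ⟨hp⟩
  refine ⟨fun {e b} sq => ?_⟩
  have ne_add_one : ∀ j : Fin 2, j ≠ j + 1 := by decide
  have eq_of_ne_add_one : ∀ j k : Fin 2, j ≠ k + 1 → j = k := by decide
  have hc : horn.IsCompatible (n := 0) (i := k + 1) fun _ _ => e := by
    rw [horn.isCompatible_zero_iff_true]; trivial
  obtain ⟨l, hl, hl'⟩ := hc.exists_lift p b fun j hj => by
    rw [eq_of_ne_add_one j k hj]; exact sq.w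
  exact ⟨⟨{ l := l, fac_left := hl k (ne_add_one k), fac_right := hl' }⟩⟩

lemma anodyne_intervalVertex (i : Fin 2) : anodyneExtensions (intervalVertex.{v} i) := by
  let T : 𝟙_ SSet.{v} ≅ Δ[0] := isTerminalTensorUnit.uniqueUpToIso stdSimplex.isTerminalObj₀
  have of_δ (k : Fin 2) (hk : stdSimplex.δ.{v} k = SSet.const (stdSimplex.obj₀Equiv.symm i)) :
      anodyneExtensions (intervalVertex.{v} i) := by
    have : intervalVertex.{v} i = T.hom ≫ stdSimplex.δ k := by rw [hk]; rfl
    rw [this]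
    exact anodyneExtensions.comp_mem _ _ (.of_isIso _) (anodyne_δ k)
  fin_cases i
  · exact of_δ 1 stdSimplex.δ_one_eq_const
  · exact of_δ 0 stdSimplex.δ_zero_eq_const

lemma exists_lift_pushoutProduct {C D K L E B : SSet.{v}} {i : C ⟶ D} {j : K ⟶ L} {p : E ⟶ B}
    [Fibration p] (h : (Mono i ∧ anodyneExtensions j) ∨ (anodyneExtensions i ∧ Mono j))
    {f : C ⊗ L ⟶ E} {g : D ⊗ K ⟶ E} {b : D ⊗ L ⟶ B} (hfg : C ◁ j ≫ f = i ▷ K ≫ g)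
    (hf : i ▷ L ≫ b = f ≫ p) (hg : D ◁ j ≫ b = g ≫ p) :
    ∃ l : D ⊗ L ⟶ E, i ▷ L ≫ l = f ∧ D ◁ j ≫ l = g ∧ l ≫ p = b := by
  let P := Functor.PushoutObjObj.ofHasPushout (curriedTensor SSet.{v}) i j
  have inr_ι : i ▷ L = P.inr ≫ P.ι := P.inr_ι.symm
  have inl_ι : D ◁ j = P.inl ≫ P.ι := P.inl_ι.symm
  have anodyne_ι : anodyneExtensions P.ι := by
    rcases h with ⟨_, hj⟩ | ⟨hi, _⟩
    · exact anodyneExtensions_pushoutObjObjι P hj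
    · exact anodyneExtensions_pushoutObjObjι' P hi
  have : HasLiftingProperty P.ι p := anodyne_ι p (mem_fibrations p)
  have sq : CommSq (P.isPushout.desc g f hfg.symm) P.ι p b := ⟨by
    apply P.isPushout.hom_ext
    · simp [hg]
    · simp [hf]⟩
  refine ⟨sq.lift, ?_, ?_, sq.fac_right⟩
  · rw [inr_ι, Category.assoc, sq.fac_left]
    exact P.isPushout.inr_desc _ _ _
  · rw [inl_ι, Category.assoc, sq.fac_left]
    exact P.isPushout.inl_desc _ _ _

/-- The inclusion of `X` into the cylinder on `X` as the end over the vertex `i`. -/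
def cylinderEnd (i : Fin 2) (X : SSet.{v}) : X ⟶ Δ[1] ⊗ X := (λ_ X).inv ≫ intervalVertex i ▷ X

lemma anodyne_cylinderEnd (i : Fin 2) (X : SSet.{v}) : anodyneExtensions (cylinderEnd i X) :=
  anodyneExtensions.comp_mem _ _ (.of_isIso _) ((anodyne_intervalVertex i).whiskerRight X)

lemma cylinderEnd_naturality (i : Fin 2) {X Y : SSet.{v}} (f : X ⟶ Y) :
    cylinderEnd i X ≫ Δ[1] ◁ f = f ≫ cylinderEnd i Y := rfl

@[simp]
lemma cylinderEnd_snd (i : Fin 2) (X : SSet.{v}) : cylinderEnd i X ≫ snd _ _ = 𝟙 X := rfl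

lemma pathEv_eq_cylinderEnd_comp_ev (Y : SSet.{v}) (i : Fin 2) :
    pathEv Y i = cylinderEnd i _ ≫ (ihom.ev _).app Y := (Category.assoc _ _ _).symm

lemma cylinderEnd_uncurry {X Y : SSet.{v}} (i : Fin 2) (h : X ⟶ (ihom Δ[1]).obj Y) :
    cylinderEnd i X ≫ MonoidalClosed.uncurry h = h ≫ pathEv Y i := by
  rw [MonoidalClosed.uncurry_eq, ← Category.assoc, cylinderEnd_naturality,
    pathEv_eq_cylinderEnd_comp_ev, Category.assoc]

lemma curry_pathEv {X Y : SSet.{v}} (i : Fin 2) (h : Δ[1] ⊗ X ⟶ Y) :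
    MonoidalClosed.curry h ≫ pathEv Y i = cylinderEnd i X ≫ h := by
  rw [← cylinderEnd_uncurry, MonoidalClosed.uncurry_curry]

lemma ihom_map_pathEv {X Y : SSet.{v}} (i : Fin 2) (f : X ⟶ Y) :
    (ihom Δ[1]).map f ≫ pathEv Y i = pathEv X i ≫ f := by
  rw [pathEv_eq_cylinderEnd_comp_ev, pathEv_eq_cylinderEnd_comp_ev,
    ← reassoc_of% (cylinderEnd_naturality i), ihom.ev_naturality, Category.assoc]

lemma comp_map_pathEv {W X Y : SSet.{v}} (i : Fin 2) (h : W ⟶ (ihom Δ[1]).obj X) (f : X ⟶ Y) :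
    (h ≫ (ihom Δ[1]).map f) ≫ pathEv Y i = (h ≫ pathEv X i) ≫ f := by
  rw [Category.assoc, Category.assoc]
  exact congrArg _ (ihom_map_pathEv i f)

/-- The inclusion of the constant paths. -/
def constPath (Y : SSet.{v}) : Y ⟶ (ihom Δ[1]).obj Y := MonoidalClosed.curry (snd _ _)

@[simp]
lemma constPath_pathEv (Y : SSet.{v}) (i : Fin 2) : constPath Y ≫ pathEv Y i = 𝟙 Y := by
  rw [constPath, curry_pathEv, cylinderEnd_snd]

lemma constPath_naturality {X Y : SSet.{v}} (f : X ⟶ Y) :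
    constPath X ≫ (ihom Δ[1]).map f = f ≫ constPath Y := by
  rw [constPath, constPath, ← MonoidalClosed.curry_natural_left,
    ← MonoidalClosed.curry_natural_right, whiskerLeft_snd]

lemma exists_pathLift (i : Fin 2) {K L E B : SSet.{v}} (k : K ⟶ L) [Mono k] (p : E ⟶ B)
    [Fibration p] (h : K ⟶ (ihom Δ[1]).obj E) (b : L ⟶ (ihom Δ[1]).obj B) (e : L ⟶ E)
    (hk : h ≫ pathEv E i = k ≫ e) (hp : h ≫ (ihom Δ[1]).map p = k ≫ b)
    (hb : b ≫ pathEv B i = e ≫ p) :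
    ∃ H : L ⟶ (ihom Δ[1]).obj E, k ≫ H = h ∧ H ≫ pathEv E i = e ∧ H ≫ (ihom Δ[1]).map p = b := by
  rw [← cylinderEnd_uncurry, cylinderEnd] at hk hb
  obtain ⟨l, hl₁, hl₂, hl₃⟩ := exists_lift_pushoutProduct (i := intervalVertex i) (j := k) (p := p)
    (.inr ⟨anodyne_intervalVertex i, inferInstance⟩) (f := (λ_ L).hom ≫ e)
    (g := MonoidalClosed.uncurry h) (b := MonoidalClosed.uncurry b)
    (by rw [leftUnitor_naturality_assoc, ← hk]; simp)
    (by rw [Category.assoc, ← hb]; simp)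
    (by rw [← MonoidalClosed.uncurry_natural_left, ← hp, MonoidalClosed.uncurry_natural_right])
  refine ⟨MonoidalClosed.curry l, ?_, ?_, ?_⟩
  · rw [← MonoidalClosed.curry_natural_left, hl₂, MonoidalClosed.curry_uncurry]
  · rw [curry_pathEv, cylinderEnd, Category.assoc, hl₁, Iso.inv_hom_id_assoc]
  · rw [← MonoidalClosed.curry_natural_right, hl₃, MonoidalClosed.curry_uncurry]

/-- The discrete simplicial set on two points, a model of the boundary of the interval. -/
abbrev twoPoints : SSet.{v} := FunctorToTypes.coprod (𝟙_ SSet.{v}) (𝟙_ SSet.{v})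

/-- The inclusion of the two vertices of the interval. -/
def twoVertices : twoPoints.{v} ⟶ Δ[1] :=
  FunctorToTypes.coprod.desc (intervalVertex 0) (intervalVertex 1)

instance : Mono twoVertices.{v} := by
  have ne (n : SimplexCategoryᵒᵖ) (h : (intervalVertex.{v} 0).app n PUnit.unit =
      (intervalVertex 1).app n PUnit.unit) : False := by
    have h := congrArg (Δ[1].map (SimplexCategory.const ⦋0⦌ n.unop 0).op) h
    rw [← app_map, ← app_map] at h
    have : (0 : Fin 2) = 1 := congrArg stdSimplex.obj₀Equiv h
    simp at this
  apply +allowSynthFailures NatTrans.mono_of_mono_app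
  intro n
  rw [mono_iff_injective]
  rintro (⟨⟩ | ⟨⟩) (⟨⟩ | ⟨⟩) h
  · rfl
  · exact (ne n h).elim
  · exact (ne n h.symm).elim
  · rfl

/-- The map out of two copies of `L` given by a pair of maps out of `L`. -/
def twoPointsDesc {L E : SSet.{v}} (f : Fin 2 → (L ⟶ E)) : twoPoints.{v} ⊗ L ⟶ E where
  app n := ↾fun x => Sum.elim (fun _ => (f 0).app n x.2) (fun _ => (f 1).app n x.2) x.1
  naturality n m a := by
    ext ⟨_ | _, y⟩
    · exact app_map (f 0) a y
    · exact app_map (f 1) a y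

/-- The inclusion of the copy of `L` over the point `i`. -/
def twoPointsInclusion (i : Fin 2) (L : SSet.{v}) : L ⟶ twoPoints.{v} ⊗ L :=
  (λ_ L).inv ≫ (![FunctorToTypes.coprod.inl, FunctorToTypes.coprod.inr] i) ▷ L

lemma twoPoints_hom_ext {L E : SSet.{v}} {f g : twoPoints.{v} ⊗ L ⟶ E}
    (h : ∀ i, twoPointsInclusion i L ≫ f = twoPointsInclusion i L ≫ g) : f = g := by
  ext n ⟨_ | _, y⟩
  · exact app_congr (h 0) n y
  · exact app_congr (h 1) n y

@[simp]
lemma twoPointsInclusion_desc {L E : SSet.{v}} (f : Fin 2 → (L ⟶ E)) (i : Fin 2) :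
    twoPointsInclusion i L ≫ twoPointsDesc f = f i := by
  fin_cases i <;> rfl

@[simp]
lemma twoPointsInclusion_whiskerRight (L : SSet.{v}) (i : Fin 2) :
    twoPointsInclusion i L ≫ twoVertices ▷ L = cylinderEnd i L := by
  fin_cases i <;> rfl

lemma twoPointsInclusion_naturality {K L : SSet.{v}} (k : K ⟶ L) (i : Fin 2) :
    twoPointsInclusion i K ≫ twoPoints ◁ k = k ≫ twoPointsInclusion i L := by
  fin_cases i <;> rfl

lemma exists_path_extension {K L E B : SSet.{v}} {k : K ⟶ L} (hk : anodyneExtensions k) (p : E ⟶ B)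
    [Fibration p] (h : K ⟶ (ihom Δ[1]).obj E) (b : L ⟶ (ihom Δ[1]).obj B) (e : Fin 2 → (L ⟶ E))
    (he : ∀ i, h ≫ pathEv E i = k ≫ e i) (hp : h ≫ (ihom Δ[1]).map p = k ≫ b)
    (hb : ∀ i, b ≫ pathEv B i = e i ≫ p) :
    ∃ H : L ⟶ (ihom Δ[1]).obj E, k ≫ H = h ∧ (∀ i, H ≫ pathEv E i = e i) ∧
      H ≫ (ihom Δ[1]).map p = b := by
  obtain ⟨l, hl₁, hl₂, hl₃⟩ := exists_lift_pushoutProduct (i := twoVertices) (j := k) (p := p)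
    (.inl ⟨inferInstance, hk⟩) (f := twoPointsDesc e) (g := MonoidalClosed.uncurry h)
    (b := MonoidalClosed.uncurry b)
    (twoPoints_hom_ext fun i => by
      rw [reassoc_of% (twoPointsInclusion_naturality k i), twoPointsInclusion_desc,
        reassoc_of% (twoPointsInclusion_whiskerRight K i), cylinderEnd_uncurry, he])
    (twoPoints_hom_ext fun i => by
      rw [reassoc_of% (twoPointsInclusion_whiskerRight L i), cylinderEnd_uncurry, hb,
        reassoc_of% (twoPointsInclusion_desc e i)])
    (by rw [← MonoidalClosed.uncurry_natural_left, ← hp, MonoidalClosed.uncurry_natural_right])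
  refine ⟨MonoidalClosed.curry l, ?_, fun i => ?_, ?_⟩
  · rw [← MonoidalClosed.curry_natural_left, hl₂, MonoidalClosed.curry_uncurry]
  · rw [curry_pathEv, ← twoPointsInclusion_whiskerRight, Category.assoc, hl₁,
      twoPointsInclusion_desc]
  · rw [← MonoidalClosed.curry_natural_right, hl₃, MonoidalClosed.curry_uncurry]

lemma exists_vertical_path {X E B : SSet.{v}} (p : E ⟶ B) [Fibration p]
    (h h' : X ⟶ (ihom Δ[1]).obj E) (h₀ : h ≫ pathEv E 0 = h' ≫ pathEv E 0)
    (hp : h ≫ (ihom Δ[1]).map p = h' ≫ (ihom Δ[1]).map p) :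
    ∃ H : X ⟶ (ihom Δ[1]).obj E, H ≫ pathEv E 0 = h ≫ pathEv E 1 ∧
      H ≫ pathEv E 1 = h' ≫ pathEv E 1 ∧
      H ≫ (ihom Δ[1]).map p = ((h ≫ pathEv E 1) ≫ p) ≫ constPath B := by
  obtain ⟨G, -, hG, hGp⟩ := exists_path_extension (anodyne_cylinderEnd 0 X) p
    ((h ≫ pathEv E 0) ≫ constPath E)
    (MonoidalClosed.uncurry (h ≫ (ihom Δ[1]).map p) ≫ constPath B)
    ![MonoidalClosed.uncurry h, MonoidalClosed.uncurry h']
    (fun i => by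
      rw [Category.assoc, constPath_pathEv, Category.comp_id]
      fin_cases i
      · exact (cylinderEnd_uncurry 0 h).symm
      · exact h₀.trans (cylinderEnd_uncurry 0 h').symm)
    (by rw [Category.assoc, constPath_naturality, ← Category.assoc, ← Category.assoc,
      cylinderEnd_uncurry, comp_map_pathEv])
    (fun i => by
      rw [Category.assoc, constPath_pathEv, Category.comp_id]
      fin_cases i
      · exact MonoidalClosed.uncurry_natural_right h p
      · exact (congrArg _ hp).trans (MonoidalClosed.uncurry_natural_right h' p))
  refine ⟨cylinderEnd 1 X ≫ G, ?_, ?_, ?_⟩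
  · rw [Category.assoc, hG 0]
    exact cylinderEnd_uncurry 1 h
  · rw [Category.assoc, hG 1]
    exact cylinderEnd_uncurry 1 h'
  · rw [Category.assoc, hGp, ← Category.assoc, cylinderEnd_uncurry, comp_map_pathEv]

lemma path_terminal_hom_ext {X : SSet.{v}} (h h' : X ⟶ (ihom Δ[1]).obj (⊤_ SSet.{v})) : h = h' :=
  MonoidalClosed.uncurry_injective (Limits.terminal.hom_ext _ _)

end Paths

section WeakEquivalences

open SSet SSet.modelCategoryQuillen Simplicial CartesianMonoidalCategory

/-- Simplicial homotopy of maps, witnessed by a map to the path object of the target. -/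
def Homotopic {X Y : SSet.{v}} (f g : X ⟶ Y) : Prop :=
  ∃ h : X ⟶ (ihom Δ[1]).obj Y, h ≫ pathEv Y 0 = f ∧ h ≫ pathEv Y 1 = g

namespace Homotopic

variable {W X Y Z : SSet.{v}}

lemma refl (f : X ⟶ Y) : Homotopic f f := ⟨f ≫ constPath Y, by simp, by simp⟩

lemma precomp (k : W ⟶ X) {f g : X ⟶ Y} (h : Homotopic f g) : Homotopic (k ≫ f) (k ≫ g) := by
  obtain ⟨h, rfl, rfl⟩ := h
  exact ⟨k ≫ h, Category.assoc _ _ _, Category.assoc _ _ _⟩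

lemma postcomp {f g : X ⟶ Y} (h : Homotopic f g) (k : Y ⟶ Z) : Homotopic (f ≫ k) (g ≫ k) := by
  obtain ⟨h, rfl, rfl⟩ := h
  exact ⟨h ≫ (ihom Δ[1]).map k, comp_map_pathEv 0 h k, comp_map_pathEv 1 h k⟩

lemma euclidean [KanComplex Y] {f g g' : X ⟶ Y} (h : Homotopic f g) (h' : Homotopic f g') :
    Homotopic g g' := by
  obtain ⟨h, rfl, rfl⟩ := h
  obtain ⟨h', e, rfl⟩ := h'
  obtain ⟨H, hH, hH', -⟩ := exists_vertical_path (Limits.terminal.from Y) h h' e.symm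
    (path_terminal_hom_ext _ _)
  exact ⟨H, hH, hH'⟩

lemma symm [KanComplex Y] {f g : X ⟶ Y} (h : Homotopic f g) : Homotopic g f :=
  h.euclidean (refl f)

lemma trans [KanComplex Y] {f g k : X ⟶ Y} (h : Homotopic f g) (h' : Homotopic g k) :
    Homotopic f k :=
  h.symm.euclidean h'

end Homotopic

/-- The maps `X ⟶ Y` as the vertices of the internal hom. -/
def homVertexEquiv {X Y : SSet.{v}} : (X ⟶ Y) ≃ ((ihom X).obj Y) _⦋0⦌ :=
  MonoidalClosed.curryHomEquiv'.trans (unitHomEquiv _)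

lemma const_homVertexEquiv {X Y : SSet.{v}} (f : X ⟶ Y) :
    SSet.const (homVertexEquiv f) = MonoidalClosed.curry ((ρ_ X).hom ≫ f) :=
  (unitHomEquiv _).symm_apply_apply (MonoidalClosed.curry' f)

lemma pre_homVertexEquiv {X Y Z : SSet.{v}} (f : X ⟶ Y) (g : Y ⟶ Z) :
    ((MonoidalClosed.pre f).app Z).app _ (homVertexEquiv g) = homVertexEquiv (f ≫ g) := by
  have curry_pre := MonoidalClosed.curry_pre_app f ((ρ_ Y).hom ≫ g)
  rw [rightUnitor_naturality_assoc] at curry_pre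
  exact app_congr curry_pre _ PUnit.unit

lemma const_inj {K : SSet.{v}} {x y : K _⦋0⦌} :
    (SSet.const x : 𝟙_ SSet.{v} ⟶ K) = SSet.const y ↔ x = y :=
  (unitHomEquiv K).symm.injective.eq_iff

lemma intervalVertex_comp_eq_const_iff {K : SSet.{v}} (s : Δ[1] ⟶ K) (i : Fin 2) (x : K _⦋0⦌) :
    intervalVertex i ≫ s = SSet.const x ↔ K.δ (1 - i) (yonedaEquiv s) = x := by
  have vertex : K.δ (1 - i) (yonedaEquiv s) = s.app _ (stdSimplex.obj₀Equiv.symm i) := by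
    refine (app_map s _ _).symm.trans (congrArg (s.app _) (stdSimplex.obj₀Equiv.injective ?_))
    fin_cases i <;> rfl
  rw [SSet.const_comp, const_inj, vertex]

lemma nonempty_edge_iff {K : SSet.{v}} (x y : K _⦋0⦌) : Nonempty (Edge x y) ↔
    ∃ s : Δ[1] ⟶ K, intervalVertex 0 ≫ s = SSet.const x ∧
      intervalVertex 1 ≫ s = SSet.const y := by
  simp only [intervalVertex_comp_eq_const_iff]
  constructor
  · rintro ⟨e⟩
    exact ⟨yonedaEquiv.symm e.edge, by simp, by simp⟩
  · rintro ⟨s, hs, hs'⟩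
    exact ⟨Edge.mk (yonedaEquiv s) hs hs'⟩

lemma π₀Rel_homVertexEquiv {X Y : SSet.{v}} (f g : X ⟶ Y) :
    π₀Rel (homVertexEquiv f) (homVertexEquiv g) ↔ Homotopic f g := by
  have vertex_iff (i : Fin 2) (s : Δ[1] ⟶ (ihom X).obj Y) (f : X ⟶ Y) :
      intervalVertex i ≫ s = SSet.const (homVertexEquiv f) ↔
        cylinderEnd i X ≫ (β_ _ _).hom ≫ MonoidalClosed.uncurry s = f := by
    rw [const_homVertexEquiv, ← MonoidalClosed.uncurry_injective.eq_iff,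
      MonoidalClosed.uncurry_curry, MonoidalClosed.uncurry_natural_left, ← Iso.inv_comp_eq]
    rfl
  rw [π₀Rel, nonempty_edge_iff]
  simp only [vertex_iff]
  constructor
  · rintro ⟨s, h₀, h₁⟩
    exact ⟨MonoidalClosed.curry ((β_ _ _).hom ≫ MonoidalClosed.uncurry s), by rwa [curry_pathEv],
      by rwa [curry_pathEv]⟩
  · rintro ⟨h, h₀, h₁⟩
    refine ⟨MonoidalClosed.curry ((β_ _ _).hom ≫ MonoidalClosed.uncurry h), ?_, ?_⟩
    · rw [MonoidalClosed.uncurry_curry, SymmetricCategory.symmetry_assoc, cylinderEnd_uncurry, h₀]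
    · rw [MonoidalClosed.uncurry_curry, SymmetricCategory.symmetry_assoc, cylinderEnd_uncurry, h₁]

lemma equivalence_π₀Rel_ihom (X Y : SSet.{v}) [KanComplex Y] :
    Equivalence (π₀Rel : ((ihom X).obj Y) _⦋0⦌ → ((ihom X).obj Y) _⦋0⦌ → Prop) := by
  have iff_homotopic (x y : ((ihom X).obj Y) _⦋0⦌) :
      π₀Rel x y ↔ Homotopic (homVertexEquiv.symm x) (homVertexEquiv.symm y) := by
    rw [← π₀Rel_homVertexEquiv, Equiv.apply_symm_apply, Equiv.apply_symm_apply]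
  constructor
  · exact fun x => (iff_homotopic _ _).2 (.refl _)
  · exact fun h => (iff_homotopic _ _).2 ((iff_homotopic _ _).1 h).symm
  · exact fun h h' =>
      (iff_homotopic _ _).2 (((iff_homotopic _ _).1 h).trans ((iff_homotopic _ _).1 h'))

lemma π₀_mk_homVertexEquiv {X Y : SSet.{v}} [KanComplex Y] (f g : X ⟶ Y) :
    π₀.mk (homVertexEquiv f) = π₀.mk (homVertexEquiv g) ↔ Homotopic f g := by
  rw [π₀.mk_eq_mk_iff, (equivalence_π₀Rel_ihom X Y).eqvGen_iff, π₀Rel_homVertexEquiv]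

lemma exists_π₀_mk_homVertexEquiv {X Y : SSet.{v}} (c : π₀ ((ihom X).obj Y)) :
    ∃ f : X ⟶ Y, π₀.mk (homVertexEquiv f) = c := by
  induction c with | mk x => exact ⟨homVertexEquiv.symm x, by rw [Equiv.apply_symm_apply]⟩

lemma sWeq_iff {X Y : SSet.{v}} (f : X ⟶ Y) : sWeq f ↔ ∀ (Z : SSet.{v}) [KanComplex Z],
    (∀ g h : Y ⟶ Z, Homotopic (f ≫ g) (f ≫ h) → Homotopic g h) ∧
      ∀ g : X ⟶ Z, ∃ h : Y ⟶ Z, Homotopic (f ≫ h) g := by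
  refine forall_congr' fun Z => forall_congr' fun _ => and_congr ?_ ?_
  · simp only [Function.Injective, (Function.Surjective.forall exists_π₀_mk_homVertexEquiv),
      mapπ₀_mk, pre_homVertexEquiv, π₀_mk_homVertexEquiv]
  · simp only [Function.Surjective, (Function.Surjective.forall exists_π₀_mk_homVertexEquiv),
      (Function.Surjective.exists exists_π₀_mk_homVertexEquiv), mapπ₀_mk, pre_homVertexEquiv,
      π₀_mk_homVertexEquiv]

lemma sWeq_of_homotopyInverse {X Y : SSet.{v}} {f : X ⟶ Y} {g : Y ⟶ X}
    (hfg : Homotopic (f ≫ g) (𝟙 X)) (hgf : Homotopic (g ≫ f) (𝟙 Y)) : sWeq f := by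
  rw [sWeq_iff]
  refine fun Z _ => ⟨fun a b hab => ?_, fun a => ⟨g ≫ a, by simpa using hfg.postcomp a⟩⟩
  have ha : Homotopic (g ≫ f ≫ a) a := by simpa using hgf.postcomp a
  have hb : Homotopic (g ≫ f ≫ b) b := by simpa using hgf.postcomp b
  exact ha.symm.trans ((hab.precomp g).trans hb)

lemma sWeq.exists_homotopyInverse {X Y : SSet.{v}} [KanComplex X] [KanComplex Y] {f : X ⟶ Y}
    (hf : sWeq f) : ∃ g : Y ⟶ X, Homotopic (f ≫ g) (𝟙 X) ∧ Homotopic (g ≫ f) (𝟙 Y) := by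
  rw [sWeq_iff] at hf
  obtain ⟨g, hg⟩ := (hf X).2 (𝟙 X)
  exact ⟨g, hg, (hf Y).1 _ _ (by simpa using hg.postcomp f)⟩

/-- The contravariant functor of homotopy classes of maps to `Z`. -/
def homotopyClasses (Z : SSet.{v}) : SSet.{v} ⥤ (Type v)ᵒᵖ where
  obj X := op (π₀ ((ihom X).obj Z))
  map f := (↾(mapπ₀ ((MonoidalClosed.pre f).app Z))).op
  map_id X := by
    apply Quiver.Hom.unop_inj
    ext x
    simp
  map_comp f g := by
    apply Quiver.Hom.unop_inj
    ext x
    simp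

lemma sWeq_iff_inverseImage {X Y : SSet.{v}} (f : X ⟶ Y) : sWeq f ↔ ∀ Z : SSet.{v}, KanComplex Z →
    (MorphismProperty.isomorphisms _).inverseImage (homotopyClasses Z) f := by
  refine forall_congr' fun Z => forall_congr' fun _ => ?_
  rw [MorphismProperty.inverseImage_iff, MorphismProperty.isomorphisms.iff, ← isIso_unop_iff,
    isIso_iff_bijective]
  rfl

instance : sWeq.{v}.HasTwoOutOfThreeProperty where
  comp_mem f g hf hg := by
    rw [sWeq_iff_inverseImage] at *
    exact fun Z hZ => MorphismProperty.comp_mem _ _ _ (hf Z hZ) (hg Z hZ)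
  of_postcomp f g hg hfg := by
    rw [sWeq_iff_inverseImage] at *
    exact fun Z hZ => MorphismProperty.of_postcomp _ f g (hg Z hZ) (hfg Z hZ)
  of_precomp f g hf hfg := by
    rw [sWeq_iff_inverseImage] at *
    exact fun Z hZ => MorphismProperty.of_precomp _ f g (hf Z hZ) (hfg Z hZ)

lemma sWeq_of_isIso {X Y : SSet.{v}} (f : X ⟶ Y) [IsIso f] : sWeq f := by
  rw [sWeq_iff_inverseImage]
  intro Z _
  exact inferInstanceAs (IsIso ((homotopyClasses Z).map f))

lemma sWeq_of_isIso_map_Q {X Y : SSet.{v}} (f : X ⟶ Y) [IsIso (sWeq.{v}.Q.map f)] : sWeq f := by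
  rw [sWeq_iff_inverseImage]
  intro Z hZ
  have inverts : sWeq.{v}.IsInvertedBy (homotopyClasses Z) := fun _ _ g hg =>
    (sWeq_iff_inverseImage g).1 hg Z hZ
  rw [MorphismProperty.inverseImage_iff, MorphismProperty.isomorphisms.iff,
    ← NatIso.isIso_map_iff (Localization.fac (homotopyClasses Z) inverts sWeq.Q)]
  dsimp
  infer_instance

end WeakEquivalences

section TrivialFibrations

open SSet SSet.modelCategoryQuillen Simplicial CartesianMonoidalCategory

/-- Trivial fibrations of simplicial sets, as the maps with the right lifting property against all
monomorphisms. -/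
abbrev sTrivFib : MorphismProperty SSet.{v} := (MorphismProperty.monomorphisms SSet.{v}).rlp

instance mono_whiskerRight {X Y : SSet.{v}} (f : X ⟶ Y) [Mono f] (Z : SSet.{v}) :
    Mono (f ▷ Z) := by
  apply +allowSynthFailures NatTrans.mono_of_mono_app
  intro n
  rw [mono_iff_injective]
  rintro ⟨x, z⟩ ⟨x', z'⟩ h
  have injective_f := (mono_iff_injective (f.app n)).1 inferInstance
  exact Prod.ext (injective_f (congrArg Prod.fst h)) (congrArg Prod.snd h :)

lemma fibration_of_anodyne_rlp {E B : SSet.{v}} {p : E ⟶ B}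
    (h : anodyneExtensions.rlp p) : Fibration p := by
  rw [fibration_iff]
  intro K L j hj
  exact h j (by rw [anodyneExtensions_eq_llp_rlp]; exact MorphismProperty.le_llp_rlp _ _ hj)

lemma hasLift_of_anodyne {E B K L : SSet.{v}} {j : K ⟶ L} (hj : anodyneExtensions j) (p : E ⟶ B)
    [Fibration p] : HasLiftingProperty j p :=
  hj p (mem_fibrations p)

lemma sTrivFib.fibration {E B : SSet.{v}} {p : E ⟶ B} (h : sTrivFib p) : Fibration p := by
  rw [fibration_iff]
  exact fun K L j hj => h j (J_le_monomorphisms _ hj)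

lemma sTrivFib.homotopic_of_comp_eq {X E B : SSet.{v}} {p : E ⟶ B} (hp : sTrivFib p)
    {f g : X ⟶ E} (hfg : f ≫ p = g ≫ p) : Homotopic f g := by
  have := hp (twoVertices ▷ X) (mono_whiskerRight twoVertices X)
  have sq : CommSq (twoPointsDesc ![f, g]) (twoVertices ▷ X) p (snd _ _ ≫ f ≫ p) := ⟨by
    refine twoPoints_hom_ext fun i => ?_
    rw [reassoc_of% (twoPointsInclusion_desc ![f, g] i),
      reassoc_of% (twoPointsInclusion_whiskerRight X i), reassoc_of% (cylinderEnd_snd i X)]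
    fin_cases i
    · rfl
    · exact hfg.symm⟩
  have end_lift (i : Fin 2) : MonoidalClosed.curry sq.lift ≫ pathEv E i = ![f, g] i := by
    rw [curry_pathEv, ← twoPointsInclusion_whiskerRight, Category.assoc, sq.fac_left,
      twoPointsInclusion_desc]
  exact ⟨MonoidalClosed.curry sq.lift, end_lift 0, end_lift 1⟩

lemma sTrivFib.sWeq {E B : SSet.{v}} {p : E ⟶ B} (hp : sTrivFib p) : sWeq p := by
  have := hp (Limits.initial.to B) (inferInstance : Mono _)
  have sq : CommSq (Limits.initial.to E) (Limits.initial.to B) p (𝟙 B) := ⟨by simp⟩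
  refine sWeq_of_homotopyInverse (g := sq.lift) (hp.homotopic_of_comp_eq (by simp)) ?_
  rw [sq.fac_right]
  exact .refl _

lemma exists_section_homotopic {E B : SSet.{v}} (p : E ⟶ B) [Fibration p] {g : B ⟶ E}
    (hg : Homotopic (g ≫ p) (𝟙 B)) : ∃ s : B ⟶ E, s ≫ p = 𝟙 B ∧ Homotopic g s := by
  obtain ⟨h, h₀, h₁⟩ := hg
  obtain ⟨H, -, hH, hHp⟩ := exists_pathLift 0 (Limits.initial.to B) p (Limits.initial.to _) h g
    (by simp) (by simp) h₀
  refine ⟨H ≫ pathEv E 1, ?_, H, hH, rfl⟩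
  rw [← comp_map_pathEv, hHp, h₁]

lemma exists_vertical_homotopy {E B : SSet.{v}} (p : E ⟶ B) [Fibration p] {s : B ⟶ E}
    (hs : s ≫ p = 𝟙 B) (h : Homotopic (p ≫ s) (𝟙 E)) :
    ∃ H : E ⟶ (ihom Δ[1]).obj E, H ≫ pathEv E 0 = p ≫ s ∧ H ≫ pathEv E 1 = 𝟙 E ∧
      H ≫ (ihom Δ[1]).map p = p ≫ constPath B := by
  obtain ⟨h, h₀, h₁⟩ := h
  obtain ⟨H, hH₀, hH₁, hHp⟩ := exists_vertical_path p (h ≫ (ihom Δ[1]).map (p ≫ s)) h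
    (by rw [comp_map_pathEv, h₀, Category.assoc, reassoc_of% hs])
    (by rw [Category.assoc, ← Functor.map_comp, Category.assoc, hs, Category.comp_id])
  rw [comp_map_pathEv, h₁, Category.id_comp] at hH₀ hHp
  rw [Category.assoc, Category.assoc, reassoc_of% hs] at hHp
  exact ⟨H, hH₀, hH₁.trans h₁, hHp⟩

lemma sTrivFib_of_vertical_homotopy {E B : SSet.{v}} (p : E ⟶ B) [Fibration p] {s : B ⟶ E}
    (hs : s ≫ p = 𝟙 B) (H : E ⟶ (ihom Δ[1]).obj E) (hH₀ : H ≫ pathEv E 0 = p ≫ s)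
    (hH₁ : H ≫ pathEv E 1 = 𝟙 E) (hHp : H ≫ (ihom Δ[1]).map p = p ≫ constPath B) :
    sTrivFib p := by
  intro K L k (_ : Mono k)
  refine ⟨fun {e b} sq => ?_⟩
  obtain ⟨G, hkG, -, hGp⟩ := exists_pathLift 0 k p (e ≫ H) (b ≫ constPath B) (b ≫ s)
    (by rw [Category.assoc, hH₀, reassoc_of% sq.w])
    (by rw [Category.assoc, hHp, reassoc_of% sq.w])
    (by rw [Category.assoc, constPath_pathEv, Category.assoc, hs])
  exact ⟨⟨{
    l := G ≫ pathEv E 1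
    fac_left := by rw [reassoc_of% hkG, hH₁, Category.comp_id]
    fac_right := by
      rw [← comp_map_pathEv, hGp, Category.assoc, constPath_pathEv, Category.comp_id] }⟩⟩

lemma sTrivFib_of_fibration_of_sWeq {E B : SSet.{v}} [KanComplex E] [KanComplex B] (p : E ⟶ B)
    [Fibration p] (hp : sWeq p) : sTrivFib p := by
  obtain ⟨g, hpg, hgp⟩ := hp.exists_homotopyInverse
  obtain ⟨s, hs, hgs⟩ := exists_section_homotopic p hgp
  obtain ⟨H, hH₀, hH₁, hHp⟩ := exists_vertical_homotopy p hs ((hgs.precomp p).euclidean hpg)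
  exact sTrivFib_of_vertical_homotopy p hs H hH₀ hH₁ hHp

lemma sTrivFib_pathEv (i : Fin 2) (B : SSet.{v}) [KanComplex B] : sTrivFib (pathEv B i) := by
  intro K L k (_ : Mono k)
  refine ⟨fun {h e} sq => ?_⟩
  obtain ⟨H, hkH, hH, -⟩ := exists_pathLift i k (Limits.terminal.from B) h
    (e ≫ Limits.terminal.from _ ≫ constPath _) e sq.w (path_terminal_hom_ext _ _)
    (Limits.terminal.hom_ext _ _)
  exact ⟨⟨{ l := H, fac_left := hkH, fac_right := hH }⟩⟩

end TrivialFibrations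

section MappingPathSpaces

open SSet SSet.modelCategoryQuillen Simplicial CartesianMonoidalCategory

variable {A B : SSet.{v}} (w : A ⟶ B)

/-- The mapping path space of `w`: points `a` of the source together with a path starting at
`w a`. -/
abbrev mappingPathSpace : SSet.{v} := Limits.pullback w (pathEv B 0)

/-- The fibrant replacement of `w`, which takes the end of the path. -/
abbrev mappingPathEnd : mappingPathSpace w ⟶ B :=
  Limits.pullback.snd w (pathEv B 0) ≫ pathEv B 1

lemma sTrivFib_mappingPathSpace_fst [KanComplex B] :
    sTrivFib (Limits.pullback.fst w (pathEv B 0)) :=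
  MorphismProperty.pullback_fst _ _ (sTrivFib_pathEv 0 B)

instance kanComplex_mappingPathSpace [KanComplex A] [KanComplex B] :
    KanComplex (mappingPathSpace w) := by
  have := (sTrivFib_mappingPathSpace_fst w).fibration
  exact isFibrant_of_fibration (Limits.pullback.fst w (pathEv B 0))

instance fibration_mappingPathEnd [KanComplex A] [KanComplex B] :
    Fibration (mappingPathEnd w) := by
  refine fibration_of_anodyne_rlp fun K L j hj => ⟨fun {u b} sq => ?_⟩
  have := hasLift_of_anodyne hj (Limits.terminal.from A)
  have sqA : CommSq (u ≫ Limits.pullback.fst _ _) j (Limits.terminal.from A)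
    (Limits.terminal.from _) := ⟨Limits.terminal.hom_ext _ _⟩
  obtain ⟨H, hjH, hH, -⟩ := exists_path_extension hj (Limits.terminal.from B)
    (u ≫ Limits.pullback.snd _ _) (Limits.terminal.from _ ≫ constPath _) ![sqA.lift ≫ w, b]
    (fun i => by
      fin_cases i
      · change (u ≫ Limits.pullback.snd _ _) ≫ pathEv B 0 = j ≫ sqA.lift ≫ w
        rw [Category.assoc, ← Limits.pullback.condition, sqA.fac_left_assoc, Category.assoc]
      · exact (Category.assoc _ _ _).trans sq.w)
    (path_terminal_hom_ext _ _) (fun _ => Limits.terminal.hom_ext _ _)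
  have start_eq : H ≫ pathEv B 0 = sqA.lift ≫ w := hH 0
  have end_eq : H ≫ pathEv B 1 = b := hH 1
  exact ⟨⟨{
    l := Limits.pullback.lift sqA.lift H start_eq.symm
    fac_left := by
      apply Limits.pullback.hom_ext
      · rw [Category.assoc, Limits.pullback.lift_fst, sqA.fac_left]
      · rw [Category.assoc, Limits.pullback.lift_snd, hjH]
    fac_right := by rw [Limits.pullback.lift_snd_assoc, end_eq] }⟩⟩

/-- The map to the mapping path space given by the constant paths. -/
def toMappingPathSpace : A ⟶ mappingPathSpace w :=
  Limits.pullback.lift (𝟙 A) (w ≫ constPath B) (by simp)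

lemma toMappingPathSpace_mappingPathEnd : toMappingPathSpace w ≫ mappingPathEnd w = w := by
  rw [toMappingPathSpace, Limits.pullback.lift_snd_assoc, Category.assoc, constPath_pathEv,
    Category.comp_id]

lemma sWeq_toMappingPathSpace [KanComplex B] : sWeq (toMappingPathSpace w) := by
  apply sWeq.of_postcomp _ (Limits.pullback.fst w (pathEv B 0))
    (sTrivFib_mappingPathSpace_fst w).sWeq
  rw [toMappingPathSpace, Limits.pullback.lift_fst]
  exact sWeq_of_isIso (𝟙 A)

lemma sWeq_mappingPathEnd_iff [KanComplex B] : sWeq (mappingPathEnd w) ↔ sWeq w := by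
  rw [← sWeq.precomp_iff (toMappingPathSpace w) _ (sWeq_toMappingPathSpace w),
    toMappingPathSpace_mappingPathEnd]

variable {w}

lemma sWeq.sTrivFib_mappingPathEnd [KanComplex A] [KanComplex B] (hw : sWeq w) :
    sTrivFib (mappingPathEnd w) :=
  sTrivFib_of_fibration_of_sWeq _ ((sWeq_mappingPathEnd_iff w).2 hw)

lemma sTrivFib_mappingPathEnd_of_isPullback {A' B' : SSet.{v}} {a : A' ⟶ A} {w' : A' ⟶ B'}
    {c : B' ⟶ B} [Fibration c] (sq : IsPullback a w' w c) (hw : sTrivFib (mappingPathEnd w)) :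
    sTrivFib (mappingPathEnd w') := by
  intro K L k (hk : Mono k)
  refine ⟨fun {u d} s => ?_⟩
  have := hw k hk
  let baseMap : mappingPathSpace w' ⟶ mappingPathSpace w :=
    Limits.pullback.map w' (pathEv B' 0) w (pathEv B 0) a ((ihom Δ[1]).map c) c sq.w.symm
      (ihom_map_pathEv 0 c).symm
  have sqBase : CommSq (u ≫ baseMap) k (mappingPathEnd w) (d ≫ c) := ⟨by
    rw [← reassoc_of% s.w, Category.assoc, Limits.pullback.lift_snd_assoc, comp_map_pathEv,
      Category.assoc]⟩
  obtain ⟨m, hkm, hmd⟩ : ∃ m, k ≫ m = u ≫ baseMap ∧ m ≫ mappingPathEnd w = d ≫ c :=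
    ⟨sqBase.lift, sqBase.fac_left, sqBase.fac_right⟩
  obtain ⟨H, hkH, hH₁, hHc⟩ := exists_pathLift 1 k c (u ≫ Limits.pullback.snd _ _)
    (m ≫ Limits.pullback.snd _ _) d (by rw [← s.w, Category.assoc])
    (by rw [reassoc_of% hkm, Limits.pullback.lift_snd, Category.assoc])
    (by rw [← hmd, Category.assoc])
  have start_eq : (m ≫ Limits.pullback.fst _ _) ≫ w = (H ≫ pathEv B' 0) ≫ c := by
    rw [Category.assoc, Limits.pullback.condition, ← comp_map_pathEv, hHc, Category.assoc]
  refine ⟨⟨{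
    l := Limits.pullback.lift (sq.lift _ _ start_eq) H (by simp)
    fac_left := ?_
    fac_right := by rw [Limits.pullback.lift_snd_assoc, hH₁] }⟩⟩
  apply Limits.pullback.hom_ext
  · rw [Category.assoc, Limits.pullback.lift_fst]
    apply sq.hom_ext
    · rw [Category.assoc, sq.lift_fst, reassoc_of% hkm, Limits.pullback.lift_fst, Category.assoc]
    · rw [Category.assoc, sq.lift_snd, reassoc_of% hkH, Category.assoc, Limits.pullback.condition]
  · rw [Category.assoc, Limits.pullback.lift_snd, hkH]

lemma sWeq_of_isPullback {A' B' : SSet.{v}} [KanComplex A] [KanComplex B] [KanComplex B']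
    {a : A' ⟶ A} {w' : A' ⟶ B'} {c : B' ⟶ B} [Fibration c] (sq : IsPullback a w' w c)
    (hw : sWeq w) : sWeq w' :=
  (sWeq_mappingPathEnd_iff w').1
    (sTrivFib_mappingPathEnd_of_isPullback sq hw.sTrivFib_mappingPathEnd).sWeq

end MappingPathSpaces

section Simplices

open SSet Simplicial

variable {J X Y : SSet.{v}} {q r : SimplexCategoryᵒᵖ}

/-- The value at a pair `(a, j)` of a `q`-simplex of the internal hom, which is a map from the
product of the `q`-simplex with `J`. -/
def ihomEval (x : ((ihom J).obj X).obj q) {c : SimplexCategoryᵒᵖ} (a : q ⟶ c) (j : J.obj c) :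
    X.obj c :=
  Functor.HomObj.app (F := J) (G := X) x c a j

lemma ihomEval_natural (x : ((ihom J).obj X).obj q) {c d : SimplexCategoryᵒᵖ} (a : q ⟶ c)
    (f : c ⟶ d) (j : J.obj c) : ihomEval x (a ≫ f) (J.map f j) = X.map f (ihomEval x a j) :=
  ConcreteCategory.congr_hom (Functor.HomObj.naturality (F := J) (G := X) x f a) j

lemma ihomEval_map (x : ((ihom J).obj X).obj q) (b : q ⟶ r) {c : SimplexCategoryᵒᵖ} (a : r ⟶ c)
    (j : J.obj c) : ihomEval (((ihom J).obj X).map b x) a j = ihomEval x (b ≫ a) j := rfl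

lemma ihom_ext {x y : ((ihom J).obj X).obj q}
    (h : ∀ (c : SimplexCategoryᵒᵖ) (a : q ⟶ c) (j : J.obj c), ihomEval x a j = ihomEval y a j) :
    x = y := by
  apply Functor.HomObj.ext
  funext c a
  ext j
  exact h c a j

/-- The simplex of an internal hom with prescribed values. -/
def ihomMk (φ : ∀ (c : SimplexCategoryᵒᵖ) (_ : q ⟶ c) (_ : J.obj c), X.obj c)
    (h : ∀ {c d : SimplexCategoryᵒᵖ} (a : q ⟶ c) (f : c ⟶ d) (j : J.obj c),
      φ d (a ≫ f) (J.map f j) = X.map f (φ c a j)) : ((ihom J).obj X).obj q :=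
  Functor.HomObj.mk (F := J) (G := X) (fun c a => ↾(φ c a)) (fun f a => by ext j; exact h a f j)

lemma uncurry_app (f : Y ⟶ (ihom J).obj X) (j : J.obj q) (y : Y.obj q) :
    (MonoidalClosed.uncurry f).app q (j, y) = ihomEval (f.app q y) (𝟙 q) j := rfl

lemma ihomEval_app (f : Y ⟶ (ihom J).obj X) (y : Y.obj q) {c : SimplexCategoryᵒᵖ} (a : q ⟶ c)
    (j : J.obj c) :
    ihomEval (f.app q y) a j = (MonoidalClosed.uncurry f).app c (j, Y.map a y) := by
  rw [uncurry_app, app_map, ihomEval_map, Category.comp_id]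

lemma ihomEval_pre {J' : SSet.{v}} (k : J' ⟶ J) (x : ((ihom J).obj X).obj q)
    {c : SimplexCategoryᵒᵖ} (a : q ⟶ c) (j : J'.obj c) :
    ihomEval (((MonoidalClosed.pre k).app X).app q x) a j = ihomEval x a (k.app c j) := by
  rw [ihomEval_app, MonoidalClosed.uncurry_pre]
  change ihomEval (((ihom J).obj X).map a x) (𝟙 c) (k.app c j) = _
  rw [ihomEval_map, Category.comp_id]

end Simplices

section OperadMappingSpaces

variable {O P Q R : SimplicialOperad.{v}} {S : SSet.{v}} {q r : SimplexCategoryᵒᵖ}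

/-- The value of a `q`-simplex of a mapping space of simplicial operads at the identity of
`q`. -/
def sHomEval (x : (sHom O P).obj q) : O.obj q ⟶ P.obj q :=
  Functor.HomObj.app (F := O) (G := P) x q (𝟙 q)

lemma sHomEval_natural (x : (sHom O P).obj q) (f : q ⟶ r) :
    O.map f ≫ sHomEval ((sHom O P).map f x) = sHomEval x ≫ P.map f := by
  rw [← show _ = sHomEval x ≫ P.map f from
    Functor.HomObj.naturality (F := O) (G := P) x f (𝟙 q)]
  congr 1

/-- The map to a mapping space of simplicial operads with prescribed values. -/
def sHomLift (φ : ∀ c : SimplexCategoryᵒᵖ, S.obj c → (O.obj c ⟶ P.obj c))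
    (h : ∀ (c d : SimplexCategoryᵒᵖ) (f : c ⟶ d) (s : S.obj c),
      O.map f ≫ φ d (S.map f s) = φ c s ≫ P.map f) : S ⟶ sHom O P :=
  (Functor.functorHomEquiv (F := O) (G := P) S).symm ⟨φ, fun f s => h _ _ f s⟩

lemma sHomEval_sHomLift (φ : ∀ c : SimplexCategoryᵒᵖ, S.obj c → (O.obj c ⟶ P.obj c))
    (h : ∀ (c d : SimplexCategoryᵒᵖ) (f : c ⟶ d) (s : S.obj c),
      O.map f ≫ φ d (S.map f s) = φ c s ≫ P.map f) (s : S.obj q) :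
    sHomEval ((sHomLift φ h).app q s) = φ q s := by
  change φ q (S.map (𝟙 q) s) = φ q s
  rw [S.map_id]
  rfl

lemma sHom_hom_ext {f g : S ⟶ sHom O P}
    (h : ∀ (c : SimplexCategoryᵒᵖ) (s : S.obj c), sHomEval (f.app c s) = sHomEval (g.app c s)) :
    f = g := by
  apply (Functor.functorHomEquiv (F := O) (G := P) S).injective
  apply Functor.HomObj.ext
  funext c s
  exact h c s

lemma operadMapPost_comp (f : P ⟶ Q) (g : Q ⟶ R) :
    operadMapPost O (f ≫ g) = operadMapPost O f ≫ operadMapPost O g := by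
  refine sHom_hom_ext fun c s => ?_
  change sHomEval s ≫ f.app c ≫ g.app c = (sHomEval s ≫ f.app c) ≫ g.app c
  rw [Category.assoc]

end OperadMappingSpaces

section OperadPullbacks

/-- The pullback of operads, which is formed in each arity. -/
def pullbackOperad {P Q R : Operad.{v}} (f : P ⟶ R) (g : Q ⟶ R) : Operad.{v} where
  P n := { p : P.P n × Q.P n // f.app n p.1 = g.app n p.2 }
  act σ p := ⟨(P.act σ p.1.1, Q.act σ p.1.2), by rw [f.act, g.act, p.2]⟩
  one := ⟨(P.one, Q.one), by rw [f.one, g.one]⟩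
  comp e p r := ⟨(P.comp e p.1.1 fun i => (r i).1.1, Q.comp e p.1.2 fun i => (r i).1.2), by
    simp only [f.comp, g.comp, p.2, (r _).2]⟩
  one_act p := Subtype.ext (Prod.ext (P.one_act _) (Q.one_act _))
  mul_act σ τ p := Subtype.ext (Prod.ext (P.mul_act _ _ _) (Q.mul_act _ _ _))
  act_comp σ e p r := Subtype.ext (Prod.ext (P.act_comp σ e _ _) (Q.act_comp σ e _ _))
  comp_act e σ e' h p r :=
    Subtype.ext (Prod.ext (P.comp_act e σ e' h _ _) (Q.comp_act e σ e' h _ _))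
  comp_act' e e' τ h p r :=
    Subtype.ext (Prod.ext (P.comp_act' e e' τ h _ _) (Q.comp_act' e e' τ h _ _))
  one_comp e h r := Subtype.ext (Prod.ext (P.one_comp e h _) (Q.one_comp e h _))
  comp_one e h p := Subtype.ext (Prod.ext (P.comp_one e h _) (Q.comp_one e h _))
  assoc e e₂ e₃ e₁ h p r s :=
    Subtype.ext (Prod.ext (P.assoc e e₂ e₃ e₁ h _ _ _) (Q.assoc e e₂ e₃ e₁ h _ _ _))

variable {P Q R : Operad.{v}} (f : P ⟶ R) (g : Q ⟶ R)

/-- The first projection of the pullback of operads. -/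
def pullbackOperadFst : pullbackOperad f g ⟶ P where
  app _ p := p.1.1
  act _ _ := rfl
  one := rfl
  comp _ _ _ := rfl

/-- The second projection of the pullback of operads. -/
def pullbackOperadSnd : pullbackOperad f g ⟶ Q where
  app _ p := p.1.2
  act _ _ := rfl
  one := rfl
  comp _ _ _ := rfl

lemma isPullback_pullbackOperad :
    IsPullback (pullbackOperadFst f g) (pullbackOperadSnd f g) f g where
  w := Operad.hom_ext fun _ p => p.2
  isLimit' := ⟨Limits.PullbackCone.IsLimit.mk _
    (fun s =>
      { app := fun n p => ⟨(s.fst.app n p, s.snd.app n p),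
          congrArg (fun t : s.pt ⟶ R => t.app n p) s.condition⟩
        act := fun σ p => Subtype.ext (Prod.ext (s.fst.act σ p) (s.snd.act σ p))
        one := Subtype.ext (Prod.ext s.fst.one s.snd.one)
        comp := fun e p r => Subtype.ext (Prod.ext (s.fst.comp e p r) (s.snd.comp e p r)) })
    (fun _ => rfl) (fun _ => rfl)
    fun s _ h₁ h₂ => Operad.hom_ext fun n p => Subtype.ext (Prod.ext
      (congrArg (fun t : s.pt ⟶ P => t.app n p) h₁)
      (congrArg (fun t : s.pt ⟶ Q => t.app n p) h₂))⟩

instance hasPullbacks_operad : Limits.HasPullbacks Operad.{v} :=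
  have {P Q R : Operad.{v}} (f : P ⟶ R) (g : Q ⟶ R) : Limits.HasPullback f g :=
    (isPullback_pullbackOperad f g).hasPullback
  Limits.hasPullbacks_of_hasLimit_cospan _

lemma isPullback_arity_pullbackOperad (n : ℕ) :
    IsPullback ((Operad.arity n).map (pullbackOperadFst f g))
      ((Operad.arity n).map (pullbackOperadSnd f g))
      ((Operad.arity n).map f) ((Operad.arity n).map g) := by
  rw [Limits.Types.isPullback_iff]
  exact ⟨by rw [← Functor.map_comp, (isPullback_pullbackOperad f g).w, Functor.map_comp],
    fun x y h => Subtype.ext (Prod.ext h.1 h.2), fun p q h => ⟨⟨(p, q), h⟩, rfl, rfl⟩⟩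

instance preservesLimit_arity (n : ℕ) :
    Limits.PreservesLimit (Limits.cospan f g) (Operad.arity.{v} n) :=
  Limits.preservesLimit_of_preserves_limit_cone (isPullback_pullbackOperad f g).isLimit
    ((Limits.isLimitMapConePullbackConeEquiv _ (isPullback_pullbackOperad f g).w).symm
      (isPullback_arity_pullbackOperad f g n).isLimit)

lemma isPullback_level {P P₁ P₂ R : SimplicialOperad.{v}} {p₁ : P ⟶ P₁} {p₂ : P ⟶ P₂}
    {f₁ : P₁ ⟶ R} {f₂ : P₂ ⟶ R} (sq : IsPullback p₁ p₂ f₁ f₂) (n : ℕ) :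
    IsPullback ((SimplicialOperad.level n).map p₁) ((SimplicialOperad.level n).map p₂)
      ((SimplicialOperad.level n).map f₁) ((SimplicialOperad.level n).map f₂) :=
  .of_forall_isPullback_app fun q =>
    (sq.map ((CategoryTheory.evaluation _ _).obj q)).map (Operad.arity n)

lemma isPullback_operadMapPost {O P P₁ P₂ R : SimplicialOperad.{v}} {p₁ : P ⟶ P₁} {p₂ : P ⟶ P₂}
    {f₁ : P₁ ⟶ R} {f₂ : P₂ ⟶ R} (sq : IsPullback p₁ p₂ f₁ f₂) :
    IsPullback (operadMapPost O p₁) (operadMapPost O p₂) (operadMapPost O f₁)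
      (operadMapPost O f₂) := by
  have sqAt (q : SimplexCategoryᵒᵖ) : IsPullback (p₁.app q) (p₂.app q) (f₁.app q) (f₂.app q) :=
    sq.map ((CategoryTheory.evaluation _ _).obj q)
  have compatible (s : Limits.PullbackCone (operadMapPost O f₁) (operadMapPost O f₂))
      (c : SimplexCategoryᵒᵖ) (x : s.pt.obj c) :
      sHomEval (s.fst.app c x) ≫ f₁.app c = sHomEval (s.snd.app c x) ≫ f₂.app c :=
    congrArg sHomEval (app_congr s.condition c x)
  refine ⟨⟨by rw [← operadMapPost_comp, sq.w, operadMapPost_comp]⟩,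
    ⟨Limits.PullbackCone.IsLimit.mk _
      (fun s => sHomLift (fun c x => (sqAt c).lift _ _ (compatible s c x)) fun c d a x => ?_)
      (fun s => sHom_hom_ext fun c x => ?_) (fun s => sHom_hom_ext fun c x => ?_)
      fun s m h₁ h₂ => sHom_hom_ext fun c x => ?_⟩⟩
  · apply (sqAt d).hom_ext
    · rw [Category.assoc, IsPullback.lift_fst, Category.assoc, p₁.naturality,
        IsPullback.lift_fst_assoc, ← sHomEval_natural, ← app_map]
    · rw [Category.assoc, IsPullback.lift_snd, Category.assoc, p₂.naturality,
        IsPullback.lift_snd_assoc, ← sHomEval_natural, ← app_map]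
  · change sHomEval ((sHomLift _ _).app c x) ≫ p₁.app c = _
    rw [sHomEval_sHomLift, IsPullback.lift_fst]
  · change sHomEval ((sHomLift _ _).app c x) ≫ p₂.app c = _
    rw [sHomEval_sHomLift, IsPullback.lift_snd]
  · rw [sHomEval_sHomLift]
    apply (sqAt c).hom_ext
    · rw [IsPullback.lift_fst, ← h₁]
      rfl
    · rw [IsPullback.lift_snd, ← h₂]
      rfl

end OperadPullbacks

section OperadPowers

open SSet SSet.modelCategoryQuillen Simplicial CartesianMonoidalCategory

variable {J K : SSet.{v}} {O P Q : SimplicialOperad.{v}} {q r : SimplexCategoryᵒᵖ}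

variable (J Q q) in
/-- The operad of `q`-simplices of the cotensor of a simplicial operad with a simplicial set. -/
def operadPowerAt : Operad.{v} where
  P n := ((ihom J).obj ((SimplicialOperad.level n).obj Q)).obj q
  act {n} σ p := ihomMk (X := (SimplicialOperad.level n).obj Q)
    (fun c a j => (Q.obj c).act σ (ihomEval p a j)) fun a f j => by
      rw [ihomEval_natural]
      exact ((Q.map f).act σ (ihomEval p a j)).symm
  one := ihomMk (X := (SimplicialOperad.level 1).obj Q) (fun c _ _ => (Q.obj c).one)
    fun _ f _ => (Q.map f).one.symm
  comp {m n k} e p g := ihomMk (X := (SimplicialOperad.level m).obj Q)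
    (fun c a j => (Q.obj c).comp e (ihomEval p a j) fun i => ihomEval (g i) a j) fun a f j => by
      simp only [ihomEval_natural]
      exact ((Q.map f).comp e (ihomEval p a j) fun i => ihomEval (g i) a j).symm
  one_act p := ihom_ext fun c a j => (Q.obj c).one_act _
  mul_act σ τ p := ihom_ext fun c a j => (Q.obj c).mul_act σ τ _
  act_comp σ e p g := ihom_ext fun c a j => (Q.obj c).act_comp σ e _ _
  comp_act e σ e' h p g := ihom_ext fun c a j => (Q.obj c).comp_act e σ e' h _ _
  comp_act' e e' τ h p g := ihom_ext fun c a j => (Q.obj c).comp_act' e e' τ h _ _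
  one_comp e h g := ihom_ext fun c a j => (Q.obj c).one_comp e h _
  comp_one e h p := ihom_ext fun c a j => (Q.obj c).comp_one e h _
  assoc e e₂ e₃ e₁ h p g r := ihom_ext fun c a j => (Q.obj c).assoc e e₂ e₃ e₁ h _ _ _

variable (J Q) in
/-- The cotensor of a simplicial operad with a simplicial set, formed in each arity. -/
def operadPower : SimplicialOperad.{v} where
  obj := operadPowerAt J Q
  map b :=
    { app := fun n p => ((ihom J).obj ((SimplicialOperad.level n).obj Q)).map b p
      act := fun _ _ => rfl
      one := rfl
      comp := fun _ _ _ => rfl }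
  map_id q := by
    ext n p
    exact ConcreteCategory.congr_hom
      (((ihom J).obj ((SimplicialOperad.level n).obj Q)).map_id q) p
  map_comp a b := by
    ext n p
    exact ConcreteCategory.congr_hom
      (((ihom J).obj ((SimplicialOperad.level n).obj Q)).map_comp a b) p

variable (Q) in
/-- The evaluation of a cotensor of operads at a simplex `(a, j)` of `Δ[q] × J`. -/
def operadPowerEval {c : SimplexCategoryᵒᵖ} (a : q ⟶ c) (j : J.obj c) :
    (operadPower J Q).obj q ⟶ Q.obj c where
  app n x := ihomEval (X := (SimplicialOperad.level n).obj Q) x a j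
  act _ _ := rfl
  one := rfl
  comp _ _ _ := rfl

lemma operadPower_map_comp_eval (b : q ⟶ r) {c : SimplexCategoryᵒᵖ} (a : r ⟶ c) (j : J.obj c) :
    (operadPower J Q).map b ≫ operadPowerEval Q a j = operadPowerEval Q (b ≫ a) j := rfl

lemma operadPowerEval_natural {c d : SimplexCategoryᵒᵖ} (a : q ⟶ c) (f : c ⟶ d) (j : J.obj c) :
    operadPowerEval Q (a ≫ f) (J.map f j) = operadPowerEval Q a j ≫ Q.map f := by
  ext n x
  exact ihomEval_natural (X := (SimplicialOperad.level n).obj Q) x a f j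

lemma operadPower_hom_ext {E : Operad.{v}} {f g : E ⟶ (operadPower J Q).obj q}
    (h : ∀ (c : SimplexCategoryᵒᵖ) (a : q ⟶ c) (j : J.obj c),
      f ≫ operadPowerEval Q a j = g ≫ operadPowerEval Q a j) : f = g := by
  ext n x
  exact ihom_ext fun c a j => congrArg (fun t : E ⟶ Q.obj c => t.app n x) (h c a j)

/-- The map to a cotensor of operads with prescribed values. -/
def operadPowerLift {E : Operad.{v}}
    (φ : ∀ (c : SimplexCategoryᵒᵖ) (_ : q ⟶ c) (_ : J.obj c), E ⟶ Q.obj c)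
    (h : ∀ {c d : SimplexCategoryᵒᵖ} (a : q ⟶ c) (f : c ⟶ d) (j : J.obj c),
      φ d (a ≫ f) (J.map f j) = φ c a j ≫ Q.map f) : E ⟶ (operadPower J Q).obj q where
  app n x := ihomMk (X := (SimplicialOperad.level n).obj Q) (fun c a j => (φ c a j).app n x)
    fun a f j => congrArg (fun t : E ⟶ Q.obj _ => t.app n x) (h a f j)
  act σ x := ihom_ext fun c a j => (φ c a j).act σ x
  one := ihom_ext fun c a j => (φ c a j).one
  comp e x y := ihom_ext fun c a j => (φ c a j).comp e x y

lemma operadPowerLift_eval {E : Operad.{v}}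
    (φ : ∀ (c : SimplexCategoryᵒᵖ) (_ : q ⟶ c) (_ : J.obj c), E ⟶ Q.obj c)
    (h : ∀ {c d : SimplexCategoryᵒᵖ} (a : q ⟶ c) (f : c ⟶ d) (j : J.obj c),
      φ d (a ≫ f) (J.map f j) = φ c a j ≫ Q.map f) {c : SimplexCategoryᵒᵖ} (a : q ⟶ c)
    (j : J.obj c) : operadPowerLift φ h ≫ operadPowerEval Q a j = φ c a j := rfl

variable (J) in
/-- The functoriality of cotensors in the operad. -/
def operadPowerMap (f : P ⟶ Q) : operadPower J P ⟶ operadPower J Q where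
  app q := operadPowerLift (fun c a j => operadPowerEval P a j ≫ f.app c) fun a g j => by
    rw [operadPowerEval_natural, Category.assoc, f.naturality, Category.assoc]

variable (Q) in
/-- The functoriality of cotensors in the simplicial set. -/
def operadPowerPre (k : K ⟶ J) : operadPower J Q ⟶ operadPower K Q where
  app q := operadPowerLift (fun c a j => operadPowerEval Q a (k.app c j)) fun a g j => by
    rw [app_map, operadPowerEval_natural]

variable (Q) in
/-- The evaluation of paths in a simplicial operad at the end points `i = 0, 1`. -/
def operadPathEv (i : Fin 2) : operadPower Δ[1] Q ⟶ Q where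
  app q := operadPowerEval Q (𝟙 q) ((intervalVertex i).app q PUnit.unit)
  naturality q r a := by
    rw [operadPower_map_comp_eval, ← operadPowerEval_natural, ← app_map, Category.comp_id,
      Category.id_comp]
    rfl

lemma level_map_operadPowerMap (f : P ⟶ Q) (n : ℕ) :
    (SimplicialOperad.level n).map (operadPowerMap J f) =
      (ihom J).map ((SimplicialOperad.level n).map f) := rfl

lemma level_map_operadPowerPre (k : K ⟶ J) (n : ℕ) :
    (SimplicialOperad.level n).map (operadPowerPre Q k) =
      (MonoidalClosed.pre k).app ((SimplicialOperad.level n).obj Q) := by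
  ext q x
  exact ihom_ext fun c a j =>
    (ihomEval_pre (X := (SimplicialOperad.level n).obj Q) k x a j).symm

lemma level_map_operadPathEv (i : Fin 2) (n : ℕ) :
    (SimplicialOperad.level n).map (operadPathEv Q i) =
      pathEv ((SimplicialOperad.level n).obj Q) i := rfl

lemma operadPowerPre_naturality (k : K ⟶ J) (f : P ⟶ Q) :
    operadPowerPre P k ≫ operadPowerMap K f = operadPowerMap J f ≫ operadPowerPre Q k := rfl

variable (O Q J) in
/-- Maps to the mapping space from `O` to `Q` are the maps from `O` to cotensors of `Q`. -/
def sHomEquivPower : (J ⟶ sHom O Q) ≃ (O ⟶ operadPower J Q) where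
  toFun u :=
    { app := fun q => operadPowerLift (fun c a j => O.map a ≫ sHomEval (u.app c j))
        fun a f j => by
          rw [app_map, O.map_comp, Category.assoc, sHomEval_natural, Category.assoc]
      naturality := fun q r b => operadPower_hom_ext fun c a j => by
        rw [Category.assoc, operadPowerLift_eval, Category.assoc, operadPower_map_comp_eval,
          operadPowerLift_eval, O.map_comp, Category.assoc] }
  invFun w := sHomLift (fun c j => w.app c ≫ operadPowerEval Q (𝟙 c) j) fun c d f j => by
    rw [← Category.assoc, w.naturality, Category.assoc, Category.assoc, operadPower_map_comp_eval,
      ← operadPowerEval_natural, Category.comp_id, Category.id_comp]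
  left_inv u := sHom_hom_ext fun c j => by
    rw [sHomEval_sHomLift, operadPowerLift_eval, O.map_id, Category.id_comp]
  right_inv w := NatTrans.ext <| funext fun q => operadPower_hom_ext fun c a j => by
    rw [operadPowerLift_eval, sHomEval_sHomLift, ← Category.assoc, w.naturality, Category.assoc,
      operadPower_map_comp_eval, Category.comp_id]

lemma sHomEquivPower_comp (k : K ⟶ J) (u : J ⟶ sHom O Q) :
    sHomEquivPower K O Q (k ≫ u) = sHomEquivPower J O Q u ≫ operadPowerPre Q k := rfl

lemma sHomEquivPower_operadMapPost (u : J ⟶ sHom O P) (f : P ⟶ Q) :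
    sHomEquivPower J O Q (u ≫ operadMapPost O f) =
      sHomEquivPower J O P u ≫ operadPowerMap J f := rfl

variable (O Q J) in
/-- The comparison map from a cotensor of a mapping space to the mapping space to a cotensor. -/
def powerToSHom : (ihom J).obj (sHom O Q) ⟶ sHom O (operadPower J Q) :=
  sHomLift
    (fun q x => operadPowerLift (fun c a j => O.map a ≫ sHomEval (ihomEval x a j))
      fun a f j => by
        rw [ihomEval_natural, O.map_comp, Category.assoc, sHomEval_natural, Category.assoc])
    fun q r b x => operadPower_hom_ext fun c a j => by
      rw [Category.assoc, operadPowerLift_eval, Category.assoc, operadPower_map_comp_eval,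
        operadPowerLift_eval, ihomEval_map, O.map_comp, Category.assoc]

lemma sHomEval_powerToSHom (x : ((ihom J).obj (sHom O Q)).obj q) {c : SimplexCategoryᵒᵖ}
    (a : q ⟶ c) (j : J.obj c) :
    sHomEval ((powerToSHom J O Q).app q x) ≫ operadPowerEval Q a j =
      O.map a ≫ sHomEval (ihomEval x a j) := by
  rw [powerToSHom, sHomEval_sHomLift]
  rfl

variable (O Q J) in
/-- The inverse of the comparison map `powerToSHom`. -/
def sHomToPower : sHom O (operadPower J Q) ⟶ (ihom J).obj (sHom O Q) :=
  MonoidalClosed.curry <| sHomLift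
    (fun q x => sHomEval x.2 ≫ operadPowerEval Q (𝟙 q) x.1) fun q r f x => by
      change O.map f ≫ sHomEval ((sHom O (operadPower J Q)).map f x.2) ≫
        operadPowerEval Q (𝟙 r) (J.map f x.1) = _
      rw [reassoc_of% (sHomEval_natural x.2 f), operadPower_map_comp_eval, Category.assoc,
        ← operadPowerEval_natural, Category.comp_id, Category.id_comp]

lemma sHomEval_sHomToPower (x : (sHom O (operadPower J Q)).obj q) {c : SimplexCategoryᵒᵖ}
    (a : q ⟶ c) (j : J.obj c) :
    O.map a ≫ sHomEval (ihomEval ((sHomToPower J O Q).app q x) a j) =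
      sHomEval x ≫ operadPowerEval Q a j := by
  have value_eq : sHomEval (ihomEval ((sHomToPower J O Q).app q x) a j) =
      sHomEval ((sHom O (operadPower J Q)).map a x) ≫ operadPowerEval Q (𝟙 c) j := by
    rw [ihomEval_app, sHomToPower, MonoidalClosed.uncurry_curry]
    exact sHomEval_sHomLift (S := J ⊗ sHom O (operadPower J Q)) _ _ (j, _)
  rw [value_eq, reassoc_of% (sHomEval_natural x a), operadPower_map_comp_eval, Category.comp_id]

variable (O Q J) in
/-- Mapping spaces out of `O` preserve cotensors. -/
def sHomPowerIso : (ihom J).obj (sHom O Q) ≅ sHom O (operadPower J Q) where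
  hom := powerToSHom J O Q
  inv := sHomToPower J O Q
  hom_inv_id := by
    apply MonoidalClosed.uncurry_injective
    refine sHom_hom_ext fun q ⟨j, x⟩ => ?_
    rw [uncurry_app, uncurry_app]
    have h := sHomEval_sHomToPower ((powerToSHom J O Q).app q x) (𝟙 q) j
    rw [sHomEval_powerToSHom, O.map_id, Category.id_comp, Category.id_comp] at h
    exact h
  inv_hom_id := sHom_hom_ext fun q x => operadPower_hom_ext fun c a j =>
    (sHomEval_powerToSHom ((sHomToPower J O Q).app q x) a j).trans (sHomEval_sHomToPower x a j)

lemma sHomPowerIso_hom_operadMapPost (i : Fin 2) :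
    (sHomPowerIso Δ[1] O Q).hom ≫ operadMapPost O (operadPathEv Q i) = pathEv _ i :=
  sHom_hom_ext fun q x =>
    (sHomEval_powerToSHom x (𝟙 q) ((intervalVertex i).app q PUnit.unit)).trans <| by
      rw [O.map_id, Category.id_comp]
      rfl

end OperadPowers

section CofibrantOperads

open SSet SSet.modelCategoryQuillen Simplicial CartesianMonoidalCategory

lemma sTrivFib.pullbackObjObjπ {X₁ Y₁ E B : SSet.{v}} {i : X₁ ⟶ Y₁} {p : E ⟶ B} [Mono i]
    (hp : sTrivFib p) (sq₁₃ : MonoidalClosed.internalHom.PullbackObjObj i p) :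
    sTrivFib sq₁₃.π := by
  rw [sTrivFib, rlp_monomorphisms]
  rintro _ _ _ ⟨n⟩
  let sq₁₂ := Functor.PushoutObjObj.ofHasPushout (curriedTensor SSet.{v}) i ∂Δ[n].ι
  rw [← MonoidalClosed.internalHomAdjunction₂.hasLiftingProperty_iff sq₁₂]
  rw [HasLiftingProperty.iff_of_arrow_iso_left
    (show Arrow.mk sq₁₂.ι ≅ Arrow.mk sq₁₂.flipTensor.ι from
      Arrow.isoMk (Iso.refl _) (β_ _ _))]
  let sq₁₃' := Functor.PullbackObjObj.ofHasPullback MonoidalClosed.internalHom ∂Δ[n].ι p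
  rw [MonoidalClosed.internalHomAdjunction₂.hasLiftingProperty_iff _ sq₁₃']
  suffices sTrivFib sq₁₃'.π from this _ ‹Mono i›
  rw [sTrivFib, rlp_monomorphisms]
  rintro _ _ _ ⟨m⟩
  rw [← MonoidalClosed.internalHomAdjunction₂.hasLiftingProperty_iff
    (Subcomplex.unionProd.pushoutObjObj.{v} _ _), Subcomplex.unionProd.pushoutObjObj_ι]
  exact hp _ (inferInstanceAs (Mono (Subcomplex.ι _)))

/-- Trivial fibrations of simplicial operads, which are defined levelwise. -/
def operadTrivFib : MorphismProperty SimplicialOperad.{v} := fun _ _ f =>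
  ∀ n, sTrivFib ((SimplicialOperad.level n).map f)

variable {O P Q : SimplicialOperad.{v}} {J K : SSet.{v}}

lemma IsCofibrantOperad.exists_lift (hO : IsCofibrantOperad O) {f : P ⟶ Q} (hf : operadTrivFib f)
    (g : O ⟶ Q) : ∃ h : O ⟶ P, h ≫ f = g :=
  hO f (fun n => (hf n).fibration) (fun n => (hf n).sWeq) g

/-- The comparison map from the cotensor of the source of `f` to the pullback of cotensors. -/
def operadPullbackPower (k : K ⟶ J) (f : P ⟶ Q) :
    operadPower J P ⟶ Limits.pullback (operadPowerMap K f) (operadPowerPre Q k) :=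
  Limits.pullback.lift (operadPowerPre P k) (operadPowerMap J f) (operadPowerPre_naturality k f)

lemma operadTrivFib_operadPullbackPower (k : K ⟶ J) [Mono k] {f : P ⟶ Q} (hf : operadTrivFib f) :
    operadTrivFib (operadPullbackPower k f) := by
  intro n
  exact (hf n).pullbackObjObjπ (i := k)
    { pt := _
      fst := (SimplicialOperad.level n).map (Limits.pullback.fst _ _)
      snd := (SimplicialOperad.level n).map (Limits.pullback.snd _ _)
      isPullback := by
        have sq := isPullback_level (.of_hasPullback (operadPowerMap K f) (operadPowerPre Q k)) n
        rw [level_map_operadPowerMap, level_map_operadPowerPre] at sq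
        exact sq
      π := (SimplicialOperad.level n).map (operadPullbackPower k f)
      π_fst := ((SimplicialOperad.level n).map_comp _ _).symm.trans <| by
        rw [operadPullbackPower, Limits.pullback.lift_fst, level_map_operadPowerPre]
        rfl
      π_snd := ((SimplicialOperad.level n).map_comp _ _).symm.trans <| by
        rw [operadPullbackPower, Limits.pullback.lift_snd, level_map_operadPowerMap]
        rfl }

lemma sTrivFib_operadMapPost (hO : IsCofibrantOperad O) {f : P ⟶ Q} (hf : operadTrivFib f) :
    sTrivFib (operadMapPost O f) := by
  intro K J k (_ : Mono k)
  refine ⟨fun {a b} sq => ?_⟩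
  have transpose_sq : sHomEquivPower K O P a ≫ operadPowerMap K f =
      sHomEquivPower J O Q b ≫ operadPowerPre Q k := by
    rw [← sHomEquivPower_operadMapPost, ← sHomEquivPower_comp, sq.w]
  obtain ⟨w, hw⟩ := hO.exists_lift (operadTrivFib_operadPullbackPower k hf)
    (Limits.pullback.lift _ _ transpose_sq)
  refine ⟨⟨{ l := (sHomEquivPower J O P).symm w, fac_left := ?_, fac_right := ?_ }⟩⟩
  · apply (sHomEquivPower K O P).injective
    rw [sHomEquivPower_comp, Equiv.apply_symm_apply, ← Limits.pullback.lift_fst _ _ transpose_sq,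
      ← hw, Category.assoc, operadPullbackPower, Limits.pullback.lift_fst]
  · apply (sHomEquivPower J O Q).injective
    rw [sHomEquivPower_operadMapPost, Equiv.apply_symm_apply,
      ← Limits.pullback.lift_snd _ _ transpose_sq, ← hw, Category.assoc, operadPullbackPower,
      Limits.pullback.lift_snd]

/-- The end point map of the mapping path operad of `p`, whose operations are those of the source
of `p` together with a path starting at their image. -/
abbrev operadMappingPathEnd (p : P ⟶ Q) : Limits.pullback p (operadPathEv Q 0) ⟶ Q :=
  Limits.pullback.snd p (operadPathEv Q 0) ≫ operadPathEv Q 1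

lemma level_map_operadMappingPathEnd (p : P ⟶ Q) (n : ℕ) :
    ∃ e : (SimplicialOperad.level n).obj (Limits.pullback p (operadPathEv Q 0)) ≅
        mappingPathSpace ((SimplicialOperad.level n).map p),
      (SimplicialOperad.level n).map (operadMappingPathEnd p) =
        e.hom ≫ mappingPathEnd ((SimplicialOperad.level n).map p) := by
  have sq := isPullback_level (.of_hasPullback p (operadPathEv Q 0)) n
  rw [level_map_operadPathEv] at sq
  refine ⟨sq.isoPullback, ?_⟩
  rw [Functor.map_comp, level_map_operadPathEv]
  exact (congrArg (· ≫ pathEv _ 1) sq.isoPullback_hom_snd).symm.trans (Category.assoc _ _ _)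

lemma operadTrivFib_operadMappingPathEnd {p : P ⟶ Q} (hp : operadWeq p)
    (hP : ∀ n, KanComplex ((SimplicialOperad.level n).obj P))
    (hQ : ∀ n, KanComplex ((SimplicialOperad.level n).obj Q)) :
    operadTrivFib (operadMappingPathEnd p) := by
  intro n
  obtain ⟨e, he⟩ := level_map_operadMappingPathEnd p n
  rw [he]
  have := hP n
  have := hQ n
  exact (MorphismProperty.cancel_left_of_respectsIso _ _ _).2 (hp n).sTrivFib_mappingPathEnd

lemma mappingPathEnd_operadMapPost (p : P ⟶ Q) :
    ∃ e : mappingPathSpace (operadMapPost O p) ≅ sHom O (Limits.pullback p (operadPathEv Q 0)),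
      mappingPathEnd (operadMapPost O p) = e.hom ≫ operadMapPost O (operadMappingPathEnd p) := by
  have sq : IsPullback (operadMapPost O (Limits.pullback.fst p (operadPathEv Q 0)))
      (operadMapPost O (Limits.pullback.snd p (operadPathEv Q 0)) ≫ (sHomPowerIso Δ[1] O Q).inv)
      (operadMapPost O p) (pathEv _ 0) :=
    (isPullback_operadMapPost (.of_hasPullback p (operadPathEv Q 0))).of_iso (Iso.refl _)
      (Iso.refl _) (sHomPowerIso Δ[1] O Q).symm (Iso.refl _) (by simp) (by simp) (by simp)
      (by simp [← sHomPowerIso_hom_operadMapPost])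
  refine ⟨sq.isoPullback.symm, ?_⟩
  rw [Iso.symm_hom, Iso.eq_inv_comp, reassoc_of% sq.isoPullback_hom_snd,
    ← sHomPowerIso_hom_operadMapPost, Iso.inv_hom_id_assoc, operadMapPost_comp]

lemma contractible_of_sTrivFib {X : SSet.{v}} {p : X ⟶ 𝟙_ SSet.{v}} (hp : sTrivFib p) :
    Contractible X := by
  have : IsIso (Limits.terminal.from (𝟙_ SSet.{v})) :=
    Limits.isIso_of_isTerminal SemiCartesianMonoidalCategory.isTerminalTensorUnit
      Limits.terminalIsTerminal _
  have weq := sWeq.comp_mem p _ hp.sWeq (sWeq_of_isIso (Limits.terminal.from (𝟙_ SSet.{v})))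
  rwa [Limits.terminal.hom_ext (p ≫ _) (Limits.terminal.from X)] at weq

lemma contractible_homotopyFiber_operadMapPost (hO : IsCofibrantOperad O) {p : P ⟶ Q}
    (hp : operadWeq p) (hP : ∀ n, KanComplex ((SimplicialOperad.level n).obj P))
    (hQ : ∀ n, KanComplex ((SimplicialOperad.level n).obj Q)) (θ : O ⟶ Q) :
    Contractible (homotopyFiber (operadMapPost O p) (operadMapVertex θ)) := by
  have trivFib_end : sTrivFib (mappingPathEnd (operadMapPost O p)) := by
    obtain ⟨e, he⟩ := mappingPathEnd_operadMapPost (O := O) p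
    rw [he]
    exact (MorphismProperty.cancel_left_of_respectsIso _ _ _).2
      (sTrivFib_operadMapPost hO (operadTrivFib_operadMappingPathEnd hp hP hQ))
  exact contractible_of_sTrivFib (MorphismProperty.pullback_snd
    (mappingPathEnd (operadMapPost O p)) (operadMapVertex θ) trivFib_end)

end CofibrantOperads

section MappingSpaces

open SSet SSet.modelCategoryQuillen

variable {D : Type u} [Category.{v} D] [ModelCategory D] [SimplicialCategory D]
  [MonoidalCategory D] [SymmetricCategory D] [SymmetricMonoidalEnrichment D]
  [OperadicModelCategory D]

lemma fibration_eHomWhiskerLeft (A : D) [IsCofibrant A] {Y Z : D} (p : Y ⟶ Z) [Fibration p] :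
    Fibration (eHomWhiskerLeft SSet.{v} A p) := by
  obtain ⟨T, ⟨initial⟩, terminal_sHom⟩ := exists_initial (D := D)
  have : Cofibration (initial.to A) := (isCofibrant_iff_of_isInitial _ initial).1 inferInstance
  let sq : (sHomFunctor D).PullbackObjObj (initial.to A) p :=
    { pt := sHom A Z
      fst := (terminal_sHom Y).some.from _
      snd := 𝟙 _
      isPullback := by
        have : IsIso (((sHomFunctor D).obj (op T)).map p) :=
          Limits.isIso_of_isTerminal (terminal_sHom Y).some (terminal_sHom Z).some _
        apply +allowSynthFailures IsPullback.of_vert_isIso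
        · exact IsIso.id (sHom A Z)
        · exact ⟨(terminal_sHom Z).some.hom_ext _ _⟩
      π := eHomWhiskerLeft SSet.{v} A p
      π_fst := (terminal_sHom Y).some.hom_ext _ _
      π_snd := Category.comp_id _ }
  exact (OperadicModelCategory.sm7 (initial.to A) p sq).1

instance isCofibrant_tensor (A B : D) [IsCofibrant A] [IsCofibrant B] : IsCofibrant (A ⊗ B) := by
  obtain ⟨T, ⟨initial⟩, -⟩ := exists_initial (D := D)
  have : Cofibration (initial.to A) := (isCofibrant_iff_of_isInitial _ initial).1 inferInstance
  have : Cofibration (initial.to B) := (isCofibrant_iff_of_isInitial _ initial).1 inferInstance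
  have initial_tensor := (OperadicModelCategory.initial_tensor T B ⟨initial⟩).some
  have tensor_initial := (OperadicModelCategory.tensor_initial A T ⟨initial⟩).some
  have initial_tensor_initial := (OperadicModelCategory.tensor_initial T T ⟨initial⟩).some
  let sq : (curriedTensor D).PushoutObjObj (initial.to A) (initial.to B) :=
    { pt := T ⊗ B
      inl := tensor_initial.to _
      inr := 𝟙 _
      isPushout := by
        have : IsIso (((curriedTensor D).map (initial.to A)).app T) :=
          Limits.isIso_of_isInitial initial_tensor_initial tensor_initial _
        apply +allowSynthFailures IsPushout.of_horiz_isIso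
        · exact ⟨initial_tensor_initial.hom_ext _ _⟩
      ι := initial_tensor.to _
      inl_ι := tensor_initial.hom_ext _ _
      inr_ι := initial_tensor.hom_ext _ _ }
  rw [isCofibrant_iff_of_isInitial (initial_tensor.to (A ⊗ B)) initial_tensor]
  exact (OperadicModelCategory.pushoutProduct (initial.to A) (initial.to B) sq).1

instance isCofibrant_pw_succ (X : D) [IsCofibrant X] : ∀ n : ℕ, IsCofibrant (pw (n + 1) X)
  | 0 => (isCofibrant_of_cofibration (ρ_ X).inv : IsCofibrant (X ⊗ 𝟙_ D))
  | n + 1 =>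
    have := isCofibrant_pw_succ X n
    isCofibrant_tensor X (pw (n + 1) X)

-- The unit need not be cofibrant, so the power of exponent zero needs the unit axiom.
lemma fibration_eHomWhiskerLeft_pw (X : D) [IsCofibrant X] (n : ℕ) {Y Z : D} (p : Y ⟶ Z)
    [Fibration p] : Fibration (eHomWhiskerLeft SSet.{v} (pw n X) p) := by
  cases n with
  | zero => exact (OperadicModelCategory.unit_fibration p).1
  | succ n => exact fibration_eHomWhiskerLeft _ p

lemma kanComplex_sHom_pw (X : D) [IsCofibrant X] (n : ℕ) (Y : D) [IsFibrant Y] :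
    KanComplex (sHom (pw n X) Y) := by
  obtain ⟨T, ⟨terminal⟩, terminal_sHom⟩ := exists_terminal (D := D)
  have : Fibration (terminal.from Y) := (isFibrant_iff_of_isTerminal _ terminal).1 inferInstance
  exact (isFibrant_iff_of_isTerminal _ (terminal_sHom (pw n X)).some).2
    (fibration_eHomWhiskerLeft_pw X n (terminal.from Y))

end MappingSpaces

section LocalEquivalences

variable {D : Type u} [Category.{v} D] [SimplicialCategory D]

/-- The `Y`-local equivalences: the morphisms which induce weak equivalences on mapping spaces
to `Y`. These mapping spaces are not derived. -/
def localEquivalences (Y : D) : MorphismProperty D :=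
  (sWeq.{v}.inverseImage ((sHomFunctor D).flip.obj Y)).unop

instance (Y : D) : (localEquivalences Y).HasTwoOutOfThreeProperty :=
  inferInstanceAs (MorphismProperty.unop _).HasTwoOutOfThreeProperty

lemma localEquivalences_of_isIso (Y : D) {A B : D} (g : A ⟶ B) [IsIso g] :
    localEquivalences Y g :=
  sWeq_of_isIso (((sHomFunctor D).flip.obj Y).map g.op)

instance (Y : D) : (localEquivalences Y).RespectsIso :=
  MorphismProperty.respectsIso_of_isStableUnderComposition fun _ _ g (_ : IsIso g) =>
    localEquivalences_of_isIso Y g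

variable [ModelCategory D] [MonoidalCategory D] [SymmetricCategory D]
  [SymmetricMonoidalEnrichment D] [OperadicModelCategory D]

lemma localEquivalences_of_weakEquivalence (Y : D) [IsFibrant Y] {A B : D} (g : A ⟶ B)
    [IsCofibrant A] [IsCofibrant B] [WeakEquivalence g] : localEquivalences Y g :=
  have := isIso_map_weq_left g Y
  sWeq_of_isIso_map_Q (eHomWhiskerRight SSet.{v} g Y)

/-- The comparison of the derived tensor product with the tensor product of cofibrant objects. -/
def derivedTensorIso : (((Functor.whiskeringLeft₂ (Ho D)).obj (CofibrantObject.ι ⋙ toHo D)).obj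
    (CofibrantObject.ι ⋙ toHo D)).obj (derivedTensor D) ≅ cofTensor D :=
  Localization.Lifting₂.iso (CofibrantObject.ι ⋙ toHo D) (CofibrantObject.ι ⋙ toHo D)
    (weakEquivalences (CofibrantObject D)) (weakEquivalences (CofibrantObject D)) (cofTensor D)
    (Localization.lift₂ (cofTensor D) (cofTensor_inverts D) (CofibrantObject.ι ⋙ toHo D)
      (CofibrantObject.ι ⋙ toHo D))

/-- The comparison of the derived mapping spaces with the mapping spaces from cofibrant to fibrant
objects. -/
def derivedMapIso : (((Functor.whiskeringLeft₂ HoSSet.{v}).obj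
    (CofibrantObject.ι ⋙ toHo D).op).obj (FibrantObject.ι ⋙ toHo D)).obj (derivedMap D) ≅
      cofFibMap D :=
  Localization.Lifting₂.iso (CofibrantObject.ι ⋙ toHo D).op (FibrantObject.ι ⋙ toHo D)
    (weakEquivalences (CofibrantObject D)).op (weakEquivalences (FibrantObject D)) (cofFibMap D)
    (Localization.lift₂ (cofFibMap D) (cofFibMap_inverts D) (CofibrantObject.ι ⋙ toHo D).op
      (FibrantObject.ι ⋙ toHo D))

/-- The derived tensor product of two cofibrant objects is their tensor product. -/
def dtensIso (A B : D) [IsCofibrant A] [IsCofibrant B] :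
    dtens ((toHo D).obj A) ((toHo D).obj B) ≅ (toHo D).obj (A ⊗ B) :=
  (derivedTensorIso.app (CofibrantObject.mk A)).app (CofibrantObject.mk B)

lemma dtensIso_naturality_right (A : D) [IsCofibrant A] {B C : D} [IsCofibrant B] [IsCofibrant C]
    (f : B ⟶ C) : ((derivedTensor D).obj ((toHo D).obj A)).map ((toHo D).map f) ≫
      (dtensIso A C).hom = (dtensIso A B).hom ≫ (toHo D).map (A ◁ f) :=
  (derivedTensorIso.hom.app (CofibrantObject.mk A)).naturality (CofibrantObject.homMk f)

/-- The derived tensor product of two isomorphisms. -/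
def dtensMapIso {a a' b b' : Ho D} (e : a ≅ a') (e' : b ≅ b') : dtens a b ≅ dtens a' b' :=
  ((derivedTensor D).mapIso e).app b ≪≫ ((derivedTensor D).obj a').mapIso e'

/-- The morphisms of the homotopy category which induce isomorphisms on derived mapping spaces
to `z`. -/
def derivedLocalEquivalences (z : Ho D) : MorphismProperty (Ho D) :=
  ((MorphismProperty.isomorphisms HoSSet.{v}).inverseImage ((derivedMap D).flip.obj z)).unop

instance (z : Ho D) : (derivedLocalEquivalences z).RespectsIso :=
  inferInstanceAs (MorphismProperty.unop _).RespectsIso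

lemma derivedLocalEquivalences_of_iso {z z' : Ho D} (e : z ≅ z') {a b : Ho D} {g : a ⟶ b}
    (hg : derivedLocalEquivalences z g) : derivedLocalEquivalences z' g :=
  (NatIso.isIso_map_iff ((derivedMap D).flip.mapIso e) g.op).1 hg

lemma localEquivalences_of_derivedLocalEquivalences (Y : D) [IsFibrant Y] {A B : D}
    [IsCofibrant A] [IsCofibrant B] (g : A ⟶ B)
    (hg : derivedLocalEquivalences ((toHo D).obj Y) ((toHo D).map g)) : localEquivalences Y g := by
  have : IsIso (sWeq.{v}.Q.map (eHomWhiskerRight SSet.{v} g Y)) :=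
    (NatIso.isIso_map_iff (((flipFunctor _ _ _).mapIso derivedMapIso).app (FibrantObject.mk Y))
      (CofibrantObject.homMk g).op).1 hg
  exact sWeq_of_isIso_map_Q (eHomWhiskerRight SSet.{v} g Y)

/-- Naturality of the adjunction map in the middle variable exhibits `(a ⊗ η)^*` as a conjugate
of `Map(a, η^*)`. -/
lemma WeakFunctionObject.derivedLocalEquivalences_tensor (W : WeakFunctionObject D) {x y : Ho D}
    {η : x ⟶ y} (hη : W.IsRigid η) {a : Ho D} (hx : W.ProvidesAdjoint a x y)
    (hy : W.ProvidesAdjoint a y y) :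
    derivedLocalEquivalences y (((derivedTensor D).obj a).map η) := by
  have : IsIso ((W.F.map η.op).app y) := hη
  have : IsIso (W.adj a x y) := hx
  have : IsIso (W.adj a y y) := hy
  have : IsIso (((derivedMap D).map (((derivedTensor D).obj a).map η).op).app y ≫
      W.adj a x y) := by
    rw [W.adj_natural_middle a η y]
    infer_instance
  exact IsIso.of_isIso_comp_right (((derivedMap D).map _).app y) (W.adj a x y)

lemma WeakFunctionObject.localEquivalences_whiskerLeft (W : WeakFunctionObject D) {x y : Ho D}
    {η : x ⟶ y} (hη : W.IsRigid η) {a : Ho D} (hx : W.ProvidesAdjoint a x y)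
    (hy : W.ProvidesAdjoint a y y) {X Y A : D} [IsCofibrant X] [IsCofibrant Y] [IsFibrant Y]
    [IsCofibrant A] {f : X ⟶ Y} (e : Arrow.mk ((toHo D).map f) ≅ Arrow.mk η)
    (i : (toHo D).obj A ≅ a) : localEquivalences Y (A ◁ f) := by
  apply localEquivalences_of_derivedLocalEquivalences
  have tensor_η := derivedLocalEquivalences_of_iso (Arrow.rightFunc.mapIso e).symm
    (W.derivedLocalEquivalences_tensor hη hx hy)
  have whiskerLeft_f : Arrow.mk ((toHo D).map (A ◁ f)) ≅
      Arrow.mk (((derivedTensor D).obj ((toHo D).obj A)).map ((toHo D).map f)) :=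
    (Arrow.isoMk (dtensIso A X) (dtensIso A Y) (dtensIso_naturality_right A f).symm).symm
  have replace_A : Arrow.mk (((derivedTensor D).obj ((toHo D).obj A)).map ((toHo D).map f)) ≅
      Arrow.mk (((derivedTensor D).obj a).map ((toHo D).map f)) :=
    Arrow.isoMk (((derivedTensor D).mapIso i).app _) (((derivedTensor D).mapIso i).app _)
      (((derivedTensor D).map i.hom).naturality _).symm
  have replace_f : Arrow.mk (((derivedTensor D).obj a).map ((toHo D).map f)) ≅
      Arrow.mk (((derivedTensor D).obj a).map η) :=
    ((derivedTensor D).obj a).mapArrow.mapIso e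
  exact ((derivedLocalEquivalences _).arrow_mk_iso_iff
    (whiskerLeft_f ≪≫ replace_A ≪≫ replace_f)).2 tensor_η

end LocalEquivalences

section CofibrantPowers

variable {D : Type u} [Category.{v} D] [MonoidalCategory D]

/-- Whiskering by `A` on the left and by `B` on the right amounts to whiskering by `A ⊗ B` on
the left. -/
def whiskerLeftWhiskerRightIso [SymmetricCategory D] (A B : D) {X Y : D} (f : X ⟶ Y) :
    Arrow.mk ((A ◁ f) ▷ B) ≅ Arrow.mk ((A ⊗ B) ◁ f) :=
  Arrow.isoMk (α_ _ _ _ ≪≫ whiskerLeftIso A (β_ X B) ≪≫ (α_ _ _ _).symm)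
    (α_ _ _ _ ≪≫ whiskerLeftIso A (β_ Y B) ≪≫ (α_ _ _ _).symm) (by
      have braiding : A ◁ f ▷ B ≫ A ◁ (β_ Y B).hom = A ◁ (β_ X B).hom ≫ A ◁ B ◁ f := by
        rw [← whiskerLeft_comp, BraidedCategory.braiding_naturality_left, whiskerLeft_comp]
      simp [reassoc_of% braiding])

/-- Whiskering by `Y` and then by `B` on the right amounts to whiskering by `B ⊗ Y` on the
right. -/
def whiskerRightWhiskerRightIso [SymmetricCategory D] {A A' : D} (g : A ⟶ A') (Y B : D) :
    Arrow.mk ((g ▷ Y) ▷ B) ≅ Arrow.mk (g ▷ (B ⊗ Y)) :=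
  Arrow.isoMk (α_ _ _ _ ≪≫ whiskerLeftIso A (β_ Y B))
    (α_ _ _ _ ≪≫ whiskerLeftIso A' (β_ Y B)) (by
      dsimp
      rw [Category.assoc, whiskerLeftIso_hom, whiskerLeftIso_hom, whisker_exchange,
        ← associator_naturality_left_assoc])

variable [ModelCategory D]

/-- Tensor powers of `X`, bracketed to the left and starting with a cofibrant replacement of the
unit object, so that they are cofibrant in every exponent when `X` is. -/
def cofPow (X : D) : ℕ → D
  | 0 => CofibrantObject.HoCat.resolutionObj (𝟙_ D)
  | n + 1 => cofPow X n ⊗ X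

/-- The action of a morphism on the powers `cofPow`. -/
def cofPowMap {X Y : D} (f : X ⟶ Y) : ∀ n, cofPow X n ⟶ cofPow Y n
  | 0 => 𝟙 _
  | n + 1 => cofPowMap f n ⊗ₘ f

lemma cofPowMap_succ_whiskerRight {X Y : D} (f : X ⟶ Y) (n : ℕ) (B : D) :
    cofPowMap f (n + 1) ▷ B = (cofPow X n ◁ f) ▷ B ≫ (cofPowMap f n ▷ Y) ▷ B := by
  rw [← comp_whiskerRight]
  exact congrArg (· ▷ B) (tensorHom_def' (cofPowMap f n) f)

variable [SymmetricCategory D]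

/-- The comparison of the powers `cofPow` with the strict powers `pw`. -/
def cofPowTo (X : D) : ∀ n, cofPow X n ⟶ pw n X
  | 0 => CofibrantObject.HoCat.pResolutionObj (𝟙_ D)
  | n + 1 => cofPowTo X n ▷ X ≫ (β_ (pw n X) X).hom

lemma cofPowTo_naturality {X Y : D} (f : X ⟶ Y) :
    ∀ n, cofPowTo X n ≫ pmap n f = cofPowMap f n ≫ cofPowTo Y n
  | 0 => (Category.comp_id _).trans (Category.id_comp _).symm
  | n + 1 => by
    change (cofPowTo X n ▷ X ≫ (β_ (pw n X) X).hom) ≫ (f ⊗ₘ pmap n f) =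
      (cofPowMap f n ⊗ₘ f) ≫ cofPowTo Y n ▷ Y ≫ (β_ (pw n Y) Y).hom
    rw [Category.assoc, ← BraidedCategory.braiding_naturality, ← tensorHom_id,
      tensorHom_comp_tensorHom_assoc, cofPowTo_naturality f n, Category.id_comp, ← tensorHom_id,
      tensorHom_comp_tensorHom_assoc, Category.comp_id]

variable [SimplicialCategory D]

/-- The factors of `X` are replaced by `Y` one at a time: this turns `X ^ (n + 1) ⊗ Y ^ m` into
`X ^ n ⊗ Y ^ (m + 1)` along `(X ^ n ⊗ Y ^ m) ⊗ f`. -/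
lemma localEquivalences_cofPowMap_whiskerRight
    {X Y : D} {f : X ⟶ Y} (hf : ∀ n m, localEquivalences Y ((cofPow X n ⊗ cofPow Y m) ◁ f)) :
    ∀ n m, localEquivalences Y (cofPowMap f n ▷ cofPow Y m)
  | 0, m => by
    have : IsIso (cofPowMap f 0 ▷ cofPow Y m) :=
      inferInstanceAs (IsIso (𝟙 (CofibrantObject.HoCat.resolutionObj (𝟙_ D)) ▷ cofPow Y m))
    exact localEquivalences_of_isIso Y _
  | n + 1, m => by
    rw [cofPowMap_succ_whiskerRight]
    exact (localEquivalences Y).comp_mem _ _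
      (((localEquivalences Y).arrow_mk_iso_iff (whiskerLeftWhiskerRightIso _ _ f)).2 (hf n m))
      (((localEquivalences Y).arrow_mk_iso_iff (whiskerRightWhiskerRightIso _ _ _)).2
        (localEquivalences_cofPowMap_whiskerRight hf n (m + 1)))

variable [SymmetricMonoidalEnrichment D] [OperadicModelCategory D]

instance isCofibrant_cofPow (X : D) [IsCofibrant X] : ∀ n, IsCofibrant (cofPow X n)
  | 0 => inferInstanceAs (IsCofibrant (CofibrantObject.HoCat.resolutionObj (𝟙_ D)))
  | n + 1 =>
    have := isCofibrant_cofPow X n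
    isCofibrant_tensor _ X

instance weakEquivalence_cofPowTo (X : D) [IsCofibrant X] : ∀ n, WeakEquivalence (cofPowTo X n)
  | 0 => inferInstanceAs (WeakEquivalence (CofibrantObject.HoCat.pResolutionObj (𝟙_ D)))
  | n + 1 =>
    have := weakEquivalence_cofPowTo X n
    have := OperadicModelCategory.weq_whiskerRight (cofPowTo X n) X
    inferInstanceAs (WeakEquivalence (cofPowTo X n ▷ X ≫ (β_ (pw n X) X).hom))

/-- The powers `cofPow` represent the derived tensor powers. -/
def cofPowIso (X : D) [IsCofibrant X] {x : Ho D} (e : (toHo D).obj X ≅ x) :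
    ∀ n, (toHo D).obj (cofPow X n) ≅ dpow x n
  | 0 => Localization.isoOfHom (toHo D) (weakEquivalences D) (cofPowTo X 0)
      (weakEquivalence_cofPowTo X 0).mem
  | n + 1 => (dtensIso (cofPow X n) X).symm ≪≫ dtensMapIso (cofPowIso X e n) e

variable {X Y : D} [IsCofibrant X] [IsCofibrant Y] [IsFibrant Y] {f : X ⟶ Y}

lemma localEquivalences_cofPowMap
    (hf : ∀ n m, localEquivalences Y ((cofPow X n ⊗ cofPow Y m) ◁ f)) (n : ℕ) :
    localEquivalences Y (cofPowMap f n) := by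
  let r := CofibrantObject.HoCat.pResolutionObj (𝟙_ D)
  have removeUnit (Z : D) [IsCofibrant Z] : localEquivalences Y (Z ◁ r ≫ (ρ_ Z).hom) := by
    have := OperadicModelCategory.weq_whiskerLeft Z r
    exact localEquivalences_of_weakEquivalence Y _
  refine (localEquivalences Y).of_precomp _ _ (removeUnit (cofPow X n)) ?_
  have naturality : (cofPow X n ◁ r ≫ (ρ_ _).hom) ≫ cofPowMap f n =
      cofPowMap f n ▷ cofPow Y 0 ≫ cofPow Y n ◁ r ≫ (ρ_ _).hom := by
    rw [Category.assoc, ← rightUnitor_naturality]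
    exact whisker_exchange_assoc (cofPowMap f n) r (ρ_ (cofPow Y n)).hom
  rw [naturality]
  exact (localEquivalences Y).comp_mem _ _ (localEquivalences_cofPowMap_whiskerRight hf n 0)
    (removeUnit _)

lemma localEquivalences_pmap
    (hf : ∀ n m, localEquivalences Y ((cofPow X n ⊗ cofPow Y m) ◁ f)) (n : ℕ) :
    localEquivalences Y (pmap n f) := by
  cases n with
  | zero =>
    have : IsIso (pmap 0 f) := inferInstanceAs (IsIso (𝟙 (𝟙_ D)))
    exact localEquivalences_of_isIso Y _
  | succ n =>
    refine (localEquivalences Y).of_precomp _ _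
      (localEquivalences_of_weakEquivalence Y (cofPowTo X (n + 1))) ?_
    rw [cofPowTo_naturality]
    exact (localEquivalences Y).comp_mem _ _ (localEquivalences_cofPowMap hf _)
      (localEquivalences_of_weakEquivalence Y (cofPowTo Y (n + 1)))

end CofibrantPowers

section EndomorphismOperads

variable {D : Type u} [Category.{v} D] [SimplicialCategory D] [MonoidalCategory D]
  [SymmetricCategory D] [SymmetricMonoidalEnrichment D]

/-- The projection from the operations of the endomorphism operad of `f : X ⟶ Y` to those of the
endomorphism operad of `Y`. -/
def levelEndArrowToTarget {X Y : D} (f : X ⟶ Y) (n : ℕ) :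
    (SimplicialOperad.level n).obj (endArrow f) ⟶ sHom (pw n Y) Y where
  app q := ↾fun p => p.1.2

lemma isPullback_level_endArrow {X Y : D} (f : X ⟶ Y) (n : ℕ) :
    IsPullback (levelEndArrowToTarget f n) ((SimplicialOperad.level n).map (endArrowToSource f))
      (eHomWhiskerRight SSet.{v} (pmap n f) Y) (eHomWhiskerLeft SSet.{v} (pw n X) f) := by
  refine IsPullback.of_forall_isPullback_app fun q => (Limits.Types.isPullback_iff _ _ _ _).2
    ⟨?_, ?_, ?_⟩
  · ext p
    exact p.2.symm
  · exact fun p p' h => Subtype.ext (Prod.ext h.2 h.1)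
  · exact fun b c h => ⟨⟨(c, b), h.symm⟩, rfl, rfl⟩

end EndomorphismOperads

section RigidMorphisms

open SSet SSet.modelCategoryQuillen

variable {D : Type u} [Category.{v} D] [ModelCategory D]

lemma exists_represents {x y : Ho D} (η : x ⟶ y) :
    ∃ (X Y : D) (f : X ⟶ Y), Represents f η := by
  have : (BifibrantObject.ι ⋙ toHo D).EssSurj :=
    Localization.essSurj _ (weakEquivalences (BifibrantObject D))
  let X := (BifibrantObject.ι ⋙ toHo D).objPreimage x
  let Y := (BifibrantObject.ι ⋙ toHo D).objPreimage y
  let eX : (toHo D).obj X.obj ≅ x := (BifibrantObject.ι ⋙ toHo D).objObjPreimageIso x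
  let eY : (toHo D).obj Y.obj ≅ y := (BifibrantObject.ι ⋙ toHo D).objObjPreimageIso y
  obtain ⟨g, hg⟩ := map_surjective_of_isLocalization (toHo D) (X := X.obj) (Y := Y.obj)
    (eX.hom ≫ η ≫ eY.inv)
  let h := MorphismProperty.factorizationData (trivialCofibrations D) (fibrations D) g
  have : Cofibration h.i := ⟨h.hi.1⟩
  have : WeakEquivalence h.i := ⟨h.hi.2⟩
  have : Fibration h.p := ⟨h.hp⟩
  have : IsIso ((toHo D).map h.i) :=
    Localization.inverts (toHo D) (weakEquivalences D) _ (mem_weakEquivalences _)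
  have fac : (toHo D).map h.i ≫ (toHo D).map h.p = eX.hom ≫ η ≫ eY.inv := by
    rw [← Functor.map_comp, h.fac, hg]
  refine ⟨h.Z, Y.obj, h.p, inferInstance, isCofibrant_of_cofibration h.i,
    isFibrant_of_fibration h.p, inferInstance, inferInstance,
    ⟨Arrow.isoMk ((asIso ((toHo D).map h.i)).symm ≪≫ eX) eY ?_⟩⟩
  simp [reassoc_of% fac]

variable [SimplicialCategory D] [MonoidalCategory D] [SymmetricCategory D]
  [SymmetricMonoidalEnrichment D] [OperadicModelCategory D]

section

variable {X Y : D} [IsCofibrant X] [IsCofibrant Y] [IsFibrant Y] (f : X ⟶ Y) [Fibration f]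

lemma kanComplex_level_endArrow (n : ℕ) :
    KanComplex ((SimplicialOperad.level n).obj (endArrow f)) := by
  have := kanComplex_sHom_pw Y n Y
  have : Fibration (levelEndArrowToTarget f n) := by
    rw [fibration_iff]
    exact MorphismProperty.of_isPullback (isPullback_level_endArrow f n).flip
      ((fibration_iff _).1 (fibration_eHomWhiskerLeft_pw X n f))
  exact isFibrant_of_fibration (levelEndArrowToTarget f n)

lemma operadWeq_endArrowToSource [IsFibrant X]
    (hf : ∀ n m, localEquivalences Y ((cofPow X n ⊗ cofPow Y m) ◁ f)) :
    operadWeq (endArrowToSource f) := by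
  intro n
  have := kanComplex_sHom_pw X n X
  have := kanComplex_sHom_pw X n Y
  have := kanComplex_sHom_pw Y n Y
  have := fibration_eHomWhiskerLeft_pw X n f
  exact sWeq_of_isPullback (B' := sHom (pw n X) X) (isPullback_level_endArrow f n)
    (localEquivalences_pmap hf n)

end

lemma Represents.localEquivalences_whiskerLeft {W : WeakFunctionObject D} {x y : Ho D} {η : x ⟶ y}
    (hη : W.IsRigid η)
    (hx : ∀ n m : ℕ, W.ProvidesAdjoint (dtens (dpow x n) (dpow y m)) x y)
    (hy : ∀ n m : ℕ, W.ProvidesAdjoint (dtens (dpow x n) (dpow y m)) y y)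
    {X Y : D} {f : X ⟶ Y} (hf : Represents f η) (n m : ℕ) :
    localEquivalences Y ((cofPow X n ⊗ cofPow Y m) ◁ f) := by
  have := hf.cofibrant_source
  have := hf.cofibrant_target
  have := hf.fibrant_target
  obtain ⟨e⟩ := hf.iso
  exact W.localEquivalences_whiskerLeft hη (hx n m) (hy n m) e ((dtensIso _ _).symm ≪≫
    dtensMapIso (cofPowIso X (Arrow.leftFunc.mapIso e) n)
      (cofPowIso Y (Arrow.rightFunc.mapIso e) m))

end RigidMorphisms

end OperadicRigidity

end

theorem theorem3p3 {D : Type u} [Category.{v} D] [ModelCategory D] [SimplicialCategory D]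
    [MonoidalCategory D] [SymmetricCategory D] [SymmetricMonoidalEnrichment D]
    [OperadicModelCategory D] (W : WeakFunctionObject D) {x y : Ho D} (η : x ⟶ y)
    (hη : W.IsRigid η)
    (hx : ∀ n m : ℕ, W.ProvidesAdjoint (dtens (dpow x n) (dpow y m)) x y)
    (hy : ∀ n m : ℕ, W.ProvidesAdjoint (dtens (dpow x n) (dpow y m)) y y) :
    (∃ (X Y : D) (f : X ⟶ Y), Represents f η) ∧
    ∀ (X Y : D) (f : X ⟶ Y), Represents f η →
      operadWeq (endArrowToSource f) ∧
      ∀ O : SimplicialOperad.{v}, IsCofibrantOperad O → ∀ θ : O ⟶ endOperad X,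
        Contractible (homotopyFiber (operadMapPost O (endArrowToSource f))
          (operadMapVertex θ)) := by
  refine ⟨exists_represents η, fun X Y f hf => ?_⟩
  have ⟨_, _, _, _, _, _⟩ := hf
  have weq : operadWeq (endArrowToSource f) :=
    operadWeq_endArrowToSource f (hf.localEquivalences_whiskerLeft hη hx hy)
  exact ⟨weq, fun O hO θ => contractible_homotopyFiber_operadMapPost hO weq
    (kanComplex_level_endArrow f) (fun n => kanComplex_sHom_pw X n X) θ⟩
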